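/- **Conventions.** For $V\in L^\infty_c(\mathbb R;\mathbb C)$ (essentially bounded, compactly supported) the resolvent $R_V(\lambda)=(-\frac{d^2}{dx^2}+V-\lambda^2)^{-1}:L^2(\mathbb R)\to L^2(\mathbb R)$, defined for $\operatorname{Im}\lambda\gg1$, continues meromorphically to $\lambda\in\mathbb C$ as an operator $L^2_c(\mathbb R)\to L^2_{\rm loc}(\mathbb R)$. The poles are the *resonances* of $-\frac{d^2}{dx^2}+V$, and $\mathcal R_V$ denotes the set of resonances; the multiplicity of a resonance $\lambda\ne0$ is the rank of the residue of $R_V$ at $\lambda$. For integers $j,k\ge0$ and $a<b$, write $V\in\mathcal V_{j,k}([a,b])$ if $\operatorname{ch}\operatorname{supp}V=[a,b]$ (convex hull of the support), $V\in C^N([a,b];\mathbb C)$ for some integer $N>\max(j,k)$, and, for some constants $C_1,C_2\in\mathbb C\setminus\{0\}$, $$V(x)\sim C_1(x-a)^j\ (x\to a^+),\qquad V(x)\sim C_2(b-x)^k\ (x\to b^-).$$ **Theorem.** Let $V\in\mathcal V_{j,k}([a,b])$, with constants $C_1,C_2$ as above, and let $W\in L^\infty_c(\mathbb R;\mathbb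 C)$ with $\operatorname{supp}W\subset(a,b)$. 1. There is $M_0>0$ such that for every $M>M_0$ there is $R>0$ for which $$\mathcal R_{V+W}\cap\{\lambda\in\mathbb C:\operatorname{Im}\lambda\le-M\log(1+|\lambda|)\}\cap\{|\lambda|>R\}=\emptyset .$$ 2. If moreover $$\operatorname{supp}W\subset\Big(a+\frac{(j+1)(b-a)}{j+k+4},\;b-\frac{(k+1)(b-a)}{j+k+4}\Big),$$ then there are $R>0$ and $N_+,N_-\in\mathbb N$ such that the resonances of $-\frac{d^2}{dx^2}+V+W$ in $\{|\lambda|>R\}$ are exactly the points $\lambda_n$ $(n>N_+)$ and $\lambda_{-n}$ $(n>N_-)$ of a sequence $$\lambda_{\pm n}=\pm\frac{n\pi}{b-a}\pm\frac{j+k+4}{2(b-a)}\frac{\pi}{2}+i\frac{\log C}{2(b-a)}-i\frac{j+k+4}{2(b-a)}\log\Big(\frac{n\pi}{b-a}\Big)+\varepsilon_{\pm n},$$ where $C=j!\,k!\,C_1C_2/2^{j+k+4}$, $\log C$ is the principal logarithm, and $\varepsilon_{\pm n}\to0$ as $n\to\infty$. These points are pairwise distinct, and each is a resonance of multiplicity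 one. -/

import Mathlib

open MeasureTheory Filter Topology Set

noncomputable section

namespace Resonances

/-- The Hilbert space `L²(ℝ; ℂ)`. -/
abbrev L2 : Type := Lp ℂ 2 (volume : Measure ℝ)

/-- The (essential) support of a function considered up to almost everywhere equality:
the complement of the largest open set on which `f = 0` almost everywhere. -/
def essSupport (f : ℝ → ℂ) : Set ℝ :=
  {x | ∀ U ∈ 𝓝 x, 0 < volume (U ∩ {y | f y ≠ 0})}

/-- `W ∈ L^∞_c(ℝ; ℂ)`: essentially bounded with compact support. -/
def MemLinftyComp (W : ℝ → ℂ) : Prop :=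
  MemLp W ⊤ volume ∧ IsCompact (essSupport W)

/-- `V ∈ 𝒱_{j,k}([a,b])`, with leading coefficients `C₁` at `a` and `C₂` at `b`. -/
structure EndpointClass (j k : ℕ) (a b : ℝ) (C₁ C₂ : ℂ) (V : ℝ → ℂ) : Prop where
  lt : a < b
  hull_support : convexHull ℝ (essSupport V) = Icc a b
  smooth : ∃ N : ℕ, j < N ∧ k < N ∧ ContDiffOn ℝ N V (Icc a b)
  left_ne_zero : C₁ ≠ 0
  right_ne_zero : C₂ ≠ 0
  left_equiv : Asymptotics.IsEquivalent (𝓝[>] a) V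
    (fun x : ℝ => C₁ * ((x - a : ℝ) : ℂ) ^ j)
  right_equiv : Asymptotics.IsEquivalent (𝓝[<] b) V
    (fun x : ℝ => C₂ * ((b - x : ℝ) : ℂ) ^ k)

/-- `u` lies in the domain of the operator `-d²/dx² + V` on `L²(ℝ)` and `(-d²/dx² + V) u = g`.
The derivative is taken in the sense of distributions. For bounded `V` and `u, g ∈ L²`,
this forces `u'' ∈ L²`, that is `u ∈ H²(ℝ)`. -/
def SchrodingerEq (V : ℝ → ℂ) (u g : L2) : Prop :=
  ∀ φ : ℝ → ℂ, ContDiff ℝ (⊤ : ℕ∞) φ → HasCompactSupport φ →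
    ∫ x, u x * (-(iteratedDeriv 2 φ x) + V x * φ x) = ∫ x, g x * φ x

/-- `T = (-d²/dx² + V - z²)⁻¹` as a bounded operator on `L²(ℝ)`. -/
def IsResolvent (V : ℝ → ℂ) (z : ℂ) (T : L2 →L[ℂ] L2) : Prop :=
  ∀ u f : L2, T f = u ↔ SchrodingerEq V u (f + z ^ 2 • u)

/-- The product of `f ∈ L²(ℝ)` and the characteristic function of `[-r, r]`. -/
def cutoffFun (r : ℝ) (f : L2) : L2 :=
  ((Lp.memLp f).indicator (measurableSet_Icc : MeasurableSet (Icc (-r) r))).toLp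
    ((Icc (-r) r).indicator f)

theorem coeFn_cutoffFun (r : ℝ) (f : L2) :
    cutoffFun r f =ᵐ[volume] (Icc (-r) r).indicator f :=
  MemLp.coeFn_toLp _

theorem cutoffFun_add (r : ℝ) (f g : L2) :
    cutoffFun r (f + g) = cutoffFun r f + cutoffFun r g := by
  apply Lp.ext
  filter_upwards [coeFn_cutoffFun r (f + g), coeFn_cutoffFun r f, coeFn_cutoffFun r g,
    Lp.coeFn_add f g, Lp.coeFn_add (cutoffFun r f) (cutoffFun r g)] with x h1 h2 h3 h4 h5
  rw [h1, h5, Pi.add_apply, h2, h3]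
  by_cases hx : x ∈ Icc (-r) r
  · simp only [indicator_of_mem hx, h4, Pi.add_apply]
  · simp only [indicator_of_notMem hx, add_zero]

theorem cutoffFun_smul (r : ℝ) (c : ℂ) (f : L2) :
    cutoffFun r (c • f) = c • cutoffFun r f := by
  apply Lp.ext
  filter_upwards [coeFn_cutoffFun r (c • f), coeFn_cutoffFun r f,
    Lp.coeFn_smul c f, Lp.coeFn_smul c (cutoffFun r f)] with x h1 h2 h3 h4
  rw [h1, h4, Pi.smul_apply, h2]
  by_cases hx : x ∈ Icc (-r) r
  · simp only [indicator_of_mem hx, h3, Pi.smul_apply]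
  · simp only [indicator_of_notMem hx, smul_zero]

theorem norm_cutoffFun_le (r : ℝ) (f : L2) : ‖cutoffFun r f‖ ≤ 1 * ‖f‖ := by
  rw [one_mul]
  refine Lp.norm_le_norm_of_ae_le ?_
  filter_upwards [coeFn_cutoffFun r f] with x hx
  rw [hx]
  exact norm_indicator_le_norm_self _ _

/-- Multiplication by the characteristic function of `[-r, r]`, as a bounded operator on
`L²(ℝ)`. -/
def cutoff (r : ℝ) : L2 →L[ℂ] L2 :=
  LinearMap.mkContinuous
    { toFun := cutoffFun r
      map_add' := cutoffFun_add r
      map_smul' := cutoffFun_smul r } 1 (norm_cutoffFun_le r)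

/-- `Rc` is the meromorphic continuation to `ℂ` of the resolvent
`z ↦ (-d²/dx² + V - z²)⁻¹`, initially defined for large `Im z`, as an operator from `L²_c(ℝ)` to
`L²_loc(ℝ)`: for every `r`, the cut-off resolvent `𝟙_[-r,r] (-d²/dx² + V - z²)⁻¹ 𝟙_[-r,r]` is
continued, as a meromorphic function with values in the bounded operators on `L²(ℝ)`, by `Rc r`.
The values of `Rc r` at the points of a discrete set are irrelevant. -/
structure IsResolventContinuation (V : ℝ → ℂ) (Rc : ℝ → ℂ → (L2 →L[ℂ] L2)) : Prop where
  meromorphic : ∀ r : ℝ, MeromorphicOn (Rc r) univ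
  eq_resolvent : ∃ A : ℝ, ∀ z : ℂ, A < z.im → ∃ T : L2 →L[ℂ] L2,
    IsResolvent V z T ∧ ∀ r : ℝ, Rc r z = (cutoff r).comp (T.comp (cutoff r))

/-- The set of resonances of `-d²/dx² + V`: the poles of the continued resolvent. -/
def resonances (V : ℝ → ℂ) : Set ℂ :=
  {z | ∃ Rc : ℝ → ℂ → (L2 →L[ℂ] L2), IsResolventContinuation V Rc ∧
    ∃ r : ℝ, meromorphicOrderAt (Rc r) z < 0}

/-- `A` is the residue at `z` of the operator-valued function `F`. -/
def IsResidue (F : ℂ → (L2 →L[ℂ] L2)) (z : ℂ) (A : L2 →L[ℂ] L2) : Prop :=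
  ∀ᶠ ρ in 𝓝[>] (0 : ℝ), (2 * (Real.pi : ℂ) * Complex.I)⁻¹ • (∮ w in C(z, ρ), F w) = A

/-- The multiplicity of `z ≠ 0` as a resonance of `-d²/dx² + V` is `m`: the rank of the residue
at `z` of the continued resolvent, as an operator from `L²_c(ℝ)` to `L²_loc(ℝ)`, is `m`. -/
def HasResonanceMultiplicity (V : ℝ → ℂ) (z : ℂ) (m : ℕ) : Prop :=
  ∃ Rc : ℝ → ℂ → (L2 →L[ℂ] L2), IsResolventContinuation V Rc ∧
    ∀ᶠ r in (atTop : Filter ℝ), ∃ A : L2 →L[ℂ] L2,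
      IsResidue (Rc r) z A ∧ LinearMap.rank (A : L2 →ₗ[ℂ] L2) = (m : Cardinal)

/-- The region above the logarithmic curve `Im z = - M log (1 + |z|)`. -/
def aboveLogCurve (M : ℝ) : Set ℂ :=
  {z | -M * Real.log (1 + ‖z‖) < z.im}

/-- The `n`-th term (`s = 1`) or the `-n`-th term (`s = -1`), without its error term, of the
logarithmic sequence with parameters `p = j + k + 4` and `C`, for an interval of length `L`. -/
def logSequence (L : ℝ) (p : ℕ) (C : ℂ) (s : ℝ) (n : ℕ) : ℂ :=
  s * (n * Real.pi / L) + s * (p / (2 * L) * (Real.pi / 2))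
    + Complex.I * (Complex.log C / (2 * L))
    - Complex.I * (p / (2 * L) * Real.log (n * Real.pi / L))

end Resonances

end

/-!
The resonances `z` of `-d²/dx² + U`, `U = V + W`, are the zeros of a determinant, and the endpoint
behaviour of `V` gives its asymptotics below the real axis.

**The determinant.** With `s = 2iz` and `w = e^{iz(x-a)} f`, where `f` is the solution equal to
`e^{-iz(x-a)}` on the left of the support, one has `w'' = s w' + U w`, `w(a) = 1`, `w'(a) = 0`
(`IsJostSol`). The function `F(s) = w(b) - w'(b) / s` vanishes if and only if `f` is outgoing on both
sides. On every interval `[-r, r]` that contains `[a, b]` the resolvent is an explicit Volterra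
series plus a rank one operator divided by a multiple of `F` (`cutResolvent`), so it continues
meromorphically to the plane. A zero of `F` which is simple gives a simple pole with residue of rank
one (`resonance_of_simple_zero`), and where `F` does not vanish there is no pole
(`jostFun_eq_zero_of_mem_resonances`). That the explicit operator agrees with the resolvent on `L²(ℝ)`
for large `Im z` follows as an outgoing solution on `[-r, r]` extends by decaying exponentials to a
solution in `L²(ℝ)` (`IsSolution.cutoff_resolvent_eq`); the resolvent itself is obtained from the free
one by a Neumann series, and the free one from an energy estimate on test functions and the density
of the range of `-d²/dx² - z²`.

**The asymptotics.** Near `a` there is an approximate solution of the equation for `w` in powers of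
`1/s` (`IsApproxSol`), and one near `b` after a reflection. For large `Re s` the function `F(s)` is,
up to controlled errors, the Wronskian of `w` with the approximate solution at `b`
(`isPrim_wronskian`). The order of vanishing of `V` at an endpoint determines the power of `1/s` that
is reflected there, and the leading exponential term of `F` is the product of the two reflections:
`F(s) ≈ 1 - ρ s^{-(j+k+4)} e^{sL}` with `ρ = j! k! C₁ C₂` and `L = b - a` (`jost_asymptotics`).
The perturbation `W`, supported at distances `δ` and `δ'` from the endpoints, enters through terms
with fewer powers of `1/s`, but of exponential size at most `e^{s(L-δ)}` or `e^{s(L-δ')}`.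

**The zeros.** Where `Re s` is larger than a large multiple of `log |s|` the exponential factors
win and the term with `e^{sL}` dominates, so that there are no zeros (`ne_zero_of_log_le_re`). If the
support of `W` is small enough, the contribution of `W` is negligible wherever the first two terms are comparable
(`relative_error_small`). All large zeros are then close to the solutions of
`ρ s^{-(j+k+4)} e^{sL} = 1`, and each of those attracts exactly one zero, which is simple, by a
contraction argument (`exists_unique_zero`, `zeros_asymptotics`).
-/

noncomputable section

namespace Resonances

section


/-! ### Absolutely continuous primitives -/

/-- `f` is an absolutely continuous primitive of `f'` on `[a, b]`. The derivative is recorded as an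
integrable function, so that it only matters almost everywhere. -/
structure IsPrim (f f' : ℝ → ℂ) (a b : ℝ) : Prop where
  le : a ≤ b
  integrable : IntervalIntegrable f' volume a b
  eq : ∀ x ∈ Icc a b, f x = f a + ∫ t in a..x, f' t

theorem absolutelyContinuousOnInterval_const (c : ℂ) (a b : ℝ) :
    AbsolutelyContinuousOnInterval (fun _ : ℝ => c) a b :=
  (LipschitzWith.const' (K := 0) c).lipschitzOnWith.absolutelyContinuousOnInterval

theorem absolutelyContinuousOnInterval_complex_integral {g : ℝ → ℂ} {a b : ℝ}
    (hg : IntervalIntegrable g volume a b) :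
    AbsolutelyContinuousOnInterval (fun x => ∫ t in a..x, g t) a b := by
  have key : ∀ x ∈ uIcc a b, ∫ t in a..x, g t
      = (∫ t in a..x, (g t).re) • (1 : ℂ) + (∫ t in a..x, (g t).im) • Complex.I := by
    intro x hx
    have hgx : IntervalIntegrable g volume a x := hg.mono_set (uIcc_subset_uIcc_left hx)
    have hre : IntervalIntegrable (fun t => (g t).re) volume a x :=
      ⟨hgx.1.re, hgx.2.re⟩
    have him : IntervalIntegrable (fun t => (g t).im) volume a x :=
      ⟨hgx.1.im, hgx.2.im⟩
    rw [← intervalIntegral.integral_smul_const, ← intervalIntegral.integral_smul_const,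
      ← intervalIntegral.integral_add]
    · congr 1
      ext t
      simp [Complex.re_add_im]
    · exact ⟨hre.1.smul_const _, hre.2.smul_const _⟩
    · exact ⟨him.1.smul_const _, him.2.smul_const _⟩
  have hre : IntervalIntegrable (fun t => (g t).re) volume a b := ⟨hg.1.re, hg.2.re⟩
  have him : IntervalIntegrable (fun t => (g t).im) volume a b := ⟨hg.1.im, hg.2.im⟩
  have h := ((hre.absolutelyContinuousOnInterval_intervalIntegral (c := a) left_mem_uIcc).fun_smul
    (absolutelyContinuousOnInterval_const 1 a b)).fun_add
    ((him.absolutelyContinuousOnInterval_intervalIntegral (c := a) left_mem_uIcc).fun_smul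
    (absolutelyContinuousOnInterval_const Complex.I a b))
  unfold AbsolutelyContinuousOnInterval at h ⊢
  refine h.congr' ?_
  rw [EventuallyEq, eventually_inf_principal]
  filter_upwards with E hE
  refine Finset.sum_congr rfl fun i hi => ?_
  have := hE.1 i hi
  rw [key _ this.1, key _ this.2]

namespace IsPrim

variable {f f' g g' : ℝ → ℂ} {a b : ℝ}

theorem continuousOn (hf : IsPrim f f' a b) : ContinuousOn f (Icc a b) := by
  have h := intervalIntegral.continuousOn_primitive_interval' hf.integrable
    (left_mem_uIcc : a ∈ uIcc a b)
  rw [uIcc_of_le hf.le] at h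
  exact (continuousOn_const.add h).congr hf.eq

theorem integrable_sub (hf : IsPrim f f' a b) {x y : ℝ} (hx : x ∈ Icc a b) (hy : y ∈ Icc a b) :
    IntervalIntegrable f' volume x y :=
  hf.integrable.mono_set (by
    rw [uIcc_of_le hf.le]
    exact uIcc_subset_Icc hx hy)

theorem integral_eq (hf : IsPrim f f' a b) {x y : ℝ} (hx : x ∈ Icc a b) (hy : y ∈ Icc a b) :
    ∫ t in x..y, f' t = f y - f x := by
  have ha : a ∈ Icc a b := left_mem_Icc.2 hf.le
  have h := intervalIntegral.integral_add_adjacent_intervals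
    (hf.integrable_sub ha hx) (hf.integrable_sub hx hy)
  rw [hf.eq x hx, hf.eq y hy, ← h]
  ring

theorem mono (hf : IsPrim f f' a b) {c d : ℝ} (hac : a ≤ c) (hcd : c ≤ d) (hdb : d ≤ b) :
    IsPrim f f' c d := by
  have hc : c ∈ Icc a b := ⟨hac, hcd.trans hdb⟩
  refine ⟨hcd, hf.integrable_sub hc ⟨hac.trans hcd, hdb⟩, fun x hx => ?_⟩
  rw [hf.integral_eq hc ⟨hac.trans hx.1, hx.2.trans hdb⟩]
  ring

theorem congr (hf : IsPrim f f' a b) {F F' : ℝ → ℂ} (h : ∀ x ∈ Icc a b, F x = f x)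
    (h' : ∀ᵐ x, x ∈ Ioc a b → F' x = f' x) : IsPrim F F' a b := by
  have h'' : ∀ᵐ x, x ∈ Ioc a b → f' x = F' x := by
    filter_upwards [h'] with x hx hx' using (hx hx').symm
  refine ⟨hf.le, hf.integrable.congr_ae ?_, fun x hx => ?_⟩
  · rw [uIoc_of_le hf.le]
    exact (ae_restrict_iff' measurableSet_Ioc).2 h''
  · rw [h x hx, h a (left_mem_Icc.2 hf.le), hf.eq x hx]
    congr 1
    refine intervalIntegral.integral_congr_ae ?_
    filter_upwards [h''] with t ht ht'
    rw [uIoc_of_le hx.1] at ht'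
    exact ht ⟨ht'.1, ht'.2.trans hx.2⟩

theorem of_hasDerivAt (hab : a ≤ b) (h : ∀ x, HasDerivAt f (f' x) x) (hc : Continuous f') :
    IsPrim f f' a b := by
  refine ⟨hab, hc.intervalIntegrable _ _, fun x _ => ?_⟩
  rw [intervalIntegral.integral_eq_sub_of_hasDerivAt (fun t _ => h t) (hc.intervalIntegrable _ _)]
  ring

theorem add (hf : IsPrim f f' a b) (hg : IsPrim g g' a b) :
    IsPrim (fun x => f x + g x) (fun x => f' x + g' x) a b := by
  have ha : a ∈ Icc a b := left_mem_Icc.2 hf.le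
  refine ⟨hf.le, hf.integrable.add hg.integrable, fun x hx => ?_⟩
  rw [intervalIntegral.integral_add (hf.integrable_sub ha hx) (hg.integrable_sub ha hx),
    hf.eq x hx, hg.eq x hx]
  ring

theorem const_mul (c : ℂ) (hf : IsPrim f f' a b) :
    IsPrim (fun x => c * f x) (fun x => c * f' x) a b := by
  refine ⟨hf.le, hf.integrable.const_mul c, fun x hx => ?_⟩
  rw [intervalIntegral.integral_const_mul, hf.eq x hx]
  ring

theorem neg (hf : IsPrim f f' a b) : IsPrim (fun x => -f x) (fun x => -f' x) a b := by
  simpa using hf.const_mul (-1)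

theorem sub (hf : IsPrim f f' a b) (hg : IsPrim g g' a b) :
    IsPrim (fun x => f x - g x) (fun x => f' x - g' x) a b := by
  simpa [sub_eq_add_neg] using hf.add hg.neg

theorem absolutelyContinuousOnInterval (hf : IsPrim f f' a b) :
    AbsolutelyContinuousOnInterval (fun x => f a + ∫ t in a..x, f' t) a b :=
  (absolutelyContinuousOnInterval_const _ a b).fun_add
    (absolutelyContinuousOnInterval_complex_integral hf.integrable)

/-- The product rule for absolutely continuous functions: the difference of the two sides is
absolutely continuous with derivative zero almost everywhere. -/
theorem mul (hf : IsPrim f f' a b) (hg : IsPrim g g' a b) :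
    IsPrim (fun x => f x * g x) (fun x => f' x * g x + f x * g' x) a b := by
  have ha : a ∈ Icc a b := left_mem_Icc.2 hf.le
  have hu : uIcc a b = Icc a b := uIcc_of_le hf.le
  have hint : IntervalIntegrable (fun x => f' x * g x + f x * g' x) volume a b :=
    (hf.integrable.mul_continuousOn (hu ▸ hg.continuousOn)).add
      (hg.integrable.continuousOn_mul (hu ▸ hf.continuousOn))
  refine ⟨hf.le, hint, fun x hx => ?_⟩
  set F : ℝ → ℂ := fun x => f a + ∫ t in a..x, f' t with hF
  set G : ℝ → ℂ := fun x => g a + ∫ t in a..x, g' t with hG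
  have hac : AbsolutelyContinuousOnInterval
      (fun x => F x • G x - ∫ t in a..x, (f' t * g t + f t * g' t)) a b :=
    (hf.absolutelyContinuousOnInterval.fun_smul hg.absolutelyContinuousOnInterval).fun_sub
      (absolutelyContinuousOnInterval_complex_integral hint)
  obtain ⟨c, hc⟩ := hac.const_of_ae_hasDerivAt_zero (by
    filter_upwards [hf.integrable.ae_hasDerivAt_integral, hg.integrable.ae_hasDerivAt_integral,
      hint.ae_hasDerivAt_integral] with y h1 h2 h3 hy
    have d1 : HasDerivAt F (f' y) y := (h1 hy a left_mem_uIcc).const_add _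
    have d2 : HasDerivAt G (g' y) y := (h2 hy a left_mem_uIcc).const_add _
    have d3 := (d1.mul d2).sub (h3 hy a left_mem_uIcc)
    have e1 : F y = f y := (hf.eq y (hu ▸ hy)).symm
    have e2 : G y = g y := (hg.eq y (hu ▸ hy)).symm
    rw [e1, e2, sub_self] at d3
    exact d3)
  have hcx := hc x (hu ▸ hx)
  have hca := hc a left_mem_uIcc
  simp only [hF, hG, intervalIntegral.integral_same, add_zero, sub_zero, smul_eq_mul] at hcx hca
  rw [← hf.eq x hx, ← hg.eq x hx] at hcx
  rw [hca, ← hcx]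
  ring

end IsPrim

/-! ### The inhomogeneous equation `e'' = s e' + H` -/

theorem hasDerivAt_cexp_linear (s : ℂ) (x : ℝ) :
    HasDerivAt (fun t : ℝ => Complex.exp (s * t)) (s * Complex.exp (s * x)) x := by
  have h : HasDerivAt (fun t : ℝ => s * (t : ℂ)) s x := by
    simpa using (Complex.ofRealCLM.hasDerivAt (x := x)).const_mul s
  simpa [mul_comm] using h.cexp

theorem isPrim_cexp {a b : ℝ} (hab : a ≤ b) (s : ℂ) :
    IsPrim (fun t => Complex.exp (s * t)) (fun t => s * Complex.exp (s * t)) a b :=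
  IsPrim.of_hasDerivAt hab (hasDerivAt_cexp_linear s) (by fun_prop)

/-- Variation of constants for the first-order equation `η' = s η + H`. -/
theorem IsPrim.variation_of_constants {η H : ℝ → ℂ} {s : ℂ} {a b : ℝ}
    (hη : IsPrim η (fun t => s * η t + H t) a b) {x : ℝ} (hx : x ∈ Icc a b) :
    η x = Complex.exp (s * (x - a)) * η a + ∫ t in a..x, Complex.exp (s * (x - t)) * H t := by
  have h := (((isPrim_cexp hη.le (-s)).mul hη).congr (F' := fun t => Complex.exp (-s * t) * H t)
    (fun _ _ => rfl) (ae_of_all _ fun t _ => by ring)).eq x hx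
  have e1 : ∀ t : ℝ, Complex.exp (s * (x - t)) = Complex.exp (s * x) * Complex.exp (-s * t) := by
    intro t
    rw [← Complex.exp_add]
    ring_nf
  simp_rw [e1, mul_assoc, intervalIntegral.integral_const_mul]
  have e2 : Complex.exp (s * x) * Complex.exp (-s * x) = 1 := by
    rw [← Complex.exp_add, neg_mul, add_neg_cancel, Complex.exp_zero]
  linear_combination (-η x) * e2 + Complex.exp (s * x) * h

theorem IsPrim.integrable_inhomogeneity {η H : ℝ → ℂ} {s : ℂ} {a b : ℝ}
    (hη : IsPrim η (fun t => s * η t + H t) a b) : IntervalIntegrable H volume a b := by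
  have h1 : IntervalIntegrable (fun t => s * η t) volume a b :=
    (ContinuousOn.intervalIntegrable (by rw [uIcc_of_le hη.le]; exact hη.continuousOn)).const_mul s
  simpa using hη.integrable.sub h1

/-- The solution of `e'' = s e' + H` with `e(a) = 0`, in terms of the initial slope. -/
theorem solution_formula {e η H : ℝ → ℂ} {s : ℂ} {a b : ℝ} (he : IsPrim e η a b)
    (hη : IsPrim η (fun t => s * η t + H t) a b) (h0 : e a = 0) {x : ℝ} (hx : x ∈ Icc a b) :
    s * e x = (Complex.exp (s * (x - a)) - 1) * η a
      + ∫ t in a..x, (Complex.exp (s * (x - t)) - 1) * H t := by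
  have hH : IntervalIntegrable H volume a x :=
    hη.integrable_inhomogeneity.mono_set (by
      rw [uIcc_of_le he.le, uIcc_of_le hx.1]; exact Icc_subset_Icc_right hx.2)
  have h1 := (((he.const_mul s).sub hη).congr (F' := fun t => -H t)
    (fun _ _ => rfl) (ae_of_all _ fun t _ => by ring)).eq x hx
  rw [intervalIntegral.integral_neg, h0] at h1
  have h2 := hη.variation_of_constants hx
  have h3 : ∫ t in a..x, (Complex.exp (s * (x - t)) - 1) * H t
      = (∫ t in a..x, Complex.exp (s * (x - t)) * H t) - ∫ t in a..x, H t := by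
    rw [← intervalIntegral.integral_sub (hH.continuousOn_mul (by fun_prop)) hH]
    congr 1
    ext t
    ring
  rw [h3]
  linear_combination h1 + h2

theorem norm_cexp_sub_one_le (s : ℂ) {t : ℝ} (ht : 0 ≤ t) :
    ‖Complex.exp (s * t) - 1‖ ≤ 2 * Real.exp (max s.re 0 * t) := by
  have h1 : ‖Complex.exp (s * t)‖ ≤ Real.exp (max s.re 0 * t) := by
    rw [Complex.norm_exp]
    simp only [Complex.mul_re, Complex.ofReal_re, Complex.ofReal_im, mul_zero, sub_zero]
    gcongr
    exact le_max_left _ _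
  have h2 : (1 : ℝ) ≤ Real.exp (max s.re 0 * t) :=
    Real.one_le_exp (mul_nonneg (le_max_right _ _) ht)
  calc _ ≤ ‖Complex.exp (s * t)‖ + ‖(1 : ℂ)‖ := norm_sub_le _ _
    _ ≤ _ := by rw [norm_one]; linarith

/-- A weighted bound for the solution: since `|e^{s t} - 1| ≤ 2 e^{σ t}` with `σ = max (Re s) 0`,
the maximum of `e^{-σ(x-a)} |e(x)|` can be absorbed once `|s|` dominates the potential. -/
theorem solution_bound {e η U h : ℝ → ℂ} {s : ℂ} {a b B K : ℝ} (he : IsPrim e η a b)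
    (hη : IsPrim η (fun t => s * η t + (U t * e t + h t)) a b) (h0 : e a = 0)
    (hB : ∀ t, ‖U t‖ ≤ B) (hh : IntervalIntegrable h volume a b)
    (hs : 4 * (b - a) * B ≤ ‖s‖) (hs0 : s ≠ 0)
    (hK : ‖η a‖ + ∫ t in a..b, Real.exp (-(max s.re 0 * (t - a))) * ‖h t‖ ≤ K) :
    ∀ x ∈ Icc a b, ‖e x‖ ≤ 4 * K / ‖s‖ * Real.exp (max s.re 0 * (x - a)) := by
  set τ := max s.re 0 with hτ
  have hab := he.le
  have hspos : 0 < ‖s‖ := norm_pos_iff.2 hs0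
  have hcont : ContinuousOn (fun x => Real.exp (-(τ * (x - a))) * ‖e x‖) (Icc a b) :=
    ContinuousOn.mul (by fun_prop) he.continuousOn.norm
  obtain ⟨y, hy, hmax⟩ := isCompact_Icc.exists_isMaxOn (nonempty_Icc.2 hab) hcont
  set m := Real.exp (-(τ * (y - a))) * ‖e y‖ with hm
  have hmle : ∀ x ∈ Icc a b, Real.exp (-(τ * (x - a))) * ‖e x‖ ≤ m := fun x hx => hmax hx
  have hB0 : 0 ≤ B := (norm_nonneg _).trans (hB a)
  have hm0 : 0 ≤ m := by positivity
  have hhw : IntervalIntegrable (fun t => Real.exp (-(τ * (t - a))) * ‖h t‖) volume a b :=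
    hh.norm.continuousOn_mul (by fun_prop)
  have hmain : ‖s‖ * m ≤ 2 * K + 2 * ((b - a) * B * m) := by
    have hform := solution_formula he hη h0 hy
    have hb1 : ‖(Complex.exp (s * (y - a)) - 1) * η a‖ ≤ 2 * Real.exp (τ * (y - a)) * ‖η a‖ := by
      rw [norm_mul]
      gcongr
      exact_mod_cast norm_cexp_sub_one_le s (sub_nonneg.2 hy.1)
    have hb2 : ‖∫ t in a..y, (Complex.exp (s * (y - t)) - 1) * (U t * e t + h t)‖
        ≤ ∫ t in a..y, 2 * Real.exp (τ * (y - a)) *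
          (B * m + Real.exp (-(τ * (t - a))) * ‖h t‖) := by
      refine intervalIntegral.norm_integral_le_of_norm_le hy.1 (ae_of_all _ fun t ht => ?_) ?_
      · have htI : t ∈ Icc a b := ⟨ht.1.le, ht.2.trans hy.2⟩
        have e1 : ‖Complex.exp (s * (y - t)) - 1‖ ≤ 2 * Real.exp (τ * (y - t)) := by
          exact_mod_cast norm_cexp_sub_one_le s (sub_nonneg.2 ht.2)
        have e2 : Real.exp (τ * (y - t)) = Real.exp (τ * (y - a)) * Real.exp (-(τ * (t - a))) := by
          rw [← Real.exp_add]; ring_nf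
        rw [norm_mul]
        calc _ ≤ 2 * Real.exp (τ * (y - t)) * (B * ‖e t‖ + ‖h t‖) := by
              gcongr
              refine (norm_add_le _ _).trans ?_
              rw [norm_mul]
              gcongr
              exact hB t
          _ = 2 * Real.exp (τ * (y - a)) * (B * (Real.exp (-(τ * (t - a))) * ‖e t‖)
              + Real.exp (-(τ * (t - a))) * ‖h t‖) := by rw [e2]; ring
          _ ≤ _ := by
              gcongr
              exact hmle t htI
      · refine IntervalIntegrable.const_mul ?_ _
        refine intervalIntegrable_const.add (hhw.mono_set ?_)
        rw [uIcc_of_le hab, uIcc_of_le hy.1]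
        exact Icc_subset_Icc_right hy.2
    have hhy : IntervalIntegrable (fun t => Real.exp (-(τ * (t - a))) * ‖h t‖) volume a y :=
      hhw.mono_set (by
        rw [uIcc_of_le hab, uIcc_of_le hy.1]
        exact Icc_subset_Icc_right hy.2)
    have hb3 : ∫ t in a..y, Real.exp (-(τ * (t - a))) * ‖h t‖
        ≤ ∫ t in a..b, Real.exp (-(τ * (t - a))) * ‖h t‖ :=
      intervalIntegral.integral_mono_interval le_rfl hy.1 hy.2
        (ae_of_all _ fun t => by positivity) hhw
    rw [intervalIntegral.integral_const_mul, intervalIntegral.integral_add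
      intervalIntegrable_const hhy, intervalIntegral.integral_const, smul_eq_mul] at hb2
    have hb4 : ‖s‖ * ‖e y‖ ≤ 2 * Real.exp (τ * (y - a)) * (K + (b - a) * B * m) := by
      rw [← norm_mul, hform]
      refine (norm_add_le _ _).trans ?_
      have : (y - a) * (B * m) ≤ (b - a) * B * m := by
        rw [← mul_assoc]
        gcongr
        exact hy.2
      calc _ ≤ 2 * Real.exp (τ * (y - a)) * ‖η a‖ + 2 * Real.exp (τ * (y - a)) *
            ((y - a) * (B * m) + ∫ t in a..y, Real.exp (-(τ * (t - a))) * ‖h t‖) := by gcongr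
        _ = 2 * Real.exp (τ * (y - a)) *
            (‖η a‖ + (∫ t in a..y, Real.exp (-(τ * (t - a))) * ‖h t‖) + (y - a) * (B * m)) := by
            ring
        _ ≤ _ := by gcongr; linarith
    calc ‖s‖ * m = Real.exp (-(τ * (y - a))) * (‖s‖ * ‖e y‖) := by rw [hm]; ring
      _ ≤ Real.exp (-(τ * (y - a))) * (2 * Real.exp (τ * (y - a)) * (K + (b - a) * B * m)) := by
          gcongr
      _ = (Real.exp (-(τ * (y - a))) * Real.exp (τ * (y - a))) * (2 * K + 2 * ((b - a) * B * m)) := by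
          ring
      _ = _ := by rw [← Real.exp_add, neg_add_cancel, Real.exp_zero, one_mul]
  have hmK : m ≤ 4 * K / ‖s‖ := by
    rw [le_div_iff₀ hspos]
    nlinarith [mul_le_mul_of_nonneg_right hs hm0]
  intro x hx
  have := (hmle x hx).trans hmK
  calc ‖e x‖ = (Real.exp (τ * (x - a)) * Real.exp (-(τ * (x - a)))) * ‖e x‖ := by
        rw [← Real.exp_add, add_neg_cancel, Real.exp_zero, one_mul]
    _ = Real.exp (τ * (x - a)) * (Real.exp (-(τ * (x - a))) * ‖e x‖) := by ring
    _ ≤ Real.exp (τ * (x - a)) * (4 * K / ‖s‖) := by gcongr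
    _ = _ := by ring

end

section


/-! ### Approximate solutions near an endpoint -/

theorem hasDerivAt_primitive {g : ℝ → ℂ} (hg : Continuous g) (a x : ℝ) :
    HasDerivAt (fun y => ∫ t in a..y, g t) (g x) x :=
  intervalIntegral.integral_hasDerivAt_right (hg.intervalIntegrable _ _)
    (hg.stronglyMeasurableAtFilter _ _) hg.continuousAt

theorem contDiff_primitive {g : ℝ → ℂ} {n : ℕ} (hg : ContDiff ℝ n g) (a : ℝ) :
    ContDiff ℝ (n + 1 : ℕ) (fun y => ∫ t in a..y, g t) := by
  have hd := hasDerivAt_primitive hg.continuous a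
  have : deriv (fun y => ∫ t in a..y, g t) = g := funext fun x => (hd x).deriv
  push_cast
  rw [contDiff_succ_iff_deriv]
  exact ⟨fun x => (hd x).differentiableAt, by simp, by rwa [this]⟩

/-- A `C^n` function on a compact interval extends to a `C^n` function on the line. -/
theorem exists_contDiff_extension {a b : ℝ} (hab : a < b) (n : ℕ) :
    ∀ V : ℝ → ℂ, ContDiffOn ℝ n V (Icc a b) → ∃ G : ℝ → ℂ, ContDiff ℝ n G ∧ EqOn G V (Icc a b) := by
  induction n with
  | zero =>
    intro V hV
    refine ⟨IccExtend hab.le ((Icc a b).domRestrict V), ?_, fun x hx => ?_⟩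
    · simp only [Nat.cast_zero, contDiff_zero]
      exact (hV.continuousOn.domRestrict).Icc_extend'
    · rw [IccExtend_of_mem _ _ hx, domRestrict_apply]
  | succ n ih =>
    intro V hV
    obtain ⟨G, hG, hGV⟩ := ih (derivWithin V (Icc a b))
      (hV.derivWithin (uniqueDiffOn_Icc hab) (by norm_cast))
    refine ⟨fun x => V a + ∫ t in a..x, G t, contDiff_const.add (contDiff_primitive hG a),
      fun x hx => ?_⟩
    have hd : ∀ t ∈ Ioo a x, HasDerivAt V (G t) t := by
      intro t ht
      have htI : t ∈ Icc a b := ⟨ht.1.le, ht.2.le.trans hx.2⟩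
      rw [hGV htI]
      exact ((hV.differentiableOn (by simp) t htI).hasDerivWithinAt).hasDerivAt
        (Icc_mem_nhds ht.1 (ht.2.trans_le hx.2))
    beta_reduce
    rw [intervalIntegral.integral_eq_sub_of_hasDerivAt_of_le hx.1
      (hV.continuousOn.mono (Icc_subset_Icc_right hx.2)) hd (hG.continuous.intervalIntegrable _ _)]
    ring

/-- The Taylor coefficients at `a` of a smooth function equivalent to `C (x - a)^j` from the right
vanish below order `j`, and the one of order `j` is `C`. -/
theorem iteratedDeriv_of_isEquivalent {G : ℝ → ℂ} {a : ℝ} {j : ℕ} {C : ℂ}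
    (hG : ContDiff ℝ j G)
    (h : Asymptotics.IsEquivalent (𝓝[>] a) G fun x : ℝ => C * ((x - a : ℝ) : ℂ) ^ j) :
    (∀ i < j, iteratedDeriv i G a = 0) ∧ iteratedDeriv j G a = j.factorial * C := by
  have hpos : ∀ᶠ x in 𝓝[>] a, 0 < x - a := by
    filter_upwards [self_mem_nhdsWithin] with x hx using sub_pos.2 hx
  have hx0 : Tendsto (fun x : ℝ => ((x - a : ℝ) : ℂ)) (𝓝[>] a) (𝓝 0) := by
    have : Continuous fun x : ℝ => ((x - a : ℝ) : ℂ) := by fun_prop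
    simpa using (this.tendsto a).mono_left nhdsWithin_le_nhds
  -- quotients of `G` by powers of `x - a`
  have hquot : ∀ i ≤ j, Tendsto (fun x : ℝ => G x / ((x - a : ℝ) : ℂ) ^ i) (𝓝[>] a)
      (𝓝 (if i = j then C else 0)) := by
    intro i hi
    have h1 : (fun x : ℝ => G x / ((x - a : ℝ) : ℂ) ^ i) =O[𝓝[>] a]
        (fun x : ℝ => G x / ((x - a : ℝ) : ℂ) ^ i) := Asymptotics.isBigO_refl _ _
    have h2 : Asymptotics.IsEquivalent (𝓝[>] a) (fun x : ℝ => G x / ((x - a : ℝ) : ℂ) ^ i)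
        (fun x : ℝ => C * ((x - a : ℝ) : ℂ) ^ j / ((x - a : ℝ) : ℂ) ^ i) :=
      h.div Asymptotics.IsEquivalent.refl
    refine h2.symm.tendsto_nhds ?_
    have h3 : (fun x : ℝ => C * ((x - a : ℝ) : ℂ) ^ (j - i)) =ᶠ[𝓝[>] a]
        (fun x : ℝ => C * ((x - a : ℝ) : ℂ) ^ j / ((x - a : ℝ) : ℂ) ^ i) := by
      filter_upwards [hpos] with x hx
      have : ((x - a : ℝ) : ℂ) ≠ 0 := by exact_mod_cast hx.ne'
      rw [eq_div_iff (pow_ne_zero _ this), mul_assoc, ← pow_add, Nat.sub_add_cancel hi]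
    refine Tendsto.congr' h3 ?_
    have h4 := (hx0.pow (j - i)).const_mul C
    convert h4 using 2
    split_ifs with hij
    · simp [hij]
    · rw [zero_pow (by omega), mul_zero]
  have hstep : ∀ i ≤ j, (∀ l < i, iteratedDeriv l G a = 0) →
      iteratedDeriv i G a = i.factorial * (if i = j then C else 0) := by
    intro i hi hl
    have ht : Tendsto (fun x => ((x - a) ^ i)⁻¹ • (G x - taylorWithinEval G i univ a x))
        (𝓝[>] a) (𝓝 0) := by
      have := taylor_tendsto (n := i) convex_univ (mem_univ a)
        ((hG.of_le (by exact_mod_cast hi)).contDiffOn)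
      rw [nhdsWithin_univ] at this
      exact this.mono_left nhdsWithin_le_nhds
    have hte : ∀ x, taylorWithinEval G i univ a x
        = ((i.factorial : ℝ)⁻¹ * (x - a) ^ i) • iteratedDeriv i G a := by
      intro x
      rw [taylor_within_apply, Finset.sum_range_succ, Finset.sum_eq_zero]
      · simp [iteratedDerivWithin_univ]
      · intro l hl'
        rw [iteratedDerivWithin_univ, hl l (Finset.mem_range.1 hl'), smul_zero]
    have h5 : Tendsto (fun x : ℝ => G x / ((x - a : ℝ) : ℂ) ^ i) (𝓝[>] a)
        (𝓝 ((i.factorial : ℂ)⁻¹ * iteratedDeriv i G a)) := by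
      have h6 := ht.add_const ((i.factorial : ℂ)⁻¹ * iteratedDeriv i G a)
      rw [zero_add] at h6
      refine h6.congr' ?_
      filter_upwards [hpos] with x hx
      have : ((x - a : ℝ) : ℂ) ≠ 0 := by exact_mod_cast hx.ne'
      have hf : (i.factorial : ℂ) ≠ 0 := by exact_mod_cast i.factorial_ne_zero
      rw [hte]
      simp only [Complex.real_smul]
      push_cast at this ⊢
      field_simp
      ring
    have := tendsto_nhds_unique h5 (hquot i hi)
    rw [← this, mul_inv_cancel_left₀ (by exact_mod_cast i.factorial_ne_zero)]
  have hz : ∀ i < j, iteratedDeriv i G a = 0 := by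
    intro i
    induction i using Nat.strong_induction_on with
    | _ i ih =>
      intro hij
      rw [hstep i hij.le fun l hl => ih l hl (hl.trans hij), if_neg hij.ne, mul_zero]
  exact ⟨hz, by rw [hstep j le_rfl hz, if_pos rfl]⟩

/-- The coefficients `c_m` of the formal solution `∑ s^{-m} c_m` of `u'' = s u' + G u`. -/
def formalCoeff (G : ℝ → ℂ) (a : ℝ) : ℕ → ℝ → ℂ
  | 0 => fun _ => 1
  | m + 1 => fun x => ∫ t in a..x, (deriv (deriv (formalCoeff G a m)) t - G t * formalCoeff G a m t)

section formalCoeff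

variable {G : ℝ → ℂ} {N : ℕ}

theorem contDiff_formalCoeff (hG : ContDiff ℝ N G) (a : ℝ) :
    ∀ m n : ℕ, m + n = N + 1 → ContDiff ℝ (n + 1 : ℕ) (formalCoeff G a m) := by
  intro m
  induction m with
  | zero => exact fun n _ => contDiff_const
  | succ m ih =>
    intro n hn
    have h1 : ContDiff ℝ (n + 2 : ℕ) (formalCoeff G a m) := ih (n + 1) (by omega)
    have h2 : ContDiff ℝ (n + 1 : ℕ) (deriv (formalCoeff G a m)) := by
      rw [show ((n + 2 : ℕ) : WithTop ℕ∞) = ((n + 1 : ℕ) : WithTop ℕ∞) + 1 by norm_cast,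
        contDiff_succ_iff_deriv] at h1
      exact h1.2.2
    have h3 : ContDiff ℝ (n : ℕ) (deriv (deriv (formalCoeff G a m))) := by
      rw [show ((n + 1 : ℕ) : WithTop ℕ∞) = ((n : ℕ) : WithTop ℕ∞) + 1 by norm_cast,
        contDiff_succ_iff_deriv] at h2
      exact h2.2.2
    exact contDiff_primitive (h3.sub ((hG.of_le (by exact_mod_cast (by omega : n ≤ N))).mul
      (h1.of_le (by exact_mod_cast (by omega : n ≤ n + 2))))) a

theorem contDiff_formalCoeff_two (hG : ContDiff ℝ N G) (a : ℝ) {m : ℕ} (hm : m ≤ N) :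
    ContDiff ℝ 2 (formalCoeff G a m) :=
  (contDiff_formalCoeff hG a m (N + 1 - m) (by omega)).of_le
    (by exact_mod_cast (by omega : 2 ≤ N + 1 - m + 1))

theorem hasDerivAt_formalCoeff (hG : ContDiff ℝ N G) (a : ℝ) {m : ℕ} (hm : m ≤ N) (x : ℝ) :
    HasDerivAt (formalCoeff G a m) (deriv (formalCoeff G a m) x) x :=
  ((contDiff_formalCoeff_two hG a hm).differentiable (by simp) x).hasDerivAt

theorem contDiff_deriv_formalCoeff (hG : ContDiff ℝ N G) (a : ℝ) {m : ℕ} (hm : m ≤ N) :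
    ContDiff ℝ 1 (deriv (formalCoeff G a m)) := by
  have h := contDiff_formalCoeff_two hG a hm
  rw [show (2 : WithTop ℕ∞) = 1 + 1 by norm_num, contDiff_succ_iff_deriv] at h
  exact h.2.2

theorem hasDerivAt_deriv_formalCoeff (hG : ContDiff ℝ N G) (a : ℝ) {m : ℕ} (hm : m ≤ N) (x : ℝ) :
    HasDerivAt (deriv (formalCoeff G a m)) (deriv (deriv (formalCoeff G a m)) x) x :=
  ((contDiff_deriv_formalCoeff hG a hm).differentiable (by simp) x).hasDerivAt

theorem continuous_deriv_deriv_formalCoeff (hG : ContDiff ℝ N G) (a : ℝ) {m : ℕ} (hm : m ≤ N) :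
    Continuous (deriv (deriv (formalCoeff G a m))) :=
  (contDiff_deriv_formalCoeff hG a hm).continuous_deriv le_rfl

theorem deriv_formalCoeff_succ (hG : ContDiff ℝ N G) (a : ℝ) {m : ℕ} (hm : m ≤ N) :
    deriv (formalCoeff G a (m + 1))
      = deriv (deriv (formalCoeff G a m)) - G * formalCoeff G a m := by
  ext x
  exact (hasDerivAt_primitive ((continuous_deriv_deriv_formalCoeff hG a hm).sub
    (hG.continuous.mul (contDiff_formalCoeff_two hG a hm).continuous)) a x).deriv

theorem formalCoeff_self (G : ℝ → ℂ) (a : ℝ) (m : ℕ) : formalCoeff G a (m + 1) a = 0 := by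
  simp [formalCoeff]

/-- Where `G` vanishes to order `j`, the derivatives of the formal coefficients are those of `-G`:
the products `G c_m` in the recursion do not contribute. -/
theorem iteratedDeriv_deriv_formalCoeff {a : ℝ} {j : ℕ} (hG : ContDiff ℝ (j + 1 : ℕ) G)
    (h0 : ∀ i < j, iteratedDeriv i G a = 0) :
    ∀ m l : ℕ, l + m ≤ j →
      iteratedDeriv l (deriv (formalCoeff G a (m + 1))) a = -iteratedDeriv (l + m) G a := by
  intro m
  induction m with
  | zero =>
    intro l _
    have : deriv (formalCoeff G a (0 + 1)) = -G := by
      rw [deriv_formalCoeff_succ hG a (Nat.zero_le _)]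
      ext x
      have h1 : deriv (formalCoeff G a 0) = fun _ => 0 := by
        ext y
        exact deriv_const _ _
      rw [h1]
      simp [formalCoeff]
    rw [this, iteratedDeriv_neg, add_zero]
  | succ m ih =>
    intro l hl
    have hs : ContDiff ℝ (l + 2 : ℕ) (formalCoeff G a (m + 1)) :=
      (contDiff_formalCoeff hG a (m + 1) (j + 1 - m) (by omega)).of_le
        (by exact_mod_cast (by omega : l + 2 ≤ j + 1 - m + 1))
    have hs1 : ContDiff ℝ (l + 1 : ℕ) (deriv (formalCoeff G a (m + 1))) := by
      rw [show ((l + 2 : ℕ) : WithTop ℕ∞) = ((l + 1 : ℕ) : WithTop ℕ∞) + 1 by norm_cast,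
        contDiff_succ_iff_deriv] at hs
      exact hs.2.2
    have hs2 : ContDiff ℝ (l : ℕ) (deriv (deriv (formalCoeff G a (m + 1)))) := by
      rw [show ((l + 1 : ℕ) : WithTop ℕ∞) = ((l : ℕ) : WithTop ℕ∞) + 1 by norm_cast,
        contDiff_succ_iff_deriv] at hs1
      exact hs1.2.2
    have hGl : ContDiff ℝ (l : ℕ) G := hG.of_le (by exact_mod_cast (by omega : l ≤ j + 1))
    have hcl : ContDiff ℝ (l : ℕ) (formalCoeff G a (m + 1)) :=
      hs.of_le (by exact_mod_cast (by omega : l ≤ l + 2))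
    rw [deriv_formalCoeff_succ hG a (by omega),
      iteratedDeriv_sub (g := G * formalCoeff G a (m + 1)) hs2.contDiffAt
        (hGl.mul hcl).contDiffAt,
      iteratedDeriv_mul hGl.contDiffAt hcl.contDiffAt, Finset.sum_eq_zero, sub_zero,
      ← iteratedDeriv_succ', ih (l + 1) (by omega)]
    · congr 2
      omega
    · intro i hi
      rw [h0 i (by have := Finset.mem_range.1 hi; omega), mul_zero, zero_mul]

end formalCoeff

/-- The bounds satisfied by an approximate solution `u` of `u'' = s u' + G u` on `[a, b]`, which
starts from `u(a) = 1` with the slope that the reflection at the endpoint `a` dictates. -/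
structure IsApproxSol (G : ℝ → ℂ) (a b : ℝ) (j : ℕ) (C : ℂ) (K : ℝ) (s : ℂ)
    (u u₁ u₂ : ℝ → ℂ) : Prop where
  deriv_zero : ∀ x, HasDerivAt u (u₁ x) x
  deriv_one : ∀ x, HasDerivAt u₁ (u₂ x) x
  continuous_two : Continuous u₂
  left : u a = 1
  left_slope : u₁ a = -(j.factorial * C * (s⁻¹) ^ (j + 1))
  norm_sub_one : ∀ x ∈ Icc a b, ‖u x - 1‖ ≤ K / ‖s‖
  norm_slope : ∀ x ∈ Icc a b, ‖u₁ x‖ ≤ K / ‖s‖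
  norm_error : ∀ x ∈ Icc a b, ‖u₂ x - s * u₁ x - G x * u x‖ ≤ K * (‖s‖⁻¹) ^ (j + 1)

theorem exists_isApproxSol {G : ℝ → ℂ} {a b : ℝ} {j : ℕ} {C : ℂ}
    (hG : ContDiff ℝ (j + 1 : ℕ) G) (h0 : ∀ i < j, iteratedDeriv i G a = 0)
    (hj : iteratedDeriv j G a = j.factorial * C) :
    ∃ K : ℝ, 1 ≤ K ∧ ∀ s : ℂ, 1 ≤ ‖s‖ → ∃ u u₁ u₂ : ℝ → ℂ, IsApproxSol G a b j C K s u u₁ u₂ := by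
  set c := formalCoeff G a with hc
  have hb : ∀ m, ∃ A : ℝ, m ≤ j + 1 → ∀ x ∈ Icc a b, ‖c m x‖ ≤ A ∧ ‖deriv (c m) x‖ ≤ A ∧
      ‖deriv (deriv (c m)) x - G x * c m x‖ ≤ A := by
    intro m
    by_cases hm : m ≤ j + 1
    · have c0 : Continuous (c m) := (contDiff_formalCoeff_two hG a hm).continuous
      have c1 : Continuous (deriv (c m)) := (contDiff_deriv_formalCoeff hG a hm).continuous
      have c2 := continuous_deriv_deriv_formalCoeff hG a hm
      obtain ⟨A0, h0⟩ := isCompact_Icc.exists_bound_of_continuousOn (s := Icc a b) c0.continuousOn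
      obtain ⟨A1, h1⟩ := isCompact_Icc.exists_bound_of_continuousOn (s := Icc a b) c1.continuousOn
      obtain ⟨A2, h2⟩ := isCompact_Icc.exists_bound_of_continuousOn (s := Icc a b)
        (c2.sub (hG.continuous.mul c0)).continuousOn
      refine ⟨max A0 (max A1 A2), fun _ x hx => ⟨(h0 x hx).trans (le_max_left _ _),
        (h1 x hx).trans ((le_max_left _ _).trans (le_max_right _ _)),
        (h2 x hx).trans ((le_max_right _ _).trans (le_max_right _ _))⟩⟩
    · exact ⟨0, fun h => absurd h hm⟩
  choose A hA using hb
  set K := 1 + ∑ m ∈ Finset.range (j + 2), |A m| with hK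
  have hsum0 : 0 ≤ ∑ m ∈ Finset.range (j + 2), |A m| := Finset.sum_nonneg fun _ _ => abs_nonneg _
  refine ⟨K, by linarith, fun s hs => ?_⟩
  have hspos : 0 < ‖s‖ := by linarith
  have hs0 : s ≠ 0 := norm_pos_iff.1 hspos
  have hsinv : ‖s⁻¹‖ ≤ 1 := by rw [norm_inv]; exact inv_le_one_of_one_le₀ hs
  have hsmall : ∀ (F : ℕ → ℂ), (∀ m ≤ j + 1, ‖F m‖ ≤ |A m|) →
      ‖∑ m ∈ Finset.range (j + 1), (s⁻¹) ^ (m + 1) * F (m + 1)‖ ≤ K / ‖s‖ := by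
    intro F hF
    calc _ ≤ ∑ m ∈ Finset.range (j + 1), ‖s‖⁻¹ * |A (m + 1)| := by
          refine norm_sum_le_of_le _ fun m hm => ?_
          rw [norm_mul, norm_pow, pow_succ', norm_inv, mul_assoc]
          have h1 : (‖s‖⁻¹) ^ m ≤ 1 := pow_le_one₀ (by positivity) (by rwa [← norm_inv])
          have h2 := hF (m + 1) (by have := Finset.mem_range.1 hm; omega)
          gcongr
          calc _ ≤ 1 * |A (m + 1)| := by gcongr
            _ = _ := one_mul _
      _ = (∑ m ∈ Finset.range (j + 1), |A (m + 1)|) / ‖s‖ := by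
          rw [← Finset.mul_sum]; field_simp
      _ ≤ K / ‖s‖ := by
          gcongr
          rw [hK, Finset.sum_range_succ' _ (j + 1)]
          linarith [abs_nonneg (A 0)]
  have hd0 : ∀ x, deriv (c 0) x = 0 := fun x => deriv_const _ _
  have hrange : ∀ {m}, m ∈ Finset.range (j + 2) → m ≤ j + 1 := fun hm => by
    have := Finset.mem_range.1 hm; omega
  refine ⟨fun x => ∑ m ∈ Finset.range (j + 2), (s⁻¹) ^ m * c m x,
    fun x => ∑ m ∈ Finset.range (j + 2), (s⁻¹) ^ m * deriv (c m) x,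
    fun x => ∑ m ∈ Finset.range (j + 2), (s⁻¹) ^ m * deriv (deriv (c m)) x, ?_, ?_, ?_, ?_, ?_, ?_,
    ?_, ?_⟩
  · exact fun x => HasDerivAt.fun_sum fun m hm =>
      (hasDerivAt_formalCoeff hG a (hrange hm) x).const_mul _
  · exact fun x => HasDerivAt.fun_sum fun m hm =>
      (hasDerivAt_deriv_formalCoeff hG a (hrange hm) x).const_mul _
  · exact continuous_finsetSum _ fun m hm => continuous_const.mul
      (continuous_deriv_deriv_formalCoeff hG a (hrange hm))
  · rw [Finset.sum_range_succ']
    simp [hc, formalCoeff_self, formalCoeff]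
  · have hz : ∀ m ≤ j, deriv (c (m + 1)) a = -iteratedDeriv m G a := by
      intro m hm
      simpa using iteratedDeriv_deriv_formalCoeff hG h0 m 0 (by omega)
    rw [Finset.sum_range_succ', Finset.sum_range_succ, Finset.sum_eq_zero, hz j le_rfl, hj, hd0]
    · ring
    · intro m hm
      have := Finset.mem_range.1 hm
      rw [hz m this.le, h0 m this, neg_zero, mul_zero]
  · intro x hx
    have h1 := hsmall (fun m => c m x) fun m hm => ((hA m hm x hx).1).trans (le_abs_self _)
    rw [Finset.sum_range_succ']
    simpa [hc, formalCoeff] using h1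
  · intro x hx
    have h1 := hsmall (fun m => deriv (c m) x) fun m hm =>
      ((hA m hm x hx).2.1).trans (le_abs_self _)
    rw [Finset.sum_range_succ', hd0]
    simpa using h1
  · intro x hx
    have hrec : ∀ m ≤ j, deriv (c (m + 1)) x = deriv (deriv (c m)) x - G x * c m x := by
      intro m hm
      exact congrFun (deriv_formalCoeff_succ hG a (by omega : m ≤ j + 1)) x
    have h1 : ∑ m ∈ Finset.range (j + 2), (s⁻¹) ^ m * deriv (deriv (c m)) x
        - s * ∑ m ∈ Finset.range (j + 2), (s⁻¹) ^ m * deriv (c m) x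
        - G x * ∑ m ∈ Finset.range (j + 2), (s⁻¹) ^ m * c m x
        = (s⁻¹) ^ (j + 1) * (deriv (deriv (c (j + 1))) x - G x * c (j + 1) x) := by
      have h2 : s * ∑ m ∈ Finset.range (j + 2), (s⁻¹) ^ m * deriv (c m) x
          = ∑ m ∈ Finset.range (j + 1), (s⁻¹) ^ m * (deriv (deriv (c m)) x - G x * c m x) := by
        rw [Finset.sum_range_succ', hd0, mul_zero, add_zero, Finset.mul_sum]
        refine Finset.sum_congr rfl fun m hm => ?_
        rw [hrec m (by have := Finset.mem_range.1 hm; omega), pow_succ']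
        field_simp
      rw [h2, Finset.mul_sum, sub_right_comm, ← Finset.sum_sub_distrib, Finset.sum_range_succ,
        add_sub_right_comm, ← Finset.sum_sub_distrib, Finset.sum_eq_zero]
      · ring
      · intro m _
        ring
    rw [h1, norm_mul, norm_pow, norm_inv, mul_comm]
    gcongr
    refine ((hA (j + 1) le_rfl x hx).2.2).trans ((le_abs_self _).trans ?_)
    have := Finset.single_le_sum (f := fun m => |A m|) (fun _ _ => abs_nonneg _)
      (Finset.mem_range.2 (by omega : j + 1 < j + 2))
    linarith

end

section


/-! ### The outgoing solution and its asymptotics -/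

/-- `w(x) = e^{iz(x-a)} f(x)` with `s = 2iz`, where `f` is the solution of `-f'' + U f = z² f` that
is equal to `e^{-iz(x-a)}` to the left of `a`; and `q` is the derivative of `w`. -/
structure IsJostSol (U : ℝ → ℂ) (s : ℂ) (a b : ℝ) (w q : ℝ → ℂ) : Prop where
  left : w a = 1
  left_slope : q a = 0
  prim : IsPrim w q a b
  prim_slope : IsPrim q (fun t => s * q t + U t * w t) a b

theorem integral_exp_linear {c : ℝ} (hc : c ≠ 0) (a b : ℝ) :
    ∫ t in a..b, Real.exp (c * (t - a)) = (Real.exp (c * (b - a)) - 1) / c := by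
  have hd : ∀ t : ℝ, HasDerivAt (fun t => Real.exp (c * (t - a)) / c) (Real.exp (c * (t - a))) t := by
    intro t
    have := ((((hasDerivAt_id t).sub_const a).const_mul c).exp).div_const c
    simpa [hc] using this
  rw [intervalIntegral.integral_eq_sub_of_hasDerivAt (fun t _ => hd t)
    (Continuous.intervalIntegrable (by fun_prop) _ _)]
  simp
  ring

theorem integral_exp_neg_le {σ : ℝ} (hσ : 0 < σ) {a b : ℝ} :
    ∫ t in a..b, Real.exp (-(σ * (t - a))) ≤ 1 / σ := by
  have h := integral_exp_linear (neg_ne_zero.2 hσ.ne') a b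
  simp only [neg_mul] at h
  rw [h, div_neg, neg_le_iff_add_nonneg, ← add_div]
  have := Real.exp_pos (-(σ * (b - a)))
  apply div_nonneg _ hσ.le
  linarith

theorem integral_exp_le {σ : ℝ} (hσ : 0 < σ) {a b : ℝ} :
    ∫ t in a..b, Real.exp (σ * (t - a)) ≤ Real.exp (σ * (b - a)) / σ := by
  rw [integral_exp_linear hσ.ne']
  gcongr
  linarith

section LeftEdge

variable {G W U : ℝ → ℂ} {a b δ δ' B K : ℝ} {j : ℕ} {C : ℂ} {s : ℂ} {u u₁ u₂ w q : ℝ → ℂ}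

/-- The source term in the equation for the difference of the outgoing solution and an approximate
solution. -/
def source (G W : ℝ → ℂ) (s : ℂ) (u u₁ u₂ : ℝ → ℂ) (t : ℝ) : ℂ :=
  W t * u t - (u₂ t - s * u₁ t - G t * u t)

theorem IsApproxSol.norm_le_two_mul (hu : IsApproxSol G a b j C K s u u₁ u₂) (hK : 1 ≤ K)
    (hs : 1 ≤ ‖s‖) {x : ℝ} (hx : x ∈ Icc a b) : ‖u x‖ ≤ 2 * K := by
  have h1 := hu.norm_sub_one x hx
  have h2 : K / ‖s‖ ≤ K := div_le_self (by linarith) hs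
  calc ‖u x‖ = ‖(u x - 1) + 1‖ := by ring_nf
    _ ≤ ‖u x - 1‖ + ‖(1 : ℂ)‖ := norm_add_le _ _
    _ ≤ _ := by rw [norm_one]; linarith

theorem isPrim_sub_approx (hu : IsApproxSol G a b j C K s u u₁ u₂) (hw : IsJostSol U s a b w q)
    (hUW : ∀ t ∈ Icc a b, U t = G t + W t) :
    IsPrim (fun x => w x - u x) (fun x => q x - u₁ x) a b ∧
    IsPrim (fun x => q x - u₁ x) (fun t => s * (q t - u₁ t) +
      (U t * (w t - u t) + source G W s u u₁ u₂ t)) a b := by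
  have hab := hw.prim.le
  have c1 : Continuous u₁ := continuous_iff_continuousAt.2 fun x => (hu.deriv_one x).continuousAt
  refine ⟨hw.prim.sub (IsPrim.of_hasDerivAt hab hu.deriv_zero c1),
    (hw.prim_slope.sub (IsPrim.of_hasDerivAt hab hu.deriv_one hu.continuous_two)).congr
      (fun _ _ => rfl) (ae_of_all _ fun t ht => ?_)⟩
  rw [source, hUW t ⟨ht.1.le, ht.2⟩]
  ring

theorem norm_source_le (hu : IsApproxSol G a b j C K s u u₁ u₂) (hK : 1 ≤ K) (hs : 1 ≤ ‖s‖)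
    (hW : ∀ t, ‖W t‖ ≤ B) (hW0 : ∀ t, W t ≠ 0 → t ∈ Icc (a + δ) (b - δ')) (hσ : 0 ≤ s.re) {t : ℝ}
    (ht : t ∈ Icc a b) :
    Real.exp (-(s.re * (t - a))) * ‖source G W s u u₁ u₂ t‖ ≤ 2 * B * K * Real.exp (-(s.re * δ))
      + K * (‖s‖⁻¹) ^ (j + 1) * Real.exp (-(s.re * (t - a))) := by
  have hB : 0 ≤ B := (norm_nonneg _).trans (hW t)
  have h1 : Real.exp (-(s.re * (t - a))) * ‖W t * u t‖ ≤ 2 * B * K * Real.exp (-(s.re * δ)) := by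
    by_cases h : W t = 0
    · rw [h, zero_mul, norm_zero, mul_zero]
      positivity
    · have hδ : δ ≤ t - a := by linarith [(hW0 t h).1]
      rw [norm_mul]
      calc _ ≤ Real.exp (-(s.re * δ)) * (B * (2 * K)) := by
            gcongr
            · exact hW t
            · exact hu.norm_le_two_mul hK hs ht
        _ = _ := by ring
  have h2 := hu.norm_error t ht
  calc _ ≤ Real.exp (-(s.re * (t - a))) *
        (‖W t * u t‖ + ‖u₂ t - s * u₁ t - G t * u t‖) := by
        gcongr
        exact norm_sub_le _ _
    _ ≤ Real.exp (-(s.re * (t - a))) * ‖W t * u t‖ +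
        Real.exp (-(s.re * (t - a))) * (K * (‖s‖⁻¹) ^ (j + 1)) := by
        rw [mul_add]
        gcongr
    _ ≤ _ := by linarith

theorem intervalIntegrable_source (hu : IsApproxSol G a b j C K s u u₁ u₂)
    (hw : IsJostSol U s a b w q) (hUW : ∀ t ∈ Icc a b, U t = G t + W t)
    (hUi : IntervalIntegrable U volume a b) :
    IntervalIntegrable (source G W s u u₁ u₂) volume a b := by
  have hab := hw.prim.le
  obtain ⟨he, hη⟩ := isPrim_sub_approx hu hw hUW
  have h1 := hη.integrable_inhomogeneity
  have h2 : IntervalIntegrable (fun t => U t * (w t - u t)) volume a b :=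
    hUi.mul_continuousOn (by rw [uIcc_of_le hab]; exact he.continuousOn)
  simpa using h1.sub h2

theorem integral_source_le (hu : IsApproxSol G a b j C K s u u₁ u₂) (hK : 1 ≤ K) (hs : 1 ≤ ‖s‖)
    (hab : a ≤ b) (hsi : IntervalIntegrable (source G W s u u₁ u₂) volume a b)
    (hW : ∀ t, ‖W t‖ ≤ B) (hW0 : ∀ t, W t ≠ 0 → t ∈ Icc (a + δ) (b - δ')) (hσ : 0 < s.re) :
    ∫ t in a..b, Real.exp (-(s.re * (t - a))) * ‖source G W s u u₁ u₂ t‖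
      ≤ 2 * (b - a) * B * K * Real.exp (-(s.re * δ)) + K * (‖s‖⁻¹) ^ (j + 1) / s.re := by
  calc _ ≤ ∫ t in a..b, (2 * B * K * Real.exp (-(s.re * δ))
      + K * (‖s‖⁻¹) ^ (j + 1) * Real.exp (-(s.re * (t - a)))) :=
        intervalIntegral.integral_mono_on hab (hsi.norm.continuousOn_mul (by fun_prop))
          (Continuous.intervalIntegrable (by fun_prop) _ _)
          fun t ht => norm_source_le hu hK hs hW hW0 hσ.le ht
    _ = (b - a) * (2 * B * K * Real.exp (-(s.re * δ))) + K * (‖s‖⁻¹) ^ (j + 1) *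
        ∫ t in a..b, Real.exp (-(s.re * (t - a))) := by
        rw [intervalIntegral.integral_add (Continuous.intervalIntegrable (by fun_prop) _ _)
          (Continuous.intervalIntegrable (by fun_prop) _ _),
          intervalIntegral.integral_const, intervalIntegral.integral_const_mul, smul_eq_mul]
    _ ≤ (b - a) * (2 * B * K * Real.exp (-(s.re * δ))) + K * (‖s‖⁻¹) ^ (j + 1) * (1 / s.re) := by
        gcongr
        exact integral_exp_neg_le hσ
    _ = _ := by ring

theorem inv_norm_le_inv_re {s : ℂ} (hσ : 0 < s.re) : ‖s‖⁻¹ ≤ s.re⁻¹ :=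
  inv_anti₀ hσ ((le_abs_self _).trans (Complex.abs_re_le_norm s))

/-- The outgoing solution is an approximate solution plus a reflected wave of amplitude
`s^{-j-2}`, up to the waves reflected by `W`. -/
theorem norm_sub_approx_le (hu : IsApproxSol G a b j C K s u u₁ u₂) (hw : IsJostSol U s a b w q)
    (hK : 1 ≤ K) (hσ : 1 ≤ s.re) (hsB : 4 * (b - a) * B ≤ ‖s‖)
    (hUW : ∀ t ∈ Icc a b, U t = G t + W t) (hUi : IntervalIntegrable U volume a b)
    (hU : ∀ t, ‖U t‖ ≤ B)
    (hW : ∀ t, ‖W t‖ ≤ B) (hW0 : ∀ t, W t ≠ 0 → t ∈ Icc (a + δ) (b - δ')) :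
    ∀ x ∈ Icc a b, ‖w x - u x‖ ≤ 4 * (j.factorial * ‖C‖ + 2 * (b - a) * B * K + K) * ‖s‖⁻¹ *
      ((‖s‖⁻¹) ^ (j + 1) + Real.exp (-(s.re * δ))) * Real.exp (s.re * (x - a)) := by
  have hab := hw.prim.le
  have hs : 1 ≤ ‖s‖ := hσ.trans ((le_abs_self _).trans (Complex.abs_re_le_norm s))
  have hs0 : s ≠ 0 := norm_pos_iff.1 (by linarith)
  have hB : 0 ≤ B := (norm_nonneg _).trans (hW a)
  obtain ⟨he, hη⟩ := isPrim_sub_approx hu hw hUW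
  have hsi := intervalIntegrable_source hu hw hUW hUi
  have hmax : max s.re 0 = s.re := max_eq_left (by linarith)
  have h1 := integral_source_le hu hK hs hab hsi hW hW0 (by linarith)
  have h2 : K * (‖s‖⁻¹) ^ (j + 1) / s.re ≤ K * (‖s‖⁻¹) ^ (j + 1) :=
    div_le_self (by positivity) hσ
  have h3 : ‖q a - u₁ a‖ = j.factorial * ‖C‖ * (‖s‖⁻¹) ^ (j + 1) := by
    rw [hw.left_slope, hu.left_slope]
    simp
  have hL : 0 ≤ b - a := by linarith
  intro x hx
  refine (solution_bound (K := (j.factorial * ‖C‖ + 2 * (b - a) * B * K + K) *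
    ((‖s‖⁻¹) ^ (j + 1) + Real.exp (-(s.re * δ)))) he hη (by rw [hw.left, hu.left, sub_self]) hU hsi
    hsB hs0 ?_ x hx).trans (le_of_eq ?_)
  · rw [hmax, h3]
    have e1 : 0 ≤ (j.factorial * ‖C‖ + K) * Real.exp (-(s.re * δ)) := by positivity
    have e2 : 0 ≤ 2 * (b - a) * B * K * (‖s‖⁻¹) ^ (j + 1) := by positivity
    calc _ ≤ j.factorial * ‖C‖ * (‖s‖⁻¹) ^ (j + 1) +
          (2 * (b - a) * B * K * Real.exp (-(s.re * δ)) + K * (‖s‖⁻¹) ^ (j + 1)) := by linarith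
      _ ≤ _ := by linarith
  · rw [hmax]
    ring

theorem one_le_exp_div {σ L : ℝ} (hL : 0 < L) (hσ : 0 < σ) : 1 ≤ Real.exp (σ * L) / σ / L := by
  rw [le_div_iff₀ hL, le_div_iff₀ hσ]
  linarith [Real.add_one_le_exp (σ * L)]

/-- At the right end the outgoing solution differs from the approximate one by the wave reflected at
`a`, which has grown to the size `|s|^{-(j+2)} e^{Re s (b-a)}`. -/
theorem norm_reflected_sub_le (hu : IsApproxSol G a b j C K s u u₁ u₂)
    (hw : IsJostSol U s a b w q) (hlt : a < b)
    (hK : 1 ≤ K) (hσ : 1 ≤ s.re) (hsB : 4 * (b - a) * B ≤ ‖s‖)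
    (hUW : ∀ t ∈ Icc a b, U t = G t + W t) (hUi : IntervalIntegrable U volume a b)
    (hU : ∀ t, ‖U t‖ ≤ B)
    (hW : ∀ t, ‖W t‖ ≤ B) (hW0 : ∀ t, W t ≠ 0 → t ∈ Icc (a + δ) (b - δ')) :
    ‖s * (w b - u b) - Complex.exp (s * (b - a)) * (j.factorial * C * (s⁻¹) ^ (j + 1))‖ ≤
      (j.factorial * ‖C‖ / (b - a) +
        2 * (4 * (b - a) * B * (j.factorial * ‖C‖ + 2 * (b - a) * B * K + K) +
        2 * (b - a) * B * K + K)) * Real.exp (s.re * (b - a)) *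
        ((‖s‖⁻¹) ^ (j + 1) / s.re + Real.exp (-(s.re * δ))) := by
  have hab := hlt.le
  have hL : 0 < b - a := by linarith
  have hs : 1 ≤ ‖s‖ := hσ.trans ((le_abs_self _).trans (Complex.abs_re_le_norm s))
  have hσ0 : 0 < s.re := by linarith
  have hB : 0 ≤ B := (norm_nonneg _).trans (hW a)
  obtain ⟨he, hη⟩ := isPrim_sub_approx hu hw hUW
  have hsi := intervalIntegrable_source hu hw hUW hUi
  have hmax : max s.re 0 = s.re := max_eq_left (by linarith)
  have hint := integral_source_le hu hK hs hab hsi hW hW0 hσ0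
  have hbd := norm_sub_approx_le hu hw hK hσ hsB hUW hUi hU hW hW0
  set M := (j.factorial * ‖C‖ + 2 * (b - a) * B * K + K) with hM
  have hM0 : 0 ≤ M := by positivity
  set E := (‖s‖⁻¹) ^ (j + 1) + Real.exp (-(s.re * δ)) with hE
  have hηa : q a - u₁ a = j.factorial * C * (s⁻¹) ^ (j + 1) := by
    rw [hw.left_slope, hu.left_slope]
    ring
  have hform := solution_formula he hη (by rw [hw.left, hu.left, sub_self]) (right_mem_Icc.2 hab)
  rw [hηa] at hform
  have hI : ‖∫ t in a..b, (Complex.exp (s * (b - t)) - 1) *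
      (U t * (w t - u t) + source G W s u u₁ u₂ t)‖ ≤ 2 * Real.exp (s.re * (b - a)) *
      ((b - a) * (B * (4 * M * ‖s‖⁻¹ * E)) + (2 * (b - a) * B * K * Real.exp (-(s.re * δ)) +
        K * (‖s‖⁻¹) ^ (j + 1) / s.re)) := by
    have hii : IntervalIntegrable (fun t => Real.exp (-(s.re * (t - a))) *
        ‖source G W s u u₁ u₂ t‖) volume a b := hsi.norm.continuousOn_mul (by fun_prop)
    calc _ ≤ ∫ t in a..b, 2 * Real.exp (s.re * (b - a)) * (B * (4 * M * ‖s‖⁻¹ * E) +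
          Real.exp (-(s.re * (t - a))) * ‖source G W s u u₁ u₂ t‖) := by
          refine intervalIntegral.norm_integral_le_of_norm_le hab (ae_of_all _ fun t ht => ?_)
            ((intervalIntegrable_const.add hii).const_mul _)
          have htI : t ∈ Icc a b := ⟨ht.1.le, ht.2⟩
          have e1 : ‖Complex.exp (s * (b - t)) - 1‖ ≤ 2 * Real.exp (s.re * (b - t)) := by
            have := norm_cexp_sub_one_le s (sub_nonneg.2 ht.2)
            rw [hmax] at this
            exact_mod_cast this
          have e2 : Real.exp (s.re * (b - t)) =
              Real.exp (s.re * (b - a)) * Real.exp (-(s.re * (t - a))) := by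
            rw [← Real.exp_add]; ring_nf
          have e3 : Real.exp (-(s.re * (t - a))) * Real.exp (s.re * (t - a)) = 1 := by
            rw [← Real.exp_add, neg_add_cancel, Real.exp_zero]
          rw [norm_mul]
          calc _ ≤ 2 * Real.exp (s.re * (b - t)) * (B * (4 * M * ‖s‖⁻¹ * E *
                Real.exp (s.re * (t - a))) + ‖source G W s u u₁ u₂ t‖) := by
                gcongr
                refine (norm_add_le _ _).trans ?_
                rw [norm_mul]
                gcongr
                · exact hU t
                · exact hbd t htI
            _ = 2 * Real.exp (s.re * (b - a)) * (B * (4 * M * ‖s‖⁻¹ * E) *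
                (Real.exp (-(s.re * (t - a))) * Real.exp (s.re * (t - a))) +
                Real.exp (-(s.re * (t - a))) * ‖source G W s u u₁ u₂ t‖) := by rw [e2]; ring
            _ = _ := by rw [e3, mul_one]
      _ = 2 * Real.exp (s.re * (b - a)) * ((b - a) * (B * (4 * M * ‖s‖⁻¹ * E)) +
          ∫ t in a..b, Real.exp (-(s.re * (t - a))) * ‖source G W s u u₁ u₂ t‖) := by
          rw [intervalIntegral.integral_const_mul, intervalIntegral.integral_add
            intervalIntegrable_const hii, intervalIntegral.integral_const, smul_eq_mul]
      _ ≤ _ := by gcongr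
  have hEr : ‖s‖⁻¹ * E ≤ (‖s‖⁻¹) ^ (j + 1) / s.re + Real.exp (-(s.re * δ)) := by
    have h1 := inv_norm_le_inv_re hσ0
    have h2 : ‖s‖⁻¹ ≤ 1 := inv_le_one_of_one_le₀ hs
    rw [hE, mul_add, div_eq_mul_inv, mul_comm ((‖s‖⁻¹) ^ (j + 1))]
    have : ‖s‖⁻¹ * Real.exp (-(s.re * δ)) ≤ 1 * Real.exp (-(s.re * δ)) := by gcongr
    gcongr
    linarith
  set E' := (‖s‖⁻¹) ^ (j + 1) / s.re + Real.exp (-(s.re * δ)) with hE'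
  have hp : 0 ≤ (‖s‖⁻¹) ^ (j + 1) / s.re := by positivity
  have hq : 0 ≤ Real.exp (-(s.re * δ)) := by positivity
  have hfst : ‖(j.factorial : ℂ) * C * (s⁻¹) ^ (j + 1)‖ ≤
      j.factorial * ‖C‖ / (b - a) * Real.exp (s.re * (b - a)) * E' := by
    have h1 := one_le_exp_div hL hσ0
    calc _ = j.factorial * ‖C‖ * (‖s‖⁻¹) ^ (j + 1) * 1 := by simp
      _ ≤ j.factorial * ‖C‖ * (‖s‖⁻¹) ^ (j + 1) *
          (Real.exp (s.re * (b - a)) / s.re / (b - a)) := by gcongr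
      _ = j.factorial * ‖C‖ / (b - a) * Real.exp (s.re * (b - a)) *
          ((‖s‖⁻¹) ^ (j + 1) / s.re) := by ring
      _ ≤ _ := by
          gcongr
          linarith
  have hsplit : s * (w b - u b) - Complex.exp (s * (b - a)) * (j.factorial * C * (s⁻¹) ^ (j + 1))
      = -(j.factorial * C * (s⁻¹) ^ (j + 1)) + ∫ t in a..b, (Complex.exp (s * (b - t)) - 1) *
      (U t * (w t - u t) + source G W s u u₁ u₂ t) := by
    rw [hform]
    ring
  rw [hsplit]
  refine (norm_add_le _ _).trans ?_
  rw [norm_neg]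
  have hsecond : (b - a) * (B * (4 * M * ‖s‖⁻¹ * E)) +
      (2 * (b - a) * B * K * Real.exp (-(s.re * δ)) + K * (‖s‖⁻¹) ^ (j + 1) / s.re) ≤
      (4 * (b - a) * B * M + 2 * (b - a) * B * K + K) * E' := by
    have h1 : (b - a) * (B * (4 * M * ‖s‖⁻¹ * E)) ≤ 4 * (b - a) * B * M * E' := by
      calc _ = 4 * (b - a) * B * M * (‖s‖⁻¹ * E) := by ring
        _ ≤ _ := by gcongr
    have h2 : 2 * (b - a) * B * K * Real.exp (-(s.re * δ)) ≤ 2 * (b - a) * B * K * E' := by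
      gcongr
      linarith
    have h3 : K * (‖s‖⁻¹) ^ (j + 1) / s.re ≤ K * E' := by
      rw [mul_div_assoc]
      gcongr
      linarith
    linarith
  calc _ ≤ j.factorial * ‖C‖ / (b - a) * Real.exp (s.re * (b - a)) * E' +
        2 * Real.exp (s.re * (b - a)) * ((4 * (b - a) * B * M + 2 * (b - a) * B * K + K) * E') := by
        gcongr
        exact hI.trans (by gcongr)
    _ = _ := by ring

end LeftEdge

end

section


/-- The size of the error in the asymptotics of the outgoing solution: the terms come from the
slowly varying part, from the corrections to the reflections at both endpoints, and from the
reflections that involve the perturbation, supported in `[a + δ, b - δ']`. -/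
def jostError (L δ δ' : ℝ) (j k : ℕ) (s : ℂ) : ℝ :=
  ‖s‖⁻¹ + Real.exp (s.re * L) * (‖s‖⁻¹) ^ (j + k + 4) / s.re
    + (‖s‖⁻¹) ^ (k + 3) * Real.exp (s.re * (L - δ))
    + (‖s‖⁻¹) ^ (j + 3) * Real.exp (s.re * (L - δ'))
    + (‖s‖⁻¹) ^ 2 * Real.exp (s.re * (L - δ - δ'))

section

variable {G W U : ℝ → ℂ} {a b δ δ' B K : ℝ} {j k : ℕ} {C₁ C₂ : ℂ} {s : ℂ}
  {u u₁ u₂ v v₁ v₂ w q : ℝ → ℂ}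

/-- The Wronskian of the outgoing solution and an approximate solution from the right end. -/
theorem isPrim_wronskian (hw : IsJostSol U s a b w q)
    (hv : IsApproxSol (fun x => G (a + b - x)) a b k C₂ K s v v₁ v₂)
    (hUW : ∀ t ∈ Icc a b, U t = G t + W t) :
    IsPrim (fun x => w x * -v₁ (a + b - x) - q x * v (a + b - x) + s * (w x * v (a + b - x)))
      (fun x => w x * (v₂ (a + b - x) - s * v₁ (a + b - x) - G x * v (a + b - x))
        - W x * w x * v (a + b - x)) a b := by
  have hab := hw.prim.le
  have d0 : ∀ x, HasDerivAt (fun x => v (a + b - x)) (-v₁ (a + b - x)) x := fun x =>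
    (hv.deriv_zero _).comp_const_sub (a + b) x
  have d1 : ∀ x, HasDerivAt (fun x => -v₁ (a + b - x)) (v₂ (a + b - x)) x := fun x => by
    simpa using ((hv.deriv_one _).comp_const_sub (a + b) x).fun_neg
  have c1 : Continuous v₁ := continuous_iff_continuousAt.2 fun x => (hv.deriv_one x).continuousAt
  have p0 := IsPrim.of_hasDerivAt hab d0 (by fun_prop)
  have p1 := IsPrim.of_hasDerivAt hab d1 (hv.continuous_two.comp (by fun_prop))
  refine (((hw.prim.mul p1).sub (hw.prim_slope.mul p0)).add
    ((hw.prim.mul p0).const_mul s)).congr (fun _ _ => rfl) (ae_of_all _ fun t ht => ?_)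
  rw [hUW t ⟨ht.1.le, ht.2⟩]
  ring

theorem jost_error_bound (hu : IsApproxSol G a b j C₁ K s u u₁ u₂)
    (hv : IsApproxSol (fun x => G (a + b - x)) a b k C₂ K s v v₁ v₂)
    (hw : IsJostSol U s a b w q) (hlt : a < b)
    (hK : 1 ≤ K) (hσ : 1 ≤ s.re) (hsB : 4 * (b - a) * B ≤ ‖s‖)
    (hUW : ∀ t ∈ Icc a b, U t = G t + W t) (hUi : IntervalIntegrable U volume a b)
    (hU : ∀ t, ‖U t‖ ≤ B)
    (hW : ∀ t, ‖W t‖ ≤ B) (hW0 : ∀ t, W t ≠ 0 → t ∈ Icc (a + δ) (b - δ')) {A A' : ℝ}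
    (hA : A = 4 * (j.factorial * ‖C₁‖ + 2 * (b - a) * B * K + K))
    (hA' : A' = j.factorial * ‖C₁‖ / (b - a) +
        2 * (4 * (b - a) * B * (j.factorial * ‖C₁‖ + 2 * (b - a) * B * K + K) +
        2 * (b - a) * B * K + K)) :
    ‖w b - q b / s - 1 + j.factorial * k.factorial * C₁ * C₂ * (s⁻¹) ^ (j + k + 4) *
        Complex.exp (s * (b - a))‖
      ≤ (2 * K + 2 * K ^ 2 + 2 * K ^ 2 * (b - a) + K * A + 4 * B * K ^ 2 * (b - a)
        + 2 * B * K * (b - a) * A + A' * (k.factorial * ‖C₂‖)) *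
        jostError (b - a) δ δ' j k s := by
  have hab := hlt.le
  have hL : 0 < b - a := by linarith
  have hs : 1 ≤ ‖s‖ := hσ.trans ((le_abs_self _).trans (Complex.abs_re_le_norm s))
  have hs0 : s ≠ 0 := norm_pos_iff.1 (by linarith)
  have hσ0 : 0 < s.re := by linarith
  have hB : 0 ≤ B := (norm_nonneg _).trans (hW a)
  have hA0 : 0 ≤ A := by rw [hA]; positivity
  have hA'0 : 0 ≤ A' := by rw [hA']; positivity
  have hr1 : ‖s‖⁻¹ ≤ 1 := inv_le_one_of_one_le₀ hs
  have hbd := norm_sub_approx_le hu hw hK hσ hsB hUW hUi hU hW hW0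
  have hstar := norm_reflected_sub_le hu hw hlt hK hσ hsB hUW hUi hU hW hW0
  rw [← hA] at hbd
  rw [← hA'] at hstar
  set r := ‖s‖⁻¹ with hr
  have hr0 : 0 ≤ r := by positivity
  set E := r ^ (j + 1) + Real.exp (-(s.re * δ)) with hE
  have hE0 : 0 ≤ E := by positivity
  have hrefl : ∀ t ∈ Icc a b, a + b - t ∈ Icc a b := fun t ht =>
    ⟨by linarith [ht.2], by linarith [ht.1]⟩
  have hwle : ∀ t ∈ Icc a b, ‖w t‖ ≤ 2 * K + A * r * E * Real.exp (s.re * (t - a)) := by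
    intro t ht
    calc ‖w t‖ = ‖u t + (w t - u t)‖ := by ring_nf
      _ ≤ ‖u t‖ + ‖w t - u t‖ := norm_add_le _ _
      _ ≤ _ := add_le_add (hu.norm_le_two_mul hK hs ht) (hbd t ht)
  have hI : ‖∫ x in a..b, (w x * (v₂ (a + b - x) - s * v₁ (a + b - x) - G x * v (a + b - x))
        - W x * w x * v (a + b - x))‖ ≤
      K * r ^ (k + 1) * (2 * K * (b - a) + A * r * E * (Real.exp (s.re * (b - a)) / s.re)) +
      (b - a) * (2 * B * K * (2 * K + A * r * E * Real.exp (s.re * (b - a - δ')))) := by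
    calc _ ≤ ∫ t in a..b, (K * r ^ (k + 1) * (2 * K + A * r * E * Real.exp (s.re * (t - a))) +
          2 * B * K * (2 * K + A * r * E * Real.exp (s.re * (b - a - δ')))) := by
          refine intervalIntegral.norm_integral_le_of_norm_le hab (ae_of_all _ fun t ht => ?_)
            (Continuous.intervalIntegrable (by fun_prop) _ _)
          have htI : t ∈ Icc a b := ⟨ht.1.le, ht.2⟩
          have h1 := hv.norm_error _ (hrefl t htI)
          rw [sub_sub_cancel] at h1
          have h2 := hwle t htI
          have h3 : ‖W t * w t * v (a + b - t)‖ ≤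
              2 * B * K * (2 * K + A * r * E * Real.exp (s.re * (b - a - δ'))) := by
            by_cases h : W t = 0
            · rw [h, zero_mul, zero_mul, norm_zero]
              positivity
            · have ht2 : t - a ≤ b - a - δ' := by linarith [(hW0 t h).2]
              rw [norm_mul, norm_mul]
              calc _ ≤ B * (2 * K + A * r * E * Real.exp (s.re * (b - a - δ'))) * (2 * K) := by
                    gcongr
                    · exact hW t
                    · exact h2.trans (by gcongr)
                    · exact hv.norm_le_two_mul hK hs (hrefl t htI)
                _ = _ := by ring
          refine (norm_sub_le _ _).trans (add_le_add ?_ h3)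
          rw [norm_mul, mul_comm]
          gcongr
      _ = K * r ^ (k + 1) * ((b - a) * (2 * K) +
          A * r * E * ∫ t in a..b, Real.exp (s.re * (t - a))) +
          (b - a) * (2 * B * K * (2 * K + A * r * E * Real.exp (s.re * (b - a - δ')))) := by
          rw [intervalIntegral.integral_add (Continuous.intervalIntegrable (by fun_prop) _ _)
            (Continuous.intervalIntegrable (by fun_prop) _ _),
            intervalIntegral.integral_const_mul, intervalIntegral.integral_add
            (Continuous.intervalIntegrable (by fun_prop) _ _)
            (Continuous.intervalIntegrable (by fun_prop) _ _), intervalIntegral.integral_const,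
            intervalIntegral.integral_const, intervalIntegral.integral_const_mul, smul_eq_mul,
            smul_eq_mul]
      _ ≤ K * r ^ (k + 1) * ((b - a) * (2 * K) +
          A * r * E * (Real.exp (s.re * (b - a)) / s.re)) +
          (b - a) * (2 * B * K * (2 * K + A * r * E * Real.exp (s.re * (b - a - δ')))) := by
          gcongr
          exact integral_exp_le hσ0
      _ = _ := by ring
  have hwr := (isPrim_wronskian hw hv hUW).eq b (right_mem_Icc.2 hab)
  set I := ∫ x in a..b, (w x * (v₂ (a + b - x) - s * v₁ (a + b - x) - G x * v (a + b - x))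
        - W x * w x * v (a + b - x)) with hIdef
  simp only [add_sub_cancel_right, add_sub_cancel_left, hw.left, hw.left_slope, hv.left] at hwr
  have hvb := hv.norm_sub_one b (right_mem_Icc.2 hab)
  have hv1b := hv.norm_slope b (right_mem_Icc.2 hab)
  have hub := hu.norm_le_two_mul hK hs (right_mem_Icc.2 hab)
  have hv1a : ‖v₁ a‖ = k.factorial * ‖C₂‖ * r ^ (k + 1) := by
    rw [hv.left_slope]
    simp [hr]
  have hv1a' := hv.norm_slope a (left_mem_Icc.2 hab)
  set R := s * (w b - u b) - Complex.exp (s * (b - a)) * (j.factorial * C₁ * (s⁻¹) ^ (j + 1))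
    with hR
  have hid : w b - q b / s - 1 + j.factorial * k.factorial * C₁ * C₂ * (s⁻¹) ^ (j + k + 4) *
        Complex.exp (s * (b - a)) =
      s⁻¹ * (-v₁ b + s * (v b - 1) + I + u b * v₁ a) + (s⁻¹) ^ 2 * (R * v₁ a) := by
    have e1 : s * s⁻¹ = 1 := mul_inv_cancel₀ hs0
    have e2 : w b - q b / s = s⁻¹ * (s * w b - q b) := by
      field_simp
    have e3 : s * w b - q b = -v₁ b + s * v b + I + w b * v₁ a := by
      linear_combination hwr
    have e4 : (s⁻¹) ^ 2 * (s * (w b - u b) * v₁ a) = s⁻¹ * ((w b - u b) * v₁ a) := by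
      field_simp
    have e5 : (j.factorial * k.factorial * C₁ * C₂ * (s⁻¹) ^ (j + k + 4) *
        Complex.exp (s * (b - a)) : ℂ) = -((s⁻¹) ^ 2 * (Complex.exp (s * (b - a)) *
        (j.factorial * C₁ * (s⁻¹) ^ (j + 1)) * v₁ a)) := by
      rw [hv.left_slope]
      ring
    rw [e2, e3, e5, hR]
    have e6 : s⁻¹ * (s * (v b - 1)) = v b - 1 := by field_simp
    have e7 : s⁻¹ * (s * v b) = v b := by field_simp
    linear_combination e7 - e6 - e4
  have hsv : ‖s * (v b - 1)‖ ≤ K := by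
    rw [norm_mul]
    calc ‖s‖ * ‖v b - 1‖ ≤ ‖s‖ * (K / ‖s‖) := by gcongr
      _ = K := by field_simp
  have hKr : K / ‖s‖ = K * r := by rw [hr, div_eq_mul_inv]
  rw [hKr] at hv1b hv1a'
  have hP : ‖-v₁ b + s * (v b - 1) + I + u b * v₁ a‖ ≤ K * r + K + ‖I‖ + 2 * K * (K * r) := by
    refine (norm_add_le _ _).trans (add_le_add ((norm_add_le _ _).trans (add_le_add
      ((norm_add_le _ _).trans (add_le_add ?_ hsv)) le_rfl)) ?_)
    · rwa [norm_neg]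
    · rw [norm_mul]
      gcongr
  have hmain : ‖w b - q b / s - 1 + j.factorial * k.factorial * C₁ * C₂ * (s⁻¹) ^ (j + k + 4) *
        Complex.exp (s * (b - a))‖ ≤ r * (K * r + K + ‖I‖ + 2 * K * (K * r)) +
      r ^ 2 * (A' * Real.exp (s.re * (b - a)) * (r ^ (j + 1) / s.re + Real.exp (-(s.re * δ))) *
        (k.factorial * ‖C₂‖ * r ^ (k + 1))) := by
    rw [hid]
    refine (norm_add_le _ _).trans (add_le_add ?_ ?_)
    · rw [norm_mul, norm_inv]
      gcongr
    · rw [norm_mul, norm_pow, norm_inv, norm_mul, hv1a]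
      gcongr
  refine hmain.trans ?_
  -- the five error terms
  have x1 : Real.exp (s.re * (b - a)) * Real.exp (-(s.re * δ)) =
      Real.exp (s.re * (b - a - δ)) := by rw [← Real.exp_add]; ring_nf
  have x2 : Real.exp (-(s.re * δ)) * Real.exp (s.re * (b - a - δ')) =
      Real.exp (s.re * (b - a - δ - δ')) := by rw [← Real.exp_add]; ring_nf
  set X := Real.exp (s.re * (b - a)) with hX
  set t2 := X * r ^ (j + k + 4) / s.re with ht2
  set t3 := r ^ (k + 3) * Real.exp (s.re * (b - a - δ)) with ht3
  set t4 := r ^ (j + 3) * Real.exp (s.re * (b - a - δ')) with ht4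
  set t5 := r ^ 2 * Real.exp (s.re * (b - a - δ - δ')) with ht5
  have hT : jostError (b - a) δ δ' j k s = r + t2 + t3 + t4 + t5 := rfl
  have p2 : 0 ≤ t2 := by positivity
  have p3 : 0 ≤ t3 := by positivity
  have p4 : 0 ≤ t4 := by positivity
  have p5 : 0 ≤ t5 := by positivity
  have pk : r ^ (k + 1) ≤ 1 := pow_le_one₀ hr0 hr1
  have hinvσ : s.re⁻¹ ≤ 1 := inv_le_one_of_one_le₀ hσ
  have q1 : r * (r ^ (k + 1) * (A * r * E * (X / s.re))) ≤ A * (t2 + t3) := by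
    have : r * (r ^ (k + 1) * (A * r * E * (X / s.re))) = A * (t2 + t3 * s.re⁻¹) := by
      rw [hE, ht2, ht3, ← x1]
      ring
    rw [this]
    have : t3 * s.re⁻¹ ≤ t3 * 1 := by gcongr
    gcongr
    linarith
  have q2 : r * (A * r * E * Real.exp (s.re * (b - a - δ'))) = A * (t4 + t5) := by
    rw [hE, ht4, ht5, ← x2]
    ring
  have q3 : r ^ 2 * (A' * X * (r ^ (j + 1) / s.re + Real.exp (-(s.re * δ))) *
        (k.factorial * ‖C₂‖ * r ^ (k + 1))) = A' * (k.factorial * ‖C₂‖) * (t2 + t3) := by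
    rw [ht2, ht3, ← x1]
    ring
  rw [q3, hT]
  have q4 : r * ‖I‖ ≤ 2 * K ^ 2 * (b - a) * r + K * (A * (t2 + t3)) + 4 * B * K ^ 2 * (b - a) * r
      + 2 * B * K * (b - a) * (A * (t4 + t5)) := by
    calc r * ‖I‖ ≤ r * (K * r ^ (k + 1) * (2 * K * (b - a) + A * r * E * (X / s.re)) +
      (b - a) * (2 * B * K * (2 * K + A * r * E * Real.exp (s.re * (b - a - δ'))))) := by gcongr
      _ = 2 * K ^ 2 * (b - a) * r * r ^ (k + 1) + K * (r * (r ^ (k + 1) * (A * r * E * (X / s.re))))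
        + 4 * B * K ^ 2 * (b - a) * r + 2 * B * K * (b - a) *
          (r * (A * r * E * Real.exp (s.re * (b - a - δ')))) := by ring
      _ ≤ 2 * K ^ 2 * (b - a) * r * 1 + K * (A * (t2 + t3))
        + 4 * B * K ^ 2 * (b - a) * r + 2 * B * K * (b - a) * (A * (t4 + t5)) := by
          rw [q2]
          gcongr
      _ = _ := by ring
  have q5 : r * (K * r + K + 2 * K * (K * r)) ≤ (2 * K + 2 * K ^ 2) * r := by
    have : r * (K * r + K + 2 * K * (K * r)) = K * r * r + K * r + 2 * K ^ 2 * r * r := by ring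
    rw [this]
    have h1 : K * r * r ≤ K * r * 1 := by gcongr
    have h2 : 2 * K ^ 2 * r * r ≤ 2 * K ^ 2 * r * 1 := by gcongr
    linarith
  have g0 : 0 ≤ 2 * K + 2 * K ^ 2 + 2 * K ^ 2 * (b - a) + 4 * B * K ^ 2 * (b - a) := by positivity
  have g1 : 0 ≤ K * A + A' * (k.factorial * ‖C₂‖) := by positivity
  have g2 : 0 ≤ 2 * B * K * (b - a) * A := by positivity
  have m1 := mul_nonneg g0 (by linarith : 0 ≤ t2 + t3 + t4 + t5)
  have m2 := mul_nonneg g1 (by linarith : 0 ≤ r + t4 + t5)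
  have m3 := mul_nonneg g2 (by linarith : 0 ≤ r + t2 + t3)
  calc _ = r * (K * r + K + 2 * K * (K * r)) + r * ‖I‖ + A' * (k.factorial * ‖C₂‖) * (t2 + t3) := by
        ring
    _ ≤ (2 * K + 2 * K ^ 2) * r + (2 * K ^ 2 * (b - a) * r + K * (A * (t2 + t3)) +
        4 * B * K ^ 2 * (b - a) * r + 2 * B * K * (b - a) * (A * (t4 + t5))) +
        A' * (k.factorial * ‖C₂‖) * (t2 + t3) := by gcongr
    _ ≤ _ := by linarith

end

/-- The asymptotics of the outgoing solution for `Re s ≥ 1`: its amplitude at `b` is a constant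
`1`, plus the wave which is reflected first at `b` and then at `a`. -/
theorem jost_asymptotics {V W U : ℝ → ℂ} {a b δ δ' B : ℝ} {j k N : ℕ} {C₁ C₂ : ℂ} (hlt : a < b)
    (hV : ContDiffOn ℝ N V (Icc a b)) (hjN : j < N) (hkN : k < N)
    (hleft : Asymptotics.IsEquivalent (𝓝[>] a) V fun x : ℝ => C₁ * ((x - a : ℝ) : ℂ) ^ j)
    (hright : Asymptotics.IsEquivalent (𝓝[<] b) V fun x : ℝ => C₂ * ((b - x : ℝ) : ℂ) ^ k)
    (hUW : ∀ t ∈ Icc a b, U t = V t + W t) (hUi : IntervalIntegrable U volume a b)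
    (hU : ∀ t, ‖U t‖ ≤ B)
    (hW : ∀ t, ‖W t‖ ≤ B) (hW0 : ∀ t, W t ≠ 0 → t ∈ Icc (a + δ) (b - δ')) :
    ∃ A S : ℝ, 0 ≤ A ∧ ∀ s : ℂ, S ≤ ‖s‖ → 1 ≤ s.re → ∀ w q, IsJostSol U s a b w q →
      ‖w b - q b / s - 1 + j.factorial * k.factorial * C₁ * C₂ * (s⁻¹) ^ (j + k + 4) *
        Complex.exp (s * (b - a))‖ ≤ A * jostError (b - a) δ δ' j k s := by
  obtain ⟨G, hG, hGV⟩ := exists_contDiff_extension hlt N V hV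
  have hleft' : Asymptotics.IsEquivalent (𝓝[>] a) G fun x : ℝ => C₁ * ((x - a : ℝ) : ℂ) ^ j := by
    refine hleft.congr_left ?_
    filter_upwards [Ioo_mem_nhdsGT hlt] with x hx using (hGV ⟨hx.1.le, hx.2.le⟩).symm
  have hright' : Asymptotics.IsEquivalent (𝓝[>] a) (fun x => G (a + b - x))
      fun x : ℝ => C₂ * ((x - a : ℝ) : ℂ) ^ k := by
    have ht : Tendsto (fun x : ℝ => a + b - x) (𝓝[>] a) (𝓝[<] b) := by
      refine tendsto_nhdsWithin_iff.2 ⟨?_, ?_⟩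
      · have : Continuous fun x : ℝ => a + b - x := by fun_prop
        have := this.tendsto a
        rw [add_sub_cancel_left] at this
        exact this.mono_left nhdsWithin_le_nhds
      · filter_upwards [self_mem_nhdsWithin] with x hx
        have : a < x := hx
        simp only [mem_Iio]
        linarith
    have h1 : Asymptotics.IsEquivalent (𝓝[<] b) G fun x : ℝ => C₂ * ((b - x : ℝ) : ℂ) ^ k := by
      refine hright.congr_left ?_
      filter_upwards [Ioo_mem_nhdsLT hlt] with x hx using (hGV ⟨hx.1.le, hx.2.le⟩).symm
    have h2 := h1.comp_tendsto ht
    refine h2.congr_right (Eventually.of_forall fun x => ?_)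
    simp only [Function.comp]
    congr 3
    ring
  have hG' : ContDiff ℝ N fun x => G (a + b - x) := hG.comp (contDiff_const.sub contDiff_id)
  have hGj : ContDiff ℝ (j + 1 : ℕ) G := hG.of_le (by exact_mod_cast hjN)
  have hGk : ContDiff ℝ (k + 1 : ℕ) fun x => G (a + b - x) := hG'.of_le (by exact_mod_cast hkN)
  obtain ⟨hz, hj⟩ := iteratedDeriv_of_isEquivalent
    (hGj.of_le (by exact_mod_cast Nat.le_succ j)) hleft'
  obtain ⟨hz', hk⟩ := iteratedDeriv_of_isEquivalent
    (hGk.of_le (by exact_mod_cast Nat.le_succ k)) hright'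
  obtain ⟨K₁, hK₁, hu⟩ := exists_isApproxSol (b := b) hGj hz hj
  obtain ⟨K₂, hK₂, hv⟩ := exists_isApproxSol (b := b) hGk hz' hk
  have mono : ∀ {G : ℝ → ℂ} {j : ℕ} {C : ℂ} {K : ℝ} {s : ℂ} {u u₁ u₂ : ℝ → ℂ},
      K ≤ max K₁ K₂ → IsApproxSol G a b j C K s u u₁ u₂ →
      IsApproxSol G a b j C (max K₁ K₂) s u u₁ u₂ := fun hK h =>
    { h with
      norm_sub_one := fun x hx => (h.norm_sub_one x hx).trans (by gcongr)
      norm_slope := fun x hx => (h.norm_slope x hx).trans (by gcongr)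
      norm_error := fun x hx => (h.norm_error x hx).trans (by gcongr) }
  have hB : 0 ≤ B := (norm_nonneg _).trans (hW a)
  have hL : 0 < b - a := by linarith
  set K := max K₁ K₂ with hK
  have hK0 : 0 ≤ K := by linarith [le_max_left K₁ K₂]
  set A₀ := 4 * (j.factorial * ‖C₁‖ + 2 * (b - a) * B * K + K) with hA₀
  set A' := j.factorial * ‖C₁‖ / (b - a) +
        2 * (4 * (b - a) * B * (j.factorial * ‖C₁‖ + 2 * (b - a) * B * K + K) +
        2 * (b - a) * B * K + K) with hA'
  refine ⟨2 * K + 2 * K ^ 2 + 2 * K ^ 2 * (b - a) + K * A₀ + 4 * B * K ^ 2 * (b - a)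
        + 2 * B * K * (b - a) * A₀ + A' * (k.factorial * ‖C₂‖), 4 * (b - a) * B, by positivity,
    fun s hs hσ w q hw => ?_⟩
  · have hs1 : 1 ≤ ‖s‖ := hσ.trans ((le_abs_self _).trans (Complex.abs_re_le_norm s))
    obtain ⟨u, u₁, u₂, hu⟩ := hu s hs1
    obtain ⟨v, v₁, v₂, hv⟩ := hv s hs1
    exact jost_error_bound (mono (le_max_left _ _) hu) (mono (le_max_right _ _) hv) hw hlt
      (hK₁.trans (le_max_left _ _)) hσ hs (fun t ht => by rw [hUW t ht, hGV ht]) hUi hU hW hW0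
      hA₀ hA'

/-- The crude asymptotics of the outgoing solution for all `s`. -/
theorem jost_crude_bound {U w q : ℝ → ℂ} {a b B : ℝ} {s : ℂ} (hw : IsJostSol U s a b w q)
    (hUi : IntervalIntegrable U volume a b) (hU : ∀ t, ‖U t‖ ≤ B)
    (hs : 4 * (b - a) * B ≤ ‖s‖) (hs0 : s ≠ 0) :
    ‖w b - q b / s - 1‖ ≤ (b - a) * B / ‖s‖ *
      (1 + 4 * ((b - a) * B) / ‖s‖ * Real.exp (max s.re 0 * (b - a))) := by
  have hab := hw.prim.le
  have hB : 0 ≤ B := (norm_nonneg _).trans (hU a)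
  have he : IsPrim (fun x => w x - 1) q a b :=
    ⟨hab, hw.prim.integrable, fun x hx => by rw [hw.prim.eq x hx]; ring⟩
  have hη : IsPrim q (fun t => s * q t + (U t * (w t - 1) + U t)) a b :=
    hw.prim_slope.congr (fun _ _ => rfl) (ae_of_all _ fun t _ => by ring)
  have hbd := solution_bound (K := (b - a) * B) he hη (by rw [hw.left, sub_self]) hU hUi hs hs0 (by
    rw [hw.left_slope, norm_zero, zero_add]
    calc _ ≤ ∫ t in a..b, B := by
          refine intervalIntegral.integral_mono_on hab (hUi.norm.continuousOn_mul (by fun_prop))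
            intervalIntegrable_const fun t ht => ?_
          have : Real.exp (-(max s.re 0 * (t - a))) ≤ 1 := by
            rw [Real.exp_le_one_iff, neg_nonpos]
            exact mul_nonneg (le_max_right _ _) (by linarith [ht.1])
          calc _ ≤ 1 * B := by gcongr; exact hU t
            _ = B := one_mul B
      _ = _ := by simp)
  have hform := ((((hw.prim.const_mul s).sub hw.prim_slope)).congr (F' := fun t => -(U t * w t))
    (fun _ _ => rfl) (ae_of_all _ fun t _ => by ring)).eq b (right_mem_Icc.2 hab)
  rw [intervalIntegral.integral_neg, hw.left, hw.left_slope] at hform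
  have hid : w b - q b / s - 1 = -(s⁻¹ * ∫ t in a..b, U t * w t) := by
    field_simp
    linear_combination hform
  have hI : ‖∫ t in a..b, U t * w t‖ ≤ ∫ t in a..b, B *
      (1 + 4 * ((b - a) * B) / ‖s‖ * Real.exp (max s.re 0 * (b - a))) := by
    refine intervalIntegral.norm_integral_le_of_norm_le hab (ae_of_all _ fun t ht => ?_)
      intervalIntegrable_const
    have htI : t ∈ Icc a b := ⟨ht.1.le, ht.2⟩
    have hL : 0 ≤ b - a := by linarith
    rw [norm_mul]
    gcongr
    · exact hU t
    · calc ‖w t‖ = ‖1 + (w t - 1)‖ := by ring_nf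
        _ ≤ ‖(1 : ℂ)‖ + ‖w t - 1‖ := norm_add_le _ _
        _ ≤ _ := by
          rw [norm_one]
          gcongr
          refine (hbd t htI).trans ?_
          gcongr
          exact htI.2
  rw [hid, norm_neg, norm_mul, norm_inv]
  rw [intervalIntegral.integral_const, smul_eq_mul] at hI
  calc _ ≤ ‖s‖⁻¹ * ((b - a) * (B *
      (1 + 4 * ((b - a) * B) / ‖s‖ * Real.exp (max s.re 0 * (b - a))))) := by gcongr
    _ = _ := by ring

/-- The outgoing solution is unique once `|s|` is large. -/
theorem IsJostSol.unique {U w q w' q' : ℝ → ℂ} {a b B : ℝ} {s : ℂ} (hw : IsJostSol U s a b w q)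
    (hw' : IsJostSol U s a b w' q') (hU : ∀ t, ‖U t‖ ≤ B)
    (hs : 4 * (b - a) * B ≤ ‖s‖) (hs0 : s ≠ 0) : w b = w' b ∧ q b = q' b := by
  have hab := hw.prim.le
  have he := hw.prim.sub hw'.prim
  have hη : IsPrim (fun x => q x - q' x)
      (fun t => s * (q t - q' t) + (U t * (w t - w' t) + (fun _ => (0 : ℂ)) t)) a b :=
    (hw.prim_slope.sub hw'.prim_slope).congr (fun _ _ => rfl) (ae_of_all _ fun t _ => by ring)
  have h0 := solution_bound (K := 0) he hη (by rw [hw.left, hw'.left, sub_self]) hU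
    intervalIntegrable_const hs hs0 (by simp [hw.left_slope, hw'.left_slope])
  have hz : ∀ x ∈ Icc a b, w x - w' x = 0 := fun x hx => by simpa using h0 x hx
  have hb := right_mem_Icc.2 hab
  refine ⟨sub_eq_zero.1 (hz b hb), sub_eq_zero.1 ?_⟩
  have hη' : IsPrim (fun x => q x - q' x) (fun t => s * (q t - q' t) + (fun _ => (0 : ℂ)) t) a b :=
    hη.congr (fun _ _ => rfl) (ae_of_all _ fun t ht => by simp [hz t ⟨ht.1.le, ht.2⟩])
  have := hη'.variation_of_constants hb
  simpa [hw.left_slope, hw'.left_slope] using this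

end

section


/-! ### The size of the error terms -/

/-- The wave reflected at both ends, `ρ s^{-p} e^{sL}`. -/
def doubleReflection (L : ℝ) (p : ℕ) (ρ s : ℂ) : ℂ :=
  ρ * (s⁻¹) ^ p * Complex.exp (s * L)

theorem norm_inv_pow_eq_exp {s : ℂ} (hs : s ≠ 0) (n : ℕ) :
    (‖s‖⁻¹) ^ n = Real.exp (-(n * Real.log ‖s‖)) := by
  rw [← Real.exp_log (inv_pos.2 (norm_pos_iff.2 hs)), ← Real.exp_nat_mul, Real.log_inv, mul_neg]

theorem norm_doubleReflection {L : ℝ} {p : ℕ} {ρ s : ℂ} (hs : s ≠ 0) :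
    ‖doubleReflection L p ρ s‖ = ‖ρ‖ * Real.exp (s.re * L - p * Real.log ‖s‖) := by
  rw [doubleReflection, norm_mul, norm_mul, norm_pow, norm_inv, norm_inv_pow_eq_exp hs,
    Complex.norm_exp, mul_assoc, ← Real.exp_add]
  simp only [Complex.mul_re, Complex.ofReal_re, Complex.ofReal_im, mul_zero, sub_zero]
  congr 2
  ring

theorem jostError_le {L δ δ' κ m E : ℝ} {j k : ℕ} {s : ℂ} (hs : s ≠ 0) (hσ : 0 < s.re)
    (hE : E = Real.exp (s.re * L - (j + k + 4 : ℕ) * Real.log ‖s‖)) (hm : E ≤ m)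
    (h1 : Real.exp (-Real.log ‖s‖) ≤ m * κ)
    (h2 : Real.exp (s.re * (L - δ) - (k + 3 : ℕ) * Real.log ‖s‖) ≤ m * κ)
    (h3 : Real.exp (s.re * (L - δ') - (j + 3 : ℕ) * Real.log ‖s‖) ≤ m * κ)
    (h4 : Real.exp (s.re * (L - δ - δ') - (2 : ℕ) * Real.log ‖s‖) ≤ m * κ) :
    jostError L δ δ' j k s ≤ m * (4 * κ + 1 / s.re) := by
  have key : ∀ (n : ℕ) (l : ℝ), (‖s‖⁻¹) ^ n * Real.exp (s.re * l) =
      Real.exp (s.re * l - n * Real.log ‖s‖) := fun n l => by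
    rw [norm_inv_pow_eq_exp hs, ← Real.exp_add]
    ring_nf
  have e1 : ‖s‖⁻¹ = Real.exp (-Real.log ‖s‖) := by
    simpa using norm_inv_pow_eq_exp hs 1
  have e2 : Real.exp (s.re * L) * (‖s‖⁻¹) ^ (j + k + 4) / s.re ≤ m * (1 / s.re) := by
    rw [mul_comm (Real.exp _), key, ← hE, mul_one_div]
    gcongr
  rw [← key] at h2 h3 h4
  rw [← e1] at h1
  rw [jostError]
  linarith

theorem norm_le_of_re_max {s : ℂ} : s.re ≤ ‖s‖ := (le_abs_self _).trans (Complex.abs_re_le_norm s)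

theorem tendsto_exp_neg_mul_log {κ : ℝ} (hκ : 0 < κ) :
    Tendsto (fun x : ℝ => Real.exp (-(κ * Real.log x))) atTop (𝓝 0) :=
  Real.tendsto_exp_neg_atTop_nhds_zero.comp (Real.tendsto_log_atTop.const_mul_atTop hκ)

/-- Below a steep logarithmic curve the doubly reflected wave dominates all other terms. -/
theorem ne_zero_of_log_le_re {F : ℂ → ℂ} {L δ δ' A S M : ℝ} {j k : ℕ} {ρ : ℂ} (hρ : ρ ≠ 0)
    (hA : 0 ≤ A) (hδ : 0 < δ) (hδ' : 0 < δ') (hL : δ + δ' ≤ L)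
    (hF : ∀ s : ℂ, S ≤ ‖s‖ → 1 ≤ s.re →
      ‖F s - 1 + doubleReflection L (j + k + 4) ρ s‖ ≤ A * jostError L δ δ' j k s)
    (hM : (j + k + 4 : ℕ) < M * min δ δ') :
    ∃ R : ℝ, ∀ s : ℂ, R ≤ ‖s‖ → M * Real.log ‖s‖ ≤ s.re → F s ≠ 0 := by
  set d := min δ δ' with hd
  have hd0 : 0 < d := lt_min hδ hδ'
  have hM0 : 0 < M := by
    by_contra h
    have : M * d ≤ 0 := mul_nonpos_of_nonpos_of_nonneg (not_lt.1 h) hd0.le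
    have h2 : (0 : ℝ) ≤ (j + k + 4 : ℕ) := by positivity
    linarith
  set ε := M * d - (j + k + 4 : ℕ) with hε
  have hε0 : 0 < ε := by linarith
  have hlim : Tendsto (fun x : ℝ => (4 * A + 1) * Real.exp (-(ε * Real.log x)) +
      A * (1 / (M * Real.log x))) atTop (𝓝 ((4 * A + 1) * 0 + A * 0)) := by
    refine ((tendsto_exp_neg_mul_log hε0).const_mul _).add (Tendsto.const_mul _ ?_)
    simp only [one_div]
    exact (Real.tendsto_log_atTop.const_mul_atTop hM0).inv_tendsto_atTop
  simp only [mul_zero, add_zero] at hlim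
  have hev := ((hlim.eventually (gt_mem_nhds (norm_pos_iff.2 hρ))).and
    ((Real.tendsto_log_atTop.const_mul_atTop hM0).eventually_ge_atTop 1)).and
    ((eventually_ge_atTop S).and (eventually_ge_atTop 1))
  obtain ⟨R, hR⟩ := eventually_atTop.1 hev
  refine ⟨R, fun s hs hσ => ?_⟩
  obtain ⟨⟨h1, h2⟩, h3, h4⟩ := hR ‖s‖ hs
  have hσ1 : 1 ≤ s.re := h2.trans hσ
  have hσ0 : 0 < s.re := by linarith
  have hs0 : s ≠ 0 := norm_pos_iff.1 (by linarith)
  set l := Real.log ‖s‖ with hl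
  have hl0 : 0 ≤ l := Real.log_nonneg h4
  set E := Real.exp (s.re * L - (j + k + 4 : ℕ) * l) with hE
  have hE0 : 0 < E := Real.exp_pos _
  -- every exponent that misses at least `d` of the length `L` is smaller by a power of `‖s‖`
  have key : ∀ x n : ℝ, 0 ≤ n → x ≤ L - d →
      Real.exp (s.re * x - n * l) ≤ E * Real.exp (-(ε * l)) := by
    intro x n hn hx
    rw [hE, ← Real.exp_add]
    gcongr
    have e1 : s.re * x ≤ s.re * (L - d) := by gcongr
    have e2 : M * l * d ≤ s.re * d := by gcongr
    have e3 : 0 ≤ n * l := by positivity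
    rw [hε]
    nlinarith
  have hd1 : d ≤ δ := min_le_left _ _
  have hd2 : d ≤ δ' := min_le_right _ _
  have hT := jostError_le (m := E) (κ := Real.exp (-(ε * l))) (j := j) (k := k) (L := L) (δ := δ)
    (δ' := δ') hs0 hσ0 hE le_rfl (by simpa using key 0 1 (by norm_num) (by linarith))
    (key _ _ (by positivity) (by linarith)) (key _ _ (by positivity) (by linarith))
    (key _ _ (by positivity) (by linarith))
  have hone : 1 ≤ E * Real.exp (-(ε * l)) := by
    simpa using key 0 0 le_rfl (by linarith)
  intro hFs
  have h5 := hF s h3 hσ1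
  rw [hFs, zero_sub] at h5
  have h6 : ‖doubleReflection L (j + k + 4) ρ s‖ ≤ 1 + A * jostError L δ δ' j k s := by
    calc _ = ‖1 + (-1 + doubleReflection L (j + k + 4) ρ s)‖ := by ring_nf
      _ ≤ ‖(1 : ℂ)‖ + ‖-1 + doubleReflection L (j + k + 4) ρ s‖ := norm_add_le _ _
      _ ≤ _ := by rw [norm_one]; gcongr
  rw [norm_doubleReflection hs0, ← hl, ← hE] at h6
  have h7 : 1 / s.re ≤ 1 / (M * l) := one_div_le_one_div_of_le (by linarith) hσ
  have h8 : 1 + A * jostError L δ δ' j k s ≤ E * ((4 * A + 1) * Real.exp (-(ε * l)) +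
      A * (1 / (M * l))) := by
    calc _ ≤ E * Real.exp (-(ε * l)) + A * (E * (4 * Real.exp (-(ε * l)) + 1 / (M * l))) := by
          gcongr
          exact hT.trans (by gcongr)
      _ = _ := by ring
  have h9 : E * ((4 * A + 1) * Real.exp (-(ε * l)) + A * (1 / (M * l))) < E * ‖ρ‖ := by gcongr
  linarith

/-- If the perturbation is supported well inside the interval, then `F = 1 - Q` with a relatively
small error, where `Q` is the doubly reflected wave. -/
theorem relative_error_small {F : ℂ → ℂ} {L δ δ' A B S : ℝ} {j k : ℕ} {ρ : ℂ} (hρ : ρ ≠ 0)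
    (hA : 0 ≤ A) (hB : 0 ≤ B) (hL : δ + δ' ≤ L) (hδ : (j + 1) * L < (j + k + 4 : ℕ) * δ)
    (hδ' : (k + 1) * L < (j + k + 4 : ℕ) * δ') (hL0 : 0 < L)
    (hF : ∀ s : ℂ, S ≤ ‖s‖ → 1 ≤ s.re →
      ‖F s - 1 + doubleReflection L (j + k + 4) ρ s‖ ≤ A * jostError L δ δ' j k s)
    (hF' : ∀ s : ℂ, S ≤ ‖s‖ →
      ‖F s - 1‖ ≤ B / ‖s‖ * (1 + B / ‖s‖ * Real.exp (max s.re 0 * L))) :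
    ∀ ε : ℝ, 0 < ε → ∃ R : ℝ, ∀ s : ℂ, R ≤ ‖s‖ →
      ‖F s - 1 + doubleReflection L (j + k + 4) ρ s‖ ≤
        ε * max 1 ‖doubleReflection L (j + k + 4) ρ s‖ := by
  intro ε hε
  set p : ℕ := j + k + 4 with hp
  have hδ0 : 0 < δ := by
    have : (0 : ℝ) < (j + 1) * L := by positivity
    have hp' : (0 : ℝ) ≤ (p : ℝ) := by positivity
    by_contra h
    linarith [mul_nonpos_of_nonneg_of_nonpos hp' (not_lt.1 h)]
  have hδ0' : 0 < δ' := by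
    have : (0 : ℝ) < (k + 1) * L := by positivity
    have hp' : (0 : ℝ) ≤ (p : ℝ) := by positivity
    by_contra h
    linarith [mul_nonpos_of_nonneg_of_nonpos hp' (not_lt.1 h)]
  have hpc : (p : ℝ) = j + k + 4 := by rw [hp]; push_cast; ring
  -- the gain in the exponents
  set κ₀ := min ((p * δ - (j + 1) * L) / L) ((p * δ' - (k + 1) * L) / L) with hκ₀
  set κ := min 1 κ₀ with hκ
  have hκpos : 0 < κ := by
    refine lt_min one_pos (lt_min (div_pos (by linarith) hL0) (div_pos (by linarith) hL0))
  have hκ1 : κ ≤ 1 := min_le_left _ _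
  have hκδ : κ * L ≤ p * δ - (j + 1) * L :=
    (le_div_iff₀ hL0).1 ((min_le_right _ _).trans (min_le_left _ _))
  have hκδ' : κ * L ≤ p * δ' - (k + 1) * L :=
    (le_div_iff₀ hL0).1 ((min_le_right _ _).trans (min_le_right _ _))
  set c := 1 + ‖ρ‖⁻¹ with hc
  have hc0 : 0 < c := by positivity
  have hlim1 : Tendsto (fun x : ℝ => A * c * (4 * Real.exp (-(κ * Real.log x)) +
      1 / (L⁻¹ * Real.log x))) atTop (𝓝 (A * c * (4 * 0 + 0))) := by
    refine Tendsto.const_mul _ (((tendsto_exp_neg_mul_log hκpos).const_mul _).add ?_)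
    simp only [one_div]
    exact (Real.tendsto_log_atTop.const_mul_atTop (inv_pos.2 hL0)).inv_tendsto_atTop
  have hlim2 : Tendsto (fun x : ℝ => B / x * (1 + B) + ‖ρ‖ * Real.exp (-(1 * Real.log x))) atTop
      (𝓝 (0 * (1 + B) + ‖ρ‖ * 0)) :=
    ((tendsto_const_nhds.div_atTop tendsto_id).mul_const _).add
      ((tendsto_exp_neg_mul_log one_pos).const_mul _)
  simp only [mul_zero, add_zero, zero_mul] at hlim1 hlim2
  have hev := (((hlim1.eventually (gt_mem_nhds hε)).and (hlim2.eventually (gt_mem_nhds hε))).and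
    ((Real.tendsto_log_atTop.const_mul_atTop (inv_pos.2 hL0)).eventually_ge_atTop 1)).and
    ((eventually_ge_atTop S).and (eventually_ge_atTop 1))
  obtain ⟨R, hR⟩ := eventually_atTop.1 hev
  refine ⟨R, fun s hs => ?_⟩
  obtain ⟨⟨⟨h1, h1'⟩, h2⟩, h3, h4⟩ := hR ‖s‖ hs
  have hspos : 0 < ‖s‖ := by linarith
  have hs0 : s ≠ 0 := norm_pos_iff.1 hspos
  set l := Real.log ‖s‖ with hl
  have hl0 : 0 ≤ l := Real.log_nonneg h4
  have hQ := norm_doubleReflection (L := L) (p := p) (ρ := ρ) hs0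
  rw [← hl] at hQ
  have hm1 : 1 ≤ max 1 ‖doubleReflection L p ρ s‖ := le_max_left _ _
  by_cases hσ : L⁻¹ * l ≤ s.re
  · have hσ1 : 1 ≤ s.re := h2.trans hσ
    have hσ0 : 0 < s.re := by linarith
    set E := Real.exp (s.re * L - p * l) with hE
    have hEQ : E = ‖ρ‖⁻¹ * ‖doubleReflection L p ρ s‖ := by
      rw [hQ, inv_mul_cancel_left₀ (norm_ne_zero_iff.2 hρ)]
    set m := c * max 1 ‖doubleReflection L p ρ s‖ with hm
    have hEm : E ≤ m := by
      rw [hEQ, hm]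
      have : ‖ρ‖⁻¹ ≤ c := by linarith
      gcongr
      exact le_max_right _ _
    have h1m : 1 ≤ m := by
      rw [hm]
      have : 1 ≤ c := by rw [hc]; linarith [inv_nonneg.2 (norm_nonneg ρ)]
      nlinarith
    -- interpolation between `1` and `E`
    have key : ∀ x n : ℝ, 0 ≤ x → x ≤ L → p * x + κ * L ≤ n * L →
        Real.exp (s.re * x - n * l) ≤ m * Real.exp (-(κ * l)) := by
      intro x n hx0 hx hn
      have e0 : s.re * x - n * l ≤ (x / L) * (s.re * L - p * l) + -(κ * l) := by
        have e1 : (x / L) * (s.re * L - p * l) = s.re * x - p * x / L * l := by field_simp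
        have e2 : p * x / L + κ ≤ n := by
          have : p * x / L + κ = (p * x + κ * L) / L := by field_simp
          rwa [this, div_le_iff₀ hL0]
        have e3 : (p * x / L + κ) * l ≤ n * l := by gcongr
        rw [e1]
        linarith
      have e4 : Real.exp ((x / L) * (s.re * L - p * l)) ≤ m := by
        have t0 : 0 ≤ x / L := by positivity
        have t1 : x / L ≤ 1 := (div_le_one hL0).2 hx
        rcases le_total 0 (s.re * L - p * l) with h | h
        · refine le_trans ?_ hEm
          rw [hE]
          gcongr
          calc _ ≤ 1 * (s.re * L - p * l) := by gcongr
            _ = _ := one_mul _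
        · refine le_trans ?_ h1m
          rw [Real.exp_le_one_iff]
          exact mul_nonpos_of_nonneg_of_nonpos t0 h
      calc _ ≤ Real.exp ((x / L) * (s.re * L - p * l) + -(κ * l)) := by gcongr
        _ = Real.exp ((x / L) * (s.re * L - p * l)) * Real.exp (-(κ * l)) := Real.exp_add _ _
        _ ≤ _ := by gcongr
    have hT := jostError_le (m := m) (κ := Real.exp (-(κ * l))) (j := j) (k := k) (L := L)
      (δ := δ) (δ' := δ') hs0 hσ0 hE hEm
      (by simpa using key 0 1 le_rfl hL0.le (by nlinarith))
      (key _ _ (by linarith) (by linarith) (by push_cast; rw [hpc] at *; linarith))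
      (key _ _ (by linarith) (by linarith) (by push_cast; rw [hpc] at *; linarith))
      (key _ _ (by linarith) (by linarith) (by push_cast; rw [hpc] at *; linarith [mul_pos hκpos hL0]))
    have h5 := hF s h3 hσ1
    refine h5.trans ?_
    have h7 : 1 / s.re ≤ 1 / (L⁻¹ * l) := one_div_le_one_div_of_le (by linarith) hσ
    calc _ ≤ A * (m * (4 * Real.exp (-(κ * l)) + 1 / (L⁻¹ * l))) := by
          gcongr
          exact hT.trans (by gcongr)
      _ = A * c * (4 * Real.exp (-(κ * l)) + 1 / (L⁻¹ * l)) *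
          max 1 ‖doubleReflection L p ρ s‖ := by rw [hm]; ring
      _ ≤ _ := by gcongr
  · have hσL : s.re * L ≤ l := by
      have h := mul_le_mul_of_nonneg_right (not_le.1 hσ).le hL0.le
      calc _ ≤ L⁻¹ * l * L := h
        _ = l := by field_simp
    have hmax : max s.re 0 * L ≤ l := by
      rcases le_total s.re 0 with h | h
      · rw [max_eq_right h, zero_mul]; exact hl0
      · rw [max_eq_left h]; exact hσL
    have e1 : Real.exp (max s.re 0 * L) ≤ ‖s‖ := by
      calc _ ≤ Real.exp l := by gcongr
        _ = ‖s‖ := Real.exp_log hspos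
    have e2 : B / ‖s‖ * Real.exp (max s.re 0 * L) ≤ B := by
      calc _ ≤ B / ‖s‖ * ‖s‖ := by gcongr
        _ = B := by field_simp
    have e3 : ‖doubleReflection L p ρ s‖ ≤ ‖ρ‖ * Real.exp (-(1 * l)) := by
      rw [hQ]
      gcongr
      rw [hpc]
      have : (0 : ℝ) ≤ (j + k) * l := by positivity
      linarith
    calc _ ≤ ‖F s - 1‖ + ‖doubleReflection L p ρ s‖ := norm_add_le _ _
      _ ≤ B / ‖s‖ * (1 + B) + ‖ρ‖ * Real.exp (-(1 * l)) := by
          gcongr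
          exact (hF' s h3).trans (by gcongr)
      _ ≤ ε * 1 := by rw [mul_one]; exact h1'.le
      _ ≤ _ := by gcongr

end

section


/-! ### Zeros of `1 - ρ s^{-p} e^{sL}` and of its perturbations -/

/-- A holomorphic function close to `1 - e^{tL}` has exactly one zero near the origin, and that
zero is simple: `t + f(t)/L` is a contraction. -/
theorem exists_unique_zero {L : ℝ} (hL : 0 < L) : ∃ r : ℝ, 0 < r ∧ ∀ (f : ℂ → ℂ) (η : ℝ),
    η ≤ r * L / 4 → (∀ t, ‖t‖ ≤ 2 * r → AnalyticAt ℂ f t) →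
    (∀ t, ‖t‖ ≤ 2 * r → ‖f t - (1 - Complex.exp (L * t))‖ ≤ η) →
    ∃ t₀ : ℂ, ‖t₀‖ ≤ 2 * η / L ∧ f t₀ = 0 ∧ deriv f t₀ ≠ 0 ∧ ∀ t, ‖t‖ ≤ r → f t = 0 → t = t₀ := by
  have hcont : Tendsto (fun t : ℂ => 1 - Complex.exp (L * t)) (𝓝 0) (𝓝 0) := by
    have : Continuous fun t : ℂ => 1 - Complex.exp (L * t) := by fun_prop
    simpa using this.tendsto 0
  obtain ⟨r₀, hr₀, hr₀'⟩ := Metric.eventually_nhds_iff.1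
    (hcont.eventually (Metric.ball_mem_nhds (0 : ℂ) (by norm_num : (0 : ℝ) < 1 / 4)))
  refine ⟨r₀ / 2, by positivity, fun f η hη han hf => ?_⟩
  set r := r₀ / 2 with hr
  have hr0 : 0 < r := by positivity
  have hη0 : 0 ≤ η := (norm_nonneg _).trans (hf 0 (by rw [norm_zero]; positivity))
  have hLc : (L : ℂ) ≠ 0 := by exact_mod_cast hL.ne'
  set φ : ℂ → ℂ := fun t => t + f t / L with hφ
  have hexp : ∀ t : ℂ, HasDerivAt (fun t : ℂ => 1 - Complex.exp (L * t))
      (-(L * Complex.exp (L * t))) t := by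
    intro t
    have := (((hasDerivAt_id t).const_mul (L : ℂ)).cexp).const_sub 1
    simpa [mul_comm] using this
  have hder : ∀ t, ‖t‖ ≤ r → HasDerivAt φ (1 + deriv f t / L) t ∧ ‖1 + deriv f t / L‖ ≤ 1 / 2 := by
    intro t ht
    have hft : HasDerivAt f (deriv f t) t := (han t (by linarith)).differentiableAt.hasDerivAt
    refine ⟨(hasDerivAt_id t).add (hft.div_const _), ?_⟩
    have hsub : HasDerivAt (fun t => f t - (1 - Complex.exp (L * t)))
        (deriv f t + L * Complex.exp (L * t)) t := by
      have := hft.fun_sub (hexp t)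
      rwa [sub_neg_eq_add] at this
    have hball : ∀ u ∈ Metric.closedBall t r, ‖u‖ ≤ 2 * r := by
      intro u hu
      rw [Metric.mem_closedBall, dist_eq_norm] at hu
      calc ‖u‖ = ‖t + (u - t)‖ := by ring_nf
        _ ≤ ‖t‖ + ‖u - t‖ := norm_add_le _ _
        _ ≤ 2 * r := by linarith
    have hcauchy := Complex.norm_deriv_le_of_forall_mem_sphere_norm_le
      (f := fun t => f t - (1 - Complex.exp (L * t))) (c := t) hr0
      (DifferentiableOn.diffContOnCl (by
        rw [closure_ball _ hr0.ne']
        exact fun u hu => ((han u (hball u hu)).differentiableAt.sub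
          (hexp u).differentiableAt).differentiableWithinAt))
      (fun u hu => hf u (hball u (Metric.sphere_subset_closedBall hu)))
    rw [hsub.deriv] at hcauchy
    have h1 : (1 : ℂ) + deriv f t / L = (1 - Complex.exp (L * t)) +
        (deriv f t + L * Complex.exp (L * t)) / L := by
      field_simp
      ring
    have h2 : ‖1 - Complex.exp (L * t)‖ ≤ 1 / 4 := by
      have := hr₀' (y := t) (by rw [dist_zero_right]; linarith)
      simpa using (mem_ball_zero_iff.1 this).le
    have h3 : ‖(deriv f t + L * Complex.exp (L * t)) / L‖ ≤ 1 / 4 := by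
      rw [norm_div, Complex.norm_real, Real.norm_of_nonneg hL.le, div_le_iff₀ hL]
      refine hcauchy.trans ?_
      rw [div_le_iff₀ hr0]
      linarith
    rw [h1]
    exact (norm_add_le _ _).trans (by linarith)
  have hlip : ∀ t₁ t₂, ‖t₁‖ ≤ r → ‖t₂‖ ≤ r → ‖φ t₁ - φ t₂‖ ≤ 1 / 2 * ‖t₁ - t₂‖ := by
    intro t₁ t₂ h1 h2
    exact (convex_closedBall (0 : ℂ) r).norm_image_sub_le_of_norm_hasDerivWithin_le
      (f := φ) (f' := fun t => 1 + deriv f t / L)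
      (fun t ht => (hder t (mem_closedBall_zero_iff.1 ht)).1.hasDerivWithinAt)
      (fun t ht => (hder t (mem_closedBall_zero_iff.1 ht)).2)
      (mem_closedBall_zero_iff.2 h2) (mem_closedBall_zero_iff.2 h1)
  have hφ0 : ‖φ 0‖ ≤ η / L := by
    have := hf 0 (by rw [norm_zero]; positivity)
    simp only [mul_zero, Complex.exp_zero, sub_self, sub_zero] at this
    rw [hφ]
    simp only [zero_add]
    rw [norm_div, Complex.norm_real, Real.norm_of_nonneg hL.le]
    gcongr
  have hηr : η / L ≤ r / 4 := by
    rw [div_le_iff₀ hL]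
    linarith
  have hmaps : ∀ t, ‖t‖ ≤ r → ‖φ t‖ ≤ r := by
    intro t ht
    have h1 := hlip t 0 ht (by rw [norm_zero]; exact hr0.le)
    rw [sub_zero] at h1
    calc ‖φ t‖ = ‖(φ t - φ 0) + φ 0‖ := by ring_nf
      _ ≤ ‖φ t - φ 0‖ + ‖φ 0‖ := norm_add_le _ _
      _ ≤ _ := by linarith
  have hfix : ∀ t, φ t = t ↔ f t = 0 := by
    intro t
    rw [hφ]
    simp [hLc]
  have hmt : MapsTo φ (Metric.closedBall 0 r) (Metric.closedBall 0 r) := fun t ht =>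
    mem_closedBall_zero_iff.2 (hmaps t (mem_closedBall_zero_iff.1 ht))
  have hcw : ContractingWith (1 / 2) (hmt.restrict φ _ _) := by
    refine ⟨by rw [← NNReal.coe_lt_coe]; norm_num, LipschitzWith.of_dist_le_mul fun x y => ?_⟩
    have := hlip x y (mem_closedBall_zero_iff.1 x.2) (mem_closedBall_zero_iff.1 y.2)
    simpa [Subtype.dist_eq, dist_eq_norm] using this
  obtain ⟨t₀, ht₀, hft₀, -⟩ := hcw.exists_fixedPoint' Metric.isClosed_closedBall.isComplete hmt
    (x := 0) (Metric.mem_closedBall_self hr0.le) (edist_ne_top _ _)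
  have ht₀r : ‖t₀‖ ≤ r := mem_closedBall_zero_iff.1 ht₀
  refine ⟨t₀, ?_, (hfix t₀).1 hft₀, fun hd => ?_, fun t ht hft => ?_⟩
  · have h1 := hlip t₀ 0 ht₀r (by rw [norm_zero]; exact hr0.le)
    have h2 : ‖t₀‖ ≤ ‖φ t₀ - φ 0‖ + ‖φ 0‖ := by
      calc ‖t₀‖ = ‖(φ t₀ - φ 0) + φ 0‖ := by rw [hft₀.eq]; ring_nf
        _ ≤ _ := norm_add_le _ _
    rw [sub_zero] at h1
    rw [mul_div_assoc]
    linarith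
  · have := (hder t₀ ht₀r).2
    rw [hd, zero_div, add_zero, norm_one] at this
    norm_num at this
  · have h1 := hlip t t₀ ht ht₀r
    rw [(hfix t).2 hft, hft₀.eq] at h1
    have : ‖t - t₀‖ ≤ 0 := by linarith [norm_nonneg (t - t₀)]
    exact sub_eq_zero.1 (norm_le_zero_iff.1 this)

/-- The points `2iz` for `z` on the logarithmic sequence: approximate zeros of `1 - Q`. -/
def approxZero (L : ℝ) (p : ℕ) (ρ : ℂ) (ς : ℝ) (n : ℕ) : ℂ :=
  2 * Complex.I * logSequence L p (ρ / 2 ^ p) ς n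

section approxZero

variable {L : ℝ} {p : ℕ} {ρ : ℂ} {ς : ℝ}

theorem log_div_two_pow (hρ : ρ ≠ 0) :
    Complex.log (ρ / 2 ^ p) = Complex.log ρ - p * Real.log 2 := by
  have h : ρ / 2 ^ p = (((2 ^ p)⁻¹ : ℝ) : ℂ) * ρ := by
    push_cast
    ring
  rw [h, Complex.log_ofReal_mul (by positivity) hρ, Real.log_inv, Real.log_pow]
  push_cast
  ring

theorem mul_approxZero (hL : 0 < L) (n : ℕ) :
    approxZero L p ρ ς n * L = ς * (n * (2 * Real.pi * Complex.I))
      + (p : ℂ) * (ς * (Real.pi / 2 * Complex.I)) - Complex.log (ρ / 2 ^ p)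
      + p * Real.log (n * Real.pi / L) := by
  have hLc : (L : ℂ) ≠ 0 := by exact_mod_cast hL.ne'
  rw [approxZero, logSequence]
  field_simp
  have := Complex.I_sq
  ring_nf
  rw [this]
  ring

theorem exp_mul_approxZero (hL : 0 < L) (hρ : ρ ≠ 0) (hς : ς = 1 ∨ ς = -1) {n : ℕ} (hn : 0 < n) :
    Complex.exp (approxZero L p ρ ς n * L) =
      (ς * Complex.I * (2 * n * Real.pi / L : ℝ)) ^ p / ρ := by
  have hpos : 0 < n * Real.pi / L := by positivity
  have e1 : Complex.exp (ς * (n * (2 * Real.pi * Complex.I))) = 1 := by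
    rcases hς with rfl | rfl
    · simp [Complex.exp_nat_mul_two_pi_mul_I n]
    · have := Complex.exp_int_mul_two_pi_mul_I (-n)
      push_cast at this ⊢
      rwa [neg_one_mul, ← neg_mul]
  have e2 : Complex.exp ((p : ℂ) * (ς * (Real.pi / 2 * Complex.I))) = (ς * Complex.I) ^ p := by
    rw [Complex.exp_nat_mul]
    congr 1
    rcases hς with rfl | rfl
    · simp [Complex.exp_pi_div_two_mul_I]
    · simp [Complex.exp_neg, Complex.exp_pi_div_two_mul_I]
  have e3 : Complex.exp (p * Real.log (n * Real.pi / L)) = ((n * Real.pi / L : ℝ) : ℂ) ^ p := by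
    rw [Complex.exp_nat_mul, ← Complex.ofReal_exp, Real.exp_log hpos]
  have hρ2 : ρ / 2 ^ p ≠ 0 := div_ne_zero hρ (pow_ne_zero _ two_ne_zero)
  rw [mul_approxZero hL, Complex.exp_add, Complex.exp_sub, Complex.exp_add, e1, e2, e3,
    Complex.exp_log hρ2, one_mul]
  have : ((2 * n * Real.pi / L : ℝ) : ℂ) = 2 * ((n * Real.pi / L : ℝ) : ℂ) := by
    push_cast
    ring
  rw [this, mul_pow _ (2 * _), mul_pow 2]
  field_simp

/-- `approxZero` grows linearly. -/
theorem tendsto_approxZero_div (hL : 0 < L) :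
    Tendsto (fun n : ℕ => approxZero L p ρ ς n / n) atTop (𝓝 (ς * Complex.I * (2 * Real.pi / L))) := by
  have hLc : (L : ℂ) ≠ 0 := by exact_mod_cast hL.ne'
  have hlog : Tendsto (fun n : ℕ => Real.log (n * Real.pi / L) / n) atTop (𝓝 0) := by
    have h1 : Tendsto (fun x : ℝ => Real.log x / x) atTop (𝓝 0) := by
      simpa using Real.isLittleO_log_id_atTop.tendsto_div_nhds_zero
    have h2 : Tendsto (fun n : ℕ => (n : ℝ) * (Real.pi / L)) atTop atTop :=
      tendsto_natCast_atTop_atTop.atTop_mul_const (by positivity)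
    have h3 := (h1.comp h2).mul_const (Real.pi / L)
    rw [zero_mul] at h3
    refine h3.congr fun n => ?_
    simp only [Function.comp]
    rcases eq_or_ne n 0 with rfl | hn
    · simp
    · have : (n : ℝ) ≠ 0 := by exact_mod_cast hn
      rw [mul_div_assoc]
      field_simp
  have hlogc : Tendsto (fun n : ℕ => ((Real.log (n * Real.pi / L) / n : ℝ) : ℂ)) atTop (𝓝 0) := by
    exact_mod_cast (Complex.continuous_ofReal.tendsto 0).comp hlog
  have hinv : Tendsto (fun n : ℕ => ((n : ℂ))⁻¹) atTop (𝓝 0) := tendsto_inv_atTop_nhds_zero_nat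
  set c₀ : ℂ := (p : ℂ) * (ς * (Real.pi / 2 * Complex.I)) - Complex.log (ρ / 2 ^ p) with hc₀
  have h4 := ((hinv.const_mul (c₀ / L)).add (hlogc.const_mul ((p : ℂ) / L))).const_add
    (ς * Complex.I * (2 * Real.pi / L))
  rw [mul_zero, mul_zero, add_zero, add_zero] at h4
  refine h4.congr' ?_
  filter_upwards [eventually_gt_atTop 0] with n hn
  have hnc : (n : ℂ) ≠ 0 := by exact_mod_cast hn.ne'
  have h5 := mul_approxZero (p := p) (ρ := ρ) (ς := ς) hL n
  have h6 : approxZero L p ρ ς n = (ς * (n * (2 * Real.pi * Complex.I)) + c₀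
      + p * Real.log (n * Real.pi / L)) / L := by
    rw [eq_div_iff hLc, h5, hc₀]
    ring
  rw [h6]
  push_cast
  field_simp
  ring

end approxZero

/-- Near an approximate zero, a function asymptotic to `1 - Q` is close to `1 - e^{tL}`. -/
theorem eventually_near_approxZero {F : ℂ → ℂ} {L : ℝ} {p : ℕ} {ρ : ℂ} {ς : ℝ} (hL : 0 < L)
    (hρ : ρ ≠ 0) (hς : ς = 1 ∨ ς = -1)
    (hF : ∀ ε : ℝ, 0 < ε → ∃ R : ℝ, ∀ s : ℂ, R ≤ ‖s‖ →
      ‖F s - 1 + doubleReflection L p ρ s‖ ≤ ε * max 1 ‖doubleReflection L p ρ s‖)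
    {r η : ℝ} (hη : 0 < η) :
    ∀ᶠ n : ℕ in atTop, ∀ t : ℂ, ‖t‖ ≤ r →
      ‖F (approxZero L p ρ ς n + t) - (1 - Complex.exp (L * t))‖ ≤ η := by
  set B := Real.exp (L * r) with hB
  have hB0 : 0 < B := Real.exp_pos _
  set η' := min 1 (η / 2) with hη'
  have hη'0 : 0 < η' := lt_min one_pos (by positivity)
  -- the ratio of the leading term to the full argument
  have hpow : ∀ᶠ x : ℂ in 𝓝 1, ‖x ^ p - 1‖ < η' / B := by
    have : Tendsto (fun x : ℂ => ‖x ^ p - 1‖) (𝓝 1) (𝓝 0) := by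
      have : Continuous fun x : ℂ => ‖x ^ p - 1‖ := by fun_prop
      simpa using this.tendsto 1
    exact this.eventually (gt_mem_nhds (by positivity))
  set c : ℂ := ς * Complex.I * (2 * Real.pi / L) with hc
  have hςn : ‖(ς : ℂ)‖ = 1 := by rcases hς with rfl | rfl <;> simp
  have hc0 : c ≠ 0 := by
    have : ‖c‖ ≠ 0 := by
      rw [hc, norm_mul, norm_mul, hςn, Complex.norm_I]
      have : ((2 * Real.pi / L : ℂ)) = ((2 * Real.pi / L : ℝ) : ℂ) := by push_cast; ring
      rw [this, Complex.norm_real]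
      have : 0 < 2 * Real.pi / L := by positivity
      simp [Real.pi_ne_zero, hL.ne']
    exact norm_ne_zero_iff.1 this
  have hratio : Tendsto (fun x : ℂ × ℂ => c / (x.1 + x.2)) (𝓝 (c, 0)) (𝓝 1) := by
    have : ContinuousAt (fun x : ℂ × ℂ => c / (x.1 + x.2)) (c, 0) :=
      ContinuousAt.div (by fun_prop) (by fun_prop) (by simpa using hc0)
    simpa [ContinuousAt, hc0] using this
  have hbase : ∀ᶠ x : ℂ × ℂ in 𝓝 (c, 0), ‖(c / (x.1 + x.2)) ^ p - 1‖ < η' / B :=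
    hratio.eventually hpow
  rw [nhds_prod_eq, eventually_prod_iff] at hbase
  obtain ⟨P₁, hP₁, P₂, hP₂, hP⟩ := hbase
  obtain ⟨d, hd, hdP⟩ := Metric.eventually_nhds_iff.1 hP₂
  obtain ⟨R, hR⟩ := hF (η / (2 * (B + 1))) (by positivity)
  have hlin := tendsto_approxZero_div (p := p) (ρ := ρ) (ς := ς) hL
  have hnorm : Tendsto (fun n : ℕ => ‖approxZero L p ρ ς n‖) atTop atTop := by
    have h1 : Tendsto (fun n : ℕ => ‖approxZero L p ρ ς n / n‖ * (n : ℝ)) atTop atTop :=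
      hlin.norm.pos_mul_atTop (norm_pos_iff.2 hc0) tendsto_natCast_atTop_atTop
    refine h1.congr' ?_
    filter_upwards [eventually_gt_atTop 0] with n hn
    have : (n : ℝ) ≠ 0 := by exact_mod_cast hn.ne'
    rw [norm_div, Complex.norm_natCast]
    field_simp
  have hrd : Tendsto (fun n : ℕ => r / (n : ℝ)) atTop (𝓝 0) :=
    tendsto_const_nhds.div_atTop tendsto_natCast_atTop_atTop
  filter_upwards [hlin.eventually hP₁, hnorm.eventually_ge_atTop (max R 1 + r),
    eventually_gt_atTop 0, hrd.eventually (gt_mem_nhds hd)] with n h1 h2 hn h3 t ht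
  set s := approxZero L p ρ ς n + t with hs
  have hnR : (0 : ℝ) < n := by exact_mod_cast hn
  have hnc : (n : ℂ) ≠ 0 := by exact_mod_cast hn.ne'
  have hsR : max R 1 ≤ ‖s‖ := by
    have : ‖approxZero L p ρ ς n‖ ≤ ‖s‖ + ‖t‖ := by
      calc _ = ‖s - t‖ := by rw [hs]; ring_nf
        _ ≤ _ := norm_sub_le _ _
    linarith
  have hs0 : s ≠ 0 := norm_pos_iff.1 (by linarith [le_max_right R 1])
  have h4 : ‖(c / (approxZero L p ρ ς n / n + t / n)) ^ p - 1‖ < η' / B := by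
    refine hP h1 (hdP ?_)
    rw [dist_zero_right, norm_div, Complex.norm_natCast]
    exact lt_of_le_of_lt (by gcongr) h3
  have hQ : doubleReflection L p ρ s =
      (c / (approxZero L p ρ ς n / n + t / n)) ^ p * Complex.exp (L * t) := by
    have e1 : c / (approxZero L p ρ ς n / n + t / n) =
        (ς * Complex.I * (2 * n * Real.pi / L : ℝ)) * s⁻¹ := by
      rw [hc, ← add_div, ← hs]
      push_cast
      field_simp
    have e2 : Complex.exp (s * L) = Complex.exp (approxZero L p ρ ς n * L) * Complex.exp (L * t) := by
      rw [← Complex.exp_add, hs]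
      ring_nf
    rw [doubleReflection, e2, exp_mul_approxZero hL hρ hς hn, e1, mul_pow _ (s⁻¹)]
    field_simp
  have hexpB : ‖Complex.exp (L * t)‖ ≤ B := by
    rw [Complex.norm_exp, hB]
    gcongr
    rw [Complex.re_ofReal_mul]
    gcongr
    exact norm_le_of_re_max.trans ht
  have h5 : ‖doubleReflection L p ρ s - Complex.exp (L * t)‖ ≤ η' := by
    rw [hQ, ← sub_one_mul, norm_mul]
    calc _ ≤ η' / B * B := by gcongr
      _ = η' := by field_simp
  have h6 : max 1 ‖doubleReflection L p ρ s‖ ≤ B + 1 := by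
    refine max_le (by linarith) ?_
    calc _ = ‖Complex.exp (L * t) + (doubleReflection L p ρ s - Complex.exp (L * t))‖ := by ring_nf
      _ ≤ _ := norm_add_le _ _
      _ ≤ _ := add_le_add hexpB (h5.trans (min_le_left _ _))
  calc _ = ‖(F s - 1 + doubleReflection L p ρ s) -
        (doubleReflection L p ρ s - Complex.exp (L * t))‖ := by ring_nf
    _ ≤ _ := norm_sub_le _ _
    _ ≤ η / (2 * (B + 1)) * (B + 1) + η / 2 := by
        refine add_le_add ((hR s ((le_max_left _ _).trans hsR)).trans ?_)
          (h5.trans (min_le_right _ _))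
        gcongr
    _ = η := by field_simp; norm_num

/-- Along the zeros of a function asymptotic to `1 - Q`, the wave `Q` tends to `1`. -/
theorem tendsto_doubleReflection_of_zero {F : ℂ → ℂ} {L : ℝ} {p : ℕ} {ρ : ℂ}
    (hF : ∀ ε : ℝ, 0 < ε → ∃ R : ℝ, ∀ s : ℂ, R ≤ ‖s‖ →
      ‖F s - 1 + doubleReflection L p ρ s‖ ≤ ε * max 1 ‖doubleReflection L p ρ s‖) :
    Tendsto (doubleReflection L p ρ) (comap norm atTop ⊓ 𝓟 {s | F s = 0}) (𝓝 1) := by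
  rw [Metric.tendsto_nhds]
  intro ε hε
  set ε' := min (1 / 2) (ε / 4) with hε'
  have hε'0 : 0 < ε' := by positivity
  obtain ⟨R, hR⟩ := hF ε' hε'0
  rw [eventually_inf_principal]
  filter_upwards [tendsto_comap.eventually (eventually_ge_atTop R)] with s hs hFs
  have h1 := hR s hs
  have hFs' : F s = 0 := hFs
  set Q := doubleReflection L p ρ s with hQ
  rw [hFs', zero_sub, neg_add_eq_sub] at h1
  have h2 : ‖Q‖ ≤ 1 + ε' * max 1 ‖Q‖ := by
    calc ‖Q‖ = ‖1 + (Q - 1)‖ := by ring_nf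
      _ ≤ ‖(1 : ℂ)‖ + ‖Q - 1‖ := norm_add_le _ _
      _ ≤ _ := by rw [norm_one]; gcongr
  have h3 : max 1 ‖Q‖ ≤ 2 := by
    refine max_le (by norm_num) ?_
    rcases le_total ‖Q‖ 1 with h | h
    · linarith
    · rw [max_eq_right h] at h2
      have : ε' * ‖Q‖ ≤ 1 / 2 * ‖Q‖ := by gcongr; exact min_le_left _ _
      linarith
  rw [dist_eq_norm]
  calc ‖Q - 1‖ ≤ ε' * 2 := h1.trans (by gcongr)
    _ ≤ ε / 4 * 2 := by gcongr; exact min_le_right _ _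
    _ < ε := by linarith

/-- Every large zero in the upper (`ς = 1`) or lower (`ς = -1`) half plane is close to an
approximate zero: the logarithm of `Q → 1` determines `s` up to a multiple of `2πi/L`. -/
theorem eventually_exists_approxZero {L : ℝ} {p : ℕ} {ρ : ℂ} {ς : ℝ} (hL : 0 < L)
    (hρ : ρ ≠ 0) (hς : ς = 1 ∨ ς = -1) {l : Filter ℂ} (hl : Tendsto norm l atTop)
    (hQ : Tendsto (doubleReflection L p ρ) l (𝓝 1)) (him : ∀ᶠ s : ℂ in l, 0 < ς * s.im)
    {r : ℝ} (hr : 0 < r) (N : ℕ) :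
    ∀ᶠ s in l, ∃ n, N ≤ n ∧ ‖s - approxZero L p ρ ς n‖ ≤ r := by
  have hLc : (L : ℂ) ≠ 0 := by exact_mod_cast hL.ne'
  have hςn : ‖(ς : ℂ)‖ = 1 := by rcases hς with rfl | rfl <;> simp
  have hςsq : ς * ς = 1 := by rcases hς with rfl | rfl <;> norm_num
  have hςsq' : (ς : ℂ) * ς = 1 := by exact_mod_cast hςsq
  have hςI : (ς : ℂ) * Complex.I ≠ 0 := by
    apply mul_ne_zero _ Complex.I_ne_zero
    intro h
    rw [h, norm_zero] at hςn
    exact zero_ne_one hςn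
  have hpos : ∀ᶠ s : ℂ in l, 0 < ‖s‖ := hl.eventually_gt_atTop 0
  have hlogdiv : Tendsto (fun s : ℂ => Real.log ‖s‖ / ‖s‖) l (𝓝 0) := by
    have h1 : Tendsto (fun x : ℝ => Real.log x / x) atTop (𝓝 0) := by
      simpa using Real.isLittleO_log_id_atTop.tendsto_div_nhds_zero
    exact h1.comp hl
  have hinv : Tendsto (fun s : ℂ => ‖s‖⁻¹) l (𝓝 0) := hl.inv_tendsto_atTop
  -- the real part is of logarithmic size
  have hre : Tendsto (fun s : ℂ => s.re / ‖s‖) l (𝓝 0) := by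
    have h1 : Tendsto (fun s : ℂ => Real.log ‖doubleReflection L p ρ s‖) l (𝓝 0) := by
      have := (Real.continuousAt_log (by norm_num : (1 : ℝ) ≠ 0)).tendsto.comp
        (by simpa using hQ.norm)
      rwa [Real.log_one] at this
    have h2 := ((h1.sub_const (Real.log ‖ρ‖)).mul hinv).add (hlogdiv.const_mul (p : ℝ))
    rw [mul_zero, mul_zero, add_zero] at h2
    have h3 := h2.div_const L
    rw [zero_div] at h3
    refine h3.congr' ?_
    filter_upwards [hpos] with s hs
    have hs0 : s ≠ 0 := norm_pos_iff.1 hs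
    rw [norm_doubleReflection hs0, Real.log_mul (norm_ne_zero_iff.2 hρ) (Real.exp_ne_zero _),
      Real.log_exp]
    field_simp
    ring
  have hims : Tendsto (fun s : ℂ => s.im / ‖s‖) l (𝓝 ς) := by
    have h1 : Tendsto (fun s : ℂ => ς * Real.sqrt (1 - (s.re / ‖s‖) ^ 2)) l (𝓝 (ς * √(1 - 0 ^ 2))) :=
      ((((hre.pow 2).const_sub 1)).sqrt).const_mul ς
    simp only [ne_eq, OfNat.ofNat_ne_zero, not_false_eq_true, zero_pow, sub_zero, Real.sqrt_one,
      mul_one] at h1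
    refine h1.congr' ?_
    filter_upwards [hpos, him] with s hs hi
    have h2 : 1 - (s.re / ‖s‖) ^ 2 = (ς * s.im / ‖s‖) ^ 2 := by
      have := Complex.sq_norm s
      rw [Complex.normSq_apply] at this
      have h5 : (ς * s.im) ^ 2 = s.im ^ 2 := by
        rw [mul_pow, sq ς, hςsq, one_mul]
      rw [div_pow, div_pow, h5]
      field_simp
      linarith
    rw [h2, Real.sqrt_sq (by positivity), ← mul_div_assoc, ← mul_assoc, hςsq, one_mul]
  have hdir : Tendsto (fun s : ℂ => s / ‖s‖) l (𝓝 (ς * Complex.I)) := by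
    have h1 : Tendsto (fun s : ℂ => ((s.re / ‖s‖ : ℝ) : ℂ) + ((s.im / ‖s‖ : ℝ) : ℂ) * Complex.I) l
        (𝓝 ((0 : ℝ) + (ς : ℝ) * Complex.I)) :=
      ((Complex.continuous_ofReal.tendsto _).comp hre).add
        (((Complex.continuous_ofReal.tendsto _).comp hims).mul_const _)
    rw [Complex.ofReal_zero, zero_add] at h1
    refine h1.congr fun s => ?_
    push_cast
    have : (s.re / ‖s‖ + s.im / ‖s‖ * Complex.I : ℂ) = (s.re + s.im * Complex.I) / ‖s‖ := by ring
    rw [this, Complex.re_add_im]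
  -- the logarithm of `Q`, up to a multiple of `2πi`
  set Y : ℂ → ℂ := fun s => s * L + Complex.log ρ - (p : ℂ) * (ς * (Real.pi / 2 * Complex.I))
    - p * Real.log ‖s‖ with hY
  have hexpY : Tendsto (fun s => Complex.exp (Y s)) l (𝓝 1) := by
    have h1 : Tendsto (fun s : ℂ => doubleReflection L p ρ s * ((s / ‖s‖) / (ς * Complex.I)) ^ p) l
        (𝓝 (1 * ((ς * Complex.I) / (ς * Complex.I)) ^ p)) :=
      hQ.mul ((hdir.div_const _).pow p)
    rw [div_self hςI, one_pow, mul_one] at h1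
    refine h1.congr' ?_
    filter_upwards [hpos] with s hs
    have hs0 : s ≠ 0 := norm_pos_iff.1 hs
    have hsn : (‖s‖ : ℂ) ≠ 0 := by exact_mod_cast hs.ne'
    have e2 : Complex.exp ((p : ℂ) * (ς * (Real.pi / 2 * Complex.I))) = (ς * Complex.I) ^ p := by
      rw [Complex.exp_nat_mul]
      congr 1
      rcases hς with rfl | rfl
      · simp [Complex.exp_pi_div_two_mul_I]
      · simp [Complex.exp_neg, Complex.exp_pi_div_two_mul_I]
    have e3 : Complex.exp (p * Real.log ‖s‖) = (‖s‖ : ℂ) ^ p := by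
      rw [Complex.exp_nat_mul, ← Complex.ofReal_exp, Real.exp_log hs]
    rw [hY]
    simp only
    rw [Complex.exp_sub, Complex.exp_sub, Complex.exp_add, e2, e3, Complex.exp_log hρ,
      doubleReflection, div_pow, div_pow, inv_pow]
    field_simp
  have hlogY : Tendsto (fun s => Complex.log (Complex.exp (Y s))) l (𝓝 0) := by
    have := (continuousAt_clog (by simp : (1 : ℂ) ∈ Complex.slitPlane)).tendsto.comp hexpY
    rwa [Complex.log_one] at this
  have hm : ∀ s, ∃ m : ℤ, Y s = Complex.log (Complex.exp (Y s)) + m * (2 * Real.pi * Complex.I) :=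
    fun s => Complex.exp_eq_exp_iff_exists_int.1 (Complex.exp_log (Complex.exp_ne_zero _)).symm
  choose m hm using hm
  have hmdiv : Tendsto (fun s => (m s : ℝ) / ‖s‖) l (𝓝 (ς * L / (2 * Real.pi))) := by
    have hlogc : Tendsto (fun s : ℂ => ((Real.log ‖s‖ / ‖s‖ : ℝ) : ℂ)) l (𝓝 0) := by
      exact_mod_cast (Complex.continuous_ofReal.tendsto 0).comp hlogdiv
    have hinvc : Tendsto (fun s : ℂ => ((‖s‖⁻¹ : ℝ) : ℂ)) l (𝓝 0) := by
      exact_mod_cast (Complex.continuous_ofReal.tendsto 0).comp hinv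
    set c₀ : ℂ := Complex.log ρ - (p : ℂ) * (ς * (Real.pi / 2 * Complex.I)) with hc₀
    have h1 := ((((hdir.mul_const (L : ℂ)).add (hinvc.const_mul c₀)).sub
      (hlogc.const_mul (p : ℂ))).sub (hlogY.mul hinvc)).mul_const ((2 * Real.pi * Complex.I)⁻¹)
    have h2 := (Complex.continuous_re.tendsto _).comp h1
    have hval : ((ς * Complex.I * L + c₀ * 0 - p * 0 - 0 * 0) *
        (2 * Real.pi * Complex.I)⁻¹ : ℂ).re = ς * L / (2 * Real.pi) := by
      have : ((ς * Complex.I * L + c₀ * 0 - p * 0 - 0 * 0) *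
        (2 * Real.pi * Complex.I)⁻¹ : ℂ) = ((ς * L / (2 * Real.pi) : ℝ) : ℂ) := by
        have hI := Complex.I_ne_zero
        have hpi : (Real.pi : ℂ) ≠ 0 := by exact_mod_cast Real.pi_ne_zero
        push_cast
        field_simp
        ring
      rw [this, Complex.ofReal_re]
    rw [hval] at h2
    refine h2.congr' ?_
    filter_upwards [hpos] with s hs
    have hsn : (‖s‖ : ℂ) ≠ 0 := by exact_mod_cast hs.ne'
    have h3 := hm s
    have hI := Complex.I_ne_zero
    have hpi : (Real.pi : ℂ) ≠ 0 := by exact_mod_cast Real.pi_ne_zero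
    have h4 : (s / ‖s‖ * L + c₀ * ((‖s‖⁻¹ : ℝ) : ℂ) - p * ((Real.log ‖s‖ / ‖s‖ : ℝ) : ℂ) -
        Complex.log (Complex.exp (Y s)) * ((‖s‖⁻¹ : ℝ) : ℂ)) * (2 * Real.pi * Complex.I)⁻¹
        = (((m s : ℝ) / ‖s‖ : ℝ) : ℂ) := by
      have h5 : (m s : ℂ) * (2 * Real.pi * Complex.I) = s * L + c₀ - p * Real.log ‖s‖ -
          Complex.log (Complex.exp (Y s)) := by
        simp only [hY] at h3 ⊢
        rw [hc₀]
        linear_combination -h3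
      push_cast
      field_simp
      linear_combination -h5
    simp only [Function.comp]
    rw [h4, Complex.ofReal_re]
  have hςm : Tendsto (fun s => ς * (m s : ℝ) / ‖s‖) l (𝓝 (L / (2 * Real.pi))) := by
    have := hmdiv.const_mul ς
    refine (this.congr fun s => ?_).trans_eq ?_
    · ring
    · congr 1
      rw [← mul_div_assoc, ← mul_assoc, hςsq, one_mul]
  have hcpos : 0 < L / (2 * Real.pi) := by positivity
  have hςmtop : Tendsto (fun s => ς * (m s : ℝ)) l atTop := by
    refine (hςm.pos_mul_atTop hcpos hl).congr' ?_
    filter_upwards [hpos] with s hs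
    field_simp
  have hnat : ∀ᶠ s in l, ((m s).natAbs : ℝ) = ς * m s := by
    filter_upwards [hςmtop.eventually_gt_atTop 0] with s hs
    rw [Nat.cast_natAbs]
    push_cast
    rcases hς with rfl | rfl
    · rw [abs_of_pos (by linarith), one_mul]
    · rw [abs_of_neg (by linarith), neg_one_mul]
  have hlogdiff : Tendsto (fun s => Real.log ‖s‖ - Real.log ((m s).natAbs * Real.pi / L)
      - Real.log 2) l (𝓝 0) := by
    have h1 : Tendsto (fun s => -Real.log (ς * (m s : ℝ) / ‖s‖ * (2 * Real.pi / L))) l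
        (𝓝 (-Real.log (L / (2 * Real.pi) * (2 * Real.pi / L)))) :=
      ((hςm.mul_const _).log (by positivity)).neg
    have h2 : L / (2 * Real.pi) * (2 * Real.pi / L) = 1 := by field_simp
    rw [h2, Real.log_one, neg_zero] at h1
    refine h1.congr' ?_
    filter_upwards [hpos, hnat, hςmtop.eventually_gt_atTop 0] with s hs hn hmp
    rw [hn]
    have e1 : ς * (m s : ℝ) / ‖s‖ * (2 * Real.pi / L) = (ς * m s * Real.pi / L) * 2 / ‖s‖ := by ring
    rw [e1, Real.log_div (by positivity) hs.ne', Real.log_mul (by positivity) (by norm_num)]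
    ring
  have hfinal : Tendsto (fun s => ‖s - approxZero L p ρ ς (m s).natAbs‖) l (𝓝 0) := by
    have h0 : Tendsto (fun s => ((Real.log ‖s‖ - Real.log ((m s).natAbs * Real.pi / L)
      - Real.log 2 : ℝ) : ℂ)) l (𝓝 0) := by
      exact_mod_cast (Complex.continuous_ofReal.tendsto 0).comp hlogdiff
    have h1 := ((hlogY.add (h0.const_mul (p : ℂ))).div_const (L : ℂ)).norm
    rw [mul_zero, add_zero, zero_div, norm_zero] at h1
    refine h1.congr' ?_
    filter_upwards [hnat] with s hn
    congr 1
    have hnc : ((m s).natAbs : ℂ) = ς * m s := by exact_mod_cast congrArg (fun x : ℝ => (x : ℂ)) hn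
    have h3 := hm s
    have h4 := mul_approxZero (p := p) (ρ := ρ) (ς := ς) hL (m s).natAbs
    rw [log_div_two_pow hρ, hnc] at h4
    rw [div_eq_iff hLc, sub_mul, h4]
    have h5 : Complex.log (Complex.exp (Y s)) = Y s - m s * (2 * Real.pi * Complex.I) :=
      eq_sub_iff_add_eq.2 h3.symm
    rw [h5, hY]
    push_cast
    linear_combination (m s * (2 * Real.pi * Complex.I)) * hςsq'
  filter_upwards [hfinal.eventually (gt_mem_nhds hr), hnat,
    hςmtop.eventually_ge_atTop (N : ℝ)] with s h1 h2 h3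
  refine ⟨(m s).natAbs, ?_, h1.le⟩
  have : (N : ℝ) ≤ (m s).natAbs := by rw [h2]; exact h3
  exact_mod_cast this

end

section


/-- The zeros near the approximate zeros of one sign: from some index on there is exactly one within
a fixed distance, it is simple, and the distance tends to zero. -/
theorem exists_zero_sequence {F : ℂ → ℂ} {L : ℝ} {p : ℕ} {ρ : ℂ} (hL : 0 < L) (hρ : ρ ≠ 0)
    (hF : ∀ ε : ℝ, 0 < ε → ∃ R : ℝ, ∀ s : ℂ, R ≤ ‖s‖ →
      ‖F s - 1 + doubleReflection L p ρ s‖ ≤ ε * max 1 ‖doubleReflection L p ρ s‖)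
    (han : ∃ R : ℝ, ∀ s : ℂ, R ≤ ‖s‖ → AnalyticAt ℂ F s) :
    ∃ r : ℝ, 0 < r ∧ ∀ ς : ℝ, ς = 1 ∨ ς = -1 → ∃ (N : ℕ) (x : ℕ → ℂ),
      Tendsto (fun n => x n - approxZero L p ρ ς n) atTop (𝓝 0) ∧
      ∀ n, N ≤ n → F (x n) = 0 ∧ deriv F (x n) ≠ 0 ∧
        ∀ s, ‖s - approxZero L p ρ ς n‖ ≤ r → F s = 0 → s = x n := by
  obtain ⟨r, hr, hzero⟩ := exists_unique_zero hL
  obtain ⟨R, hR⟩ := han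
  refine ⟨r, hr, fun ς hς => ?_⟩
  have hlin := tendsto_approxZero_div (p := p) (ρ := ρ) (ς := ς) hL
  have hςn : ‖(ς : ℂ)‖ = 1 := by rcases hς with rfl | rfl <;> simp
  have hlim0 : 0 < ‖(ς * Complex.I * (2 * Real.pi / L) : ℂ)‖ := by
    have : (2 * Real.pi / L : ℂ) = ((2 * Real.pi / L : ℝ) : ℂ) := by push_cast; ring
    rw [norm_mul, norm_mul, hςn, Complex.norm_I, this, Complex.norm_real, one_mul, one_mul,
      Real.norm_of_nonneg (by positivity)]
    positivity
  have hnorm : Tendsto (fun n : ℕ => ‖approxZero L p ρ ς n‖) atTop atTop := by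
    have h1 : Tendsto (fun n : ℕ => ‖approxZero L p ρ ς n / n‖ * (n : ℝ)) atTop atTop :=
      hlin.norm.pos_mul_atTop hlim0 tendsto_natCast_atTop_atTop
    refine h1.congr' ?_
    filter_upwards [eventually_gt_atTop 0] with n hn
    have : (n : ℝ) ≠ 0 := by exact_mod_cast hn.ne'
    rw [norm_div, Complex.norm_natCast]
    field_simp
  -- the conclusion of the contraction argument, for every small `η`
  have key : ∀ η : ℝ, 0 < η → η ≤ r * L / 4 → ∀ᶠ n : ℕ in atTop, ∃ y : ℂ,
      ‖y - approxZero L p ρ ς n‖ ≤ 2 * η / L ∧ F y = 0 ∧ deriv F y ≠ 0 ∧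
      ∀ s, ‖s - approxZero L p ρ ς n‖ ≤ r → F s = 0 → s = y := by
    intro η hη hηr
    filter_upwards [eventually_near_approxZero hL hρ hς hF (r := 2 * r) hη,
      hnorm.eventually_ge_atTop (R + 2 * r)] with n h1 h2
    set s₀ := approxZero L p ρ ς n with hs₀
    obtain ⟨t, ht, ht0, htd, htu⟩ := hzero (fun t => F (s₀ + t)) η hηr (fun t ht => by
      have hFan : AnalyticAt ℂ F (s₀ + t) := hR _ (by
        have : ‖s₀‖ ≤ ‖s₀ + t‖ + ‖t‖ := by
          calc ‖s₀‖ = ‖(s₀ + t) - t‖ := by ring_nf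
            _ ≤ _ := norm_sub_le _ _
        linarith)
      exact hFan.fun_comp (by fun_prop : AnalyticAt ℂ (fun t : ℂ => s₀ + t) t)) h1
    refine ⟨s₀ + t, by simpa using ht, ht0, ?_, fun s hs hFs => ?_⟩
    · rwa [deriv_comp_const_add] at htd
    · have := htu (s - s₀) hs (by simpa using hFs)
      rw [← this]
      ring
  have hη₀ : 0 < r * L / 4 := by positivity
  obtain ⟨N, hN⟩ := eventually_atTop.1 (key _ hη₀ le_rfl)
  choose y hy using hN
  refine ⟨N, fun n => if h : N ≤ n then y n h else 0, ?_, fun n hn => ?_⟩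
  · rw [Metric.tendsto_nhds]
    intro ε hε
    set η := min (r * L / 4) (ε * L / 4) with hη
    filter_upwards [key η (by positivity) (min_le_left _ _), eventually_ge_atTop N] with n h1 hn
    obtain ⟨y', h2, h3, -, -⟩ := h1
    have h4 : 2 * η / L ≤ r := by
      rw [div_le_iff₀ hL]
      linarith [min_le_left (r * L / 4) (ε * L / 4), mul_pos hr hL]
    have h5 : y' = y n hn := (hy n hn).2.2.2 y' (h2.trans h4) h3
    rw [dist_zero_right, dif_pos hn, ← h5]
    refine h2.trans_lt ?_
    rw [div_lt_iff₀ hL]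
    linarith [min_le_right (r * L / 4) (ε * L / 4), mul_pos hε hL]
  · beta_reduce
    rw [dif_pos hn]
    exact (hy n hn).2

/-- A sequence of norms that increases to infinity from some index on is cut by a level exactly at
an index, provided that the level is not exceeded up to there. -/
theorem exists_cut {x : ℕ → ℝ} {N : ℕ} {R : ℝ} (hmono : ∀ n, N ≤ n → x n < x (n + 1))
    (hlim : Tendsto x atTop atTop) (hR : ∀ n, n ≤ N → x n ≤ R) :
    ∃ M, N ≤ M ∧ ∀ n, R < x n ↔ M < n := by
  have hex : ∃ n, R < x n := (hlim.eventually_gt_atTop R).exists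
  classical
  set m := Nat.find hex with hm
  have hmR : R < x m := Nat.find_spec hex
  have hNm : N < m := by
    by_contra h
    exact absurd (hR m (not_lt.1 h)) (not_le.2 hmR)
  have hup : ∀ n, m ≤ n → R < x n := by
    intro n hn
    induction n, hn using Nat.le_induction with
    | base => exact hmR
    | succ n hn ih => exact ih.trans (hmono n (by omega))
  refine ⟨m - 1, by omega, fun n => ⟨fun h => ?_, fun h => hup n (by omega)⟩⟩
  have : m ≤ n := Nat.find_min' hex h
  omega

/-- The eventual behaviour of a sequence close to the approximate zeros. -/
theorem eventually_norm_lt_succ {L : ℝ} {p : ℕ} {ρ : ℂ} {ς : ℝ} {x : ℕ → ℂ} (hL : 0 < L)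
    (hς : ς = 1 ∨ ς = -1)
    (hx : Tendsto (fun n => x n - approxZero L p ρ ς n) atTop (𝓝 0)) :
    Tendsto (fun n => ‖x n‖) atTop atTop ∧ (∀ᶠ n in atTop, ‖x n‖ < ‖x (n + 1)‖) ∧
      ∀ᶠ n in atTop, 0 < ς * (x n).im := by
  set c : ℂ := ς * Complex.I * (2 * Real.pi / L) with hc
  have hcdef : c = ((ς * (2 * Real.pi / L) : ℝ) : ℂ) * Complex.I := by
    rw [hc]; push_cast; ring
  have hdiv : Tendsto (fun n : ℕ => x n / n) atTop (𝓝 c) := by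
    have h1 : Tendsto (fun n : ℕ => (x n - approxZero L p ρ ς n) * ((n : ℂ))⁻¹) atTop (𝓝 (0 * 0)) :=
      hx.mul tendsto_inv_atTop_nhds_zero_nat
    have h2 := h1.add (tendsto_approxZero_div (p := p) (ρ := ρ) (ς := ς) hL)
    rw [mul_zero, zero_add] at h2
    refine h2.congr fun n => ?_
    ring
  have hςsq : ς * ς = 1 := by rcases hς with rfl | rfl <;> norm_num
  have hcim : ς * c.im = 2 * Real.pi / L := by
    rw [hcdef, Complex.im_ofReal_mul]
    simp only [Complex.I_im, mul_one]
    rw [← mul_assoc, hςsq, one_mul]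
  have hcnorm : 0 < Complex.normSq c := by
    rw [Complex.normSq_pos]
    intro h
    rw [h, Complex.zero_im, mul_zero] at hcim
    have : 0 < 2 * Real.pi / L := by positivity
    linarith
  have hncast : Tendsto (fun n : ℕ => (n : ℝ)) atTop atTop := tendsto_natCast_atTop_atTop
  refine ⟨?_, ?_, ?_⟩
  · have h1 : Tendsto (fun n : ℕ => ‖x n / n‖ * (n : ℝ)) atTop atTop :=
      hdiv.norm.pos_mul_atTop (norm_pos_iff.2 (Complex.normSq_pos.1 hcnorm)) hncast
    refine h1.congr' ?_
    filter_upwards [eventually_gt_atTop 0] with n hn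
    have : (n : ℝ) ≠ 0 := by exact_mod_cast hn.ne'
    rw [norm_div, Complex.norm_natCast]
    field_simp
  · -- the increments tend to `c`, and so do the directions
    have hinc : Tendsto (fun n => x (n + 1) - x n) atTop (𝓝 c) := by
      have h1 : Tendsto (fun n => approxZero L p ρ ς (n + 1) - approxZero L p ρ ς n) atTop
          (𝓝 c) := by
        have h2 : Tendsto (fun n : ℕ => Real.log ((n + 1 : ℕ) * Real.pi / L) -
            Real.log (n * Real.pi / L)) atTop (𝓝 0) := by
          have h3 : Tendsto (fun n : ℕ => Real.log (1 + ((n : ℝ))⁻¹)) atTop (𝓝 (Real.log (1 + 0))) :=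
            (tendsto_inv_atTop_nhds_zero_nat.const_add 1).log (by norm_num)
          rw [add_zero, Real.log_one] at h3
          refine h3.congr' ?_
          filter_upwards [eventually_gt_atTop 0] with n hn
          have hn' : (0 : ℝ) < n := by exact_mod_cast hn
          rw [← Real.log_div (by positivity) (by positivity)]
          congr 1
          push_cast
          field_simp
        have h4 : Tendsto (fun n : ℕ => ((Real.log ((n + 1 : ℕ) * Real.pi / L) -
            Real.log (n * Real.pi / L) : ℝ) : ℂ)) atTop (𝓝 0) := by
          exact_mod_cast (Complex.continuous_ofReal.tendsto 0).comp h2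
        have h5 := (h4.const_mul ((p : ℂ) / L)).const_add c
        rw [mul_zero, add_zero] at h5
        refine h5.congr fun n => ?_
        have hLc : (L : ℂ) ≠ 0 := by exact_mod_cast hL.ne'
        have e1 := mul_approxZero (p := p) (ρ := ρ) (ς := ς) hL n
        have e2 := mul_approxZero (p := p) (ρ := ρ) (ς := ς) hL (n + 1)
        have e3 : (approxZero L p ρ ς (n + 1) - approxZero L p ρ ς n) * L =
            (c + (p : ℂ) / L * ((Real.log ((n + 1 : ℕ) * Real.pi / L) -
            Real.log (n * Real.pi / L) : ℝ) : ℂ)) * L := by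
          rw [sub_mul, e1, e2, hc]
          push_cast
          field_simp
          ring
        exact (mul_right_cancel₀ hLc e3).symm
      have h6 := ((hx.comp (tendsto_add_atTop_nat 1)).sub hx).add h1
      rw [sub_zero, zero_add] at h6
      refine h6.congr fun n => ?_
      simp only [Function.comp]
      ring
    have hprod : Tendsto (fun n : ℕ => ((x (n + 1) - x n) * (starRingEnd ℂ) (x n / n)).re) atTop
        (𝓝 (Complex.normSq c)) := by
      have h1 := (Complex.continuous_re.tendsto _).comp
        (hinc.mul ((Complex.continuous_conj.tendsto _).comp hdiv))
      rw [Complex.mul_conj, Complex.ofReal_re] at h1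
      exact h1
    filter_upwards [hprod.eventually (lt_mem_nhds hcnorm), eventually_gt_atTop 0] with n h1 hn
    have hn' : (0 : ℝ) < n := by exact_mod_cast hn
    have h2 : 0 < ((x (n + 1) - x n) * (starRingEnd ℂ) (x n)).re := by
      have : (x (n + 1) - x n) * (starRingEnd ℂ) (x n) =
          (n : ℝ) * ((x (n + 1) - x n) * (starRingEnd ℂ) (x n / n)) := by
        have hnc : (n : ℂ) ≠ 0 := by exact_mod_cast hn.ne'
        rw [map_div₀, Complex.conj_natCast]
        push_cast
        field_simp
      rw [this, Complex.re_ofReal_mul]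
      positivity
    have h3 : (x (n + 1) * (starRingEnd ℂ) (x n)).re = ‖x n‖ ^ 2 +
        ((x (n + 1) - x n) * (starRingEnd ℂ) (x n)).re := by
      rw [sub_mul, Complex.sub_re, Complex.mul_conj, Complex.ofReal_re, Complex.normSq_eq_norm_sq]
      ring
    have h4 : (x (n + 1) * (starRingEnd ℂ) (x n)).re ≤ ‖x (n + 1)‖ * ‖x n‖ := by
      refine norm_le_of_re_max.trans ?_
      rw [norm_mul, RCLike.norm_conj]
    by_contra h
    have h5 : ‖x (n + 1)‖ * ‖x n‖ ≤ ‖x n‖ * ‖x n‖ := by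
      gcongr
      exact not_lt.1 h
    linarith [sq ‖x n‖]
  · have h1 : Tendsto (fun n : ℕ => ς * (x n / n).im) atTop (𝓝 (ς * c.im)) :=
      ((Complex.continuous_im.tendsto _).comp hdiv).const_mul ς
    rw [hcim] at h1
    filter_upwards [h1.eventually (lt_mem_nhds (by positivity : (0 : ℝ) < 2 * Real.pi / L)),
      eventually_gt_atTop 0] with n h2 hn
    have hn' : (0 : ℝ) < n := by exact_mod_cast hn
    rw [← Complex.ofReal_natCast, Complex.div_ofReal_im, ← mul_div_assoc] at h2
    exact (div_pos_iff_of_pos_right hn').1 h2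

/-- The large zeros of a function asymptotic to `1 - ρ s^{-p} e^{sL}` are simple and form two
sequences, asymptotic to the approximate zeros. -/
theorem zeros_asymptotics {F : ℂ → ℂ} {L : ℝ} {p : ℕ} {ρ : ℂ} (hL : 0 < L) (hρ : ρ ≠ 0)
    (hF : ∀ ε : ℝ, 0 < ε → ∃ R : ℝ, ∀ s : ℂ, R ≤ ‖s‖ →
      ‖F s - 1 + doubleReflection L p ρ s‖ ≤ ε * max 1 ‖doubleReflection L p ρ s‖)
    (han : ∃ R : ℝ, ∀ s : ℂ, R ≤ ‖s‖ → AnalyticAt ℂ F s) (R₀ : ℝ) :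
    ∃ R : ℝ, R₀ ≤ R ∧ ∃ (Np Nm : ℕ) (xp xm : ℕ → ℂ),
      Tendsto (fun n => xp n - approxZero L p ρ 1 n) atTop (𝓝 0) ∧
      Tendsto (fun n => xm n - approxZero L p ρ (-1) n) atTop (𝓝 0) ∧
      {s | F s = 0 ∧ R < ‖s‖} = xp '' Ioi Np ∪ xm '' Ioi Nm ∧
      InjOn xp (Ioi Np) ∧ InjOn xm (Ioi Nm) ∧ Disjoint (xp '' Ioi Np) (xm '' Ioi Nm) ∧
      ∀ s, F s = 0 → R < ‖s‖ → deriv F s ≠ 0 := by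
  obtain ⟨r, hr, hseq⟩ := exists_zero_sequence hL hρ hF han
  obtain ⟨N₁, xp, hxp, hp⟩ := hseq 1 (Or.inl rfl)
  obtain ⟨N₂, xm, hxm, hm⟩ := hseq (-1) (Or.inr rfl)
  obtain ⟨hptop, hpmono, hpim⟩ := eventually_norm_lt_succ hL (Or.inl rfl) hxp
  obtain ⟨hmtop, hmmono, hmim⟩ := eventually_norm_lt_succ hL (Or.inr rfl) hxm
  obtain ⟨N, hN⟩ := eventually_atTop.1 ((hpmono.and hpim).and ((hmmono.and hmim).and
    ((eventually_ge_atTop N₁).and (eventually_ge_atTop N₂))))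
  have hQ := tendsto_doubleReflection_of_zero hF
  set l : Filter ℂ := comap norm atTop ⊓ 𝓟 {s | F s = 0} with hl
  have hlnorm : Tendsto norm l atTop := tendsto_comap.mono_left inf_le_left
  have hsign : ∀ ς : ℝ, ς = 1 ∨ ς = -1 → ∀ᶠ s in l, 0 < ς * s.im →
      ∃ n, N ≤ n ∧ ‖s - approxZero L p ρ ς n‖ ≤ r := by
    intro ς hς
    have h1 := eventually_exists_approxZero (l := l ⊓ 𝓟 {s | 0 < ς * s.im}) hL hρ hς
      (hlnorm.mono_left inf_le_left) (hQ.mono_left inf_le_left)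
      (eventually_inf_principal.2 (Eventually.of_forall fun s hs => hs)) hr N
    exact eventually_inf_principal.1 h1
  -- large zeros are not real, as `Q` tends to zero along the real axis of `z`
  have hreal : ∀ᶠ s in l, s.im ≠ 0 := by
    have hre : Tendsto (fun s : ℂ => (s.re * L - p * Real.log ‖s‖)) l (𝓝 (-Real.log ‖ρ‖)) := by
      have h1 : Tendsto (fun s : ℂ => Real.log ‖doubleReflection L p ρ s‖) l (𝓝 0) := by
        have := (Real.continuousAt_log (by norm_num : (1 : ℝ) ≠ 0)).tendsto.comp
          (by simpa using hQ.norm)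
        rwa [Real.log_one] at this
      have h2 := h1.sub_const (Real.log ‖ρ‖)
      rw [zero_sub] at h2
      refine h2.congr' ?_
      filter_upwards [hlnorm.eventually_gt_atTop 0] with s hs
      have hs0 : s ≠ 0 := norm_pos_iff.1 hs
      rw [norm_doubleReflection hs0, Real.log_mul (norm_ne_zero_iff.2 hρ) (Real.exp_ne_zero _),
        Real.log_exp]
      ring
    have hdiv : Tendsto (fun s : ℂ => |s.re| / ‖s‖) l (𝓝 0) := by
      have hlogdiv : Tendsto (fun s : ℂ => Real.log ‖s‖ / ‖s‖) l (𝓝 0) := by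
        have h1 : Tendsto (fun x : ℝ => Real.log x / x) atTop (𝓝 0) := by
          simpa using Real.isLittleO_log_id_atTop.tendsto_div_nhds_zero
        exact h1.comp hlnorm
      have h3 := ((hre.mul hlnorm.inv_tendsto_atTop).add (hlogdiv.const_mul (p : ℝ))).div_const L
      rw [mul_zero, mul_zero, add_zero, zero_div] at h3
      have h4 := h3.abs
      rw [abs_zero] at h4
      refine h4.congr' ?_
      filter_upwards [hlnorm.eventually_gt_atTop 0] with s hs
      have : ((s.re * L - p * Real.log ‖s‖) * (norm⁻¹ : ℂ → ℝ) s + p * (Real.log ‖s‖ / ‖s‖)) / L =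
          s.re / ‖s‖ := by
        simp only [Pi.inv_apply]
        field_simp
        ring
      rw [this, abs_div, abs_norm]
    filter_upwards [hdiv.eventually (gt_mem_nhds one_pos), hlnorm.eventually_gt_atTop 0]
      with s h1 h2 h3
    rw [Complex.abs_re_eq_norm.2 h3, div_self h2.ne'] at h1
    exact lt_irrefl _ h1
  have hall := (hsign 1 (Or.inl rfl)).and ((hsign (-1) (Or.inr rfl)).and hreal)
  rw [hl, eventually_inf_principal, eventually_comap] at hall
  obtain ⟨R₁, hR₁⟩ := eventually_atTop.1 hall
  have hcover : ∀ s, R₁ ≤ ‖s‖ → F s = 0 →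
      (∃ n, N ≤ n ∧ s = xp n) ∨ ∃ n, N ≤ n ∧ s = xm n := by
    intro s hs hFs
    obtain ⟨h1, h2, h3⟩ := hR₁ _ hs s rfl hFs
    rcases lt_or_gt_of_ne h3 with h | h
    · obtain ⟨n, hn, hn'⟩ := h2 (by linarith)
      exact Or.inr ⟨n, hn, (hm n (hN n hn).2.2.2).2.2 s hn' hFs⟩
    · obtain ⟨n, hn, hn'⟩ := h1 (by linarith)
      exact Or.inl ⟨n, hn, (hp n (hN n hn).2.2.1).2.2 s hn' hFs⟩
  set R := max (max R₀ R₁) (∑ n ∈ Finset.range (N + 1), (‖xp n‖ + ‖xm n‖)) with hR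
  have hsum : ∀ n ≤ N, ‖xp n‖ + ‖xm n‖ ≤ R := fun n hn =>
    (Finset.single_le_sum (f := fun n => ‖xp n‖ + ‖xm n‖) (fun _ _ => by positivity)
      (Finset.mem_range.2 (by omega))).trans (le_max_right _ _)
  obtain ⟨Np, hNp, hcp⟩ := exists_cut (x := fun n => ‖xp n‖) (fun n hn => (hN n hn).1.1) hptop
    (fun n hn => by linarith [hsum n hn, norm_nonneg (xm n)])
  obtain ⟨Nm, hNm, hcm⟩ := exists_cut (x := fun n => ‖xm n‖) (fun n hn => (hN n hn).2.1.1) hmtop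
    (fun n hn => by linarith [hsum n hn, norm_nonneg (xp n)])
  have hinj : ∀ (x : ℕ → ℂ) (M : ℕ), (∀ n, N ≤ n → ‖x n‖ < ‖x (n + 1)‖) → N ≤ M →
      InjOn x (Ioi M) := by
    intro x M hx hM
    have hlt : ∀ m n, N ≤ m → m < n → ‖x m‖ < ‖x n‖ := by
      intro m n hm hmn
      induction n, hmn using Nat.le_induction with
      | base => exact hx m hm
      | succ n hn ih => exact ih.trans (hx n (by omega))
    intro m hm n hn hmn
    have hm' : M < m := hm
    have hn' : M < n := hn
    rcases lt_trichotomy m n with h | h | h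
    · have := hlt m n (by omega) h
      rw [hmn] at this
      exact absurd this (lt_irrefl _)
    · exact h
    · have := hlt n m (by omega) h
      rw [hmn] at this
      exact absurd this (lt_irrefl _)
  have hset : {s | F s = 0 ∧ R < ‖s‖} = xp '' Ioi Np ∪ xm '' Ioi Nm := by
    ext s
    constructor
    · rintro ⟨hFs, hs⟩
      rcases hcover s (((le_max_right _ _).trans (le_max_left _ _)).trans hs.le) hFs with
        ⟨n, hn, rfl⟩ | ⟨n, hn, rfl⟩
      · exact Or.inl ⟨n, (hcp n).1 hs, rfl⟩
      · exact Or.inr ⟨n, (hcm n).1 hs, rfl⟩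
    · rintro (⟨n, hn, rfl⟩ | ⟨n, hn, rfl⟩)
      · exact ⟨(hp n (hN n (hNp.trans (le_of_lt hn))).2.2.1).1, (hcp n).2 hn⟩
      · exact ⟨(hm n (hN n (hNm.trans (le_of_lt hn))).2.2.2).1, (hcm n).2 hn⟩
  refine ⟨R, (le_max_left _ _).trans (le_max_left _ _), Np, Nm, xp, xm, hxp, hxm, hset,
    hinj xp Np (fun n hn => (hN n hn).1.1) hNp, hinj xm Nm (fun n hn => (hN n hn).2.1.1) hNm,
    ?_, fun s hFs hs => ?_⟩
  · rw [Set.disjoint_left]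
    rintro _ ⟨n, hn, rfl⟩ ⟨m, hm', hmn⟩
    have h1 := (hN n (hNp.trans (le_of_lt hn))).1.2
    have h2 := (hN m (hNm.trans (le_of_lt hm'))).2.1.2
    rw [hmn] at h2
    linarith
  · have : s ∈ xp '' Ioi Np ∪ xm '' Ioi Nm := hset ▸ ⟨hFs, hs⟩
    rcases this with ⟨n, hn, rfl⟩ | ⟨n, hn, rfl⟩
    · exact (hp n (hN n (hNp.trans (le_of_lt hn))).2.2.1).2.1
    · exact (hm n (hN n (hNm.trans (le_of_lt hn))).2.2.2).2.1

end

section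


/-! ### The free resolvent -/

open scoped ComplexConjugate Convolution

/-- `φ` is a test function: smooth with compact support. -/
structure IsTest (φ : ℝ → ℂ) : Prop where
  contDiff : ContDiff ℝ (⊤ : ℕ∞) φ
  compact : HasCompactSupport φ

/-- The space `C_c^∞(ℝ; ℂ)` of test functions. -/
def testSpace : Submodule ℂ (ℝ → ℂ) where
  carrier := {φ | IsTest φ}
  add_mem' := fun hf hg => ⟨hf.1.add hg.1, hf.2.add hg.2⟩
  zero_mem' := ⟨contDiff_const, HasCompactSupport.zero⟩
  smul_mem' := fun c _ hf => ⟨hf.1.const_smul c, hf.2.smul_left (f := fun _ => c)⟩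

theorem IsTest.differentiable {φ : ℝ → ℂ} (hφ : IsTest φ) : Differentiable ℝ φ :=
  hφ.contDiff.differentiable (by simp)

theorem IsTest.continuous {φ : ℝ → ℂ} (hφ : IsTest φ) : Continuous φ := hφ.contDiff.continuous

theorem IsTest.deriv {φ : ℝ → ℂ} (hφ : IsTest φ) : IsTest (_root_.deriv φ) :=
  ⟨(contDiff_infty_iff_deriv.1 hφ.1).2, hφ.2.deriv⟩

theorem IsTest.memLp {φ : ℝ → ℂ} (hφ : IsTest φ) : MemLp φ 2 volume :=
  hφ.continuous.memLp_of_hasCompactSupport hφ.2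

theorem iteratedDeriv_two (φ : ℝ → ℂ) : iteratedDeriv 2 φ = deriv (deriv φ) := by
  rw [iteratedDeriv_succ, iteratedDeriv_one]

/-- The inclusion of the test functions in `L²(ℝ)`. -/
def testToL2 : testSpace →ₗ[ℂ] L2 where
  toFun φ := MemLp.toLp φ.1 φ.2.memLp
  map_add' _ _ := rfl
  map_smul' _ _ := rfl

theorem coeFn_testToL2 (φ : testSpace) : testToL2 φ =ᵐ[volume] φ.1 :=
  MemLp.coeFn_toLp φ.2.memLp

/-- The operator `-d²/dx² - z²` on test functions. -/
def helmholtz (z : ℂ) : testSpace →ₗ[ℂ] testSpace where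
  toFun φ := ⟨fun x => -deriv (deriv φ.1) x - z ^ 2 * φ.1 x,
    testSpace.sub_mem (testSpace.neg_mem φ.2.deriv.deriv) (testSpace.smul_mem (z ^ 2) φ.2)⟩
  map_add' φ ψ := by
    ext x
    have h1 : deriv (φ.1 + ψ.1) = deriv φ.1 + deriv ψ.1 := by
      ext y
      exact deriv_add φ.2.differentiable.differentiableAt ψ.2.differentiable.differentiableAt
    have h2 : deriv (deriv φ.1 + deriv ψ.1) x = deriv (deriv φ.1) x + deriv (deriv ψ.1) x :=
      deriv_add φ.2.deriv.differentiable.differentiableAt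
        ψ.2.deriv.differentiable.differentiableAt
    simp only [Submodule.coe_add, h1, h2, Pi.add_apply]
    ring
  map_smul' c φ := by
    ext x
    have h1 : deriv (c • φ.1) = c • deriv φ.1 := by
      ext y
      exact deriv_const_smul c φ.2.differentiable.differentiableAt
    have h2 : deriv (c • deriv φ.1) x = c • deriv (deriv φ.1) x :=
      deriv_const_smul c φ.2.deriv.differentiable.differentiableAt
    simp only [Submodule.coe_smul, h1, h2, Pi.smul_apply, smul_eq_mul, RingHom.id_apply]
    ring

theorem helmholtz_apply (z : ℂ) (φ : testSpace) (x : ℝ) :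
    (helmholtz z φ).1 x = -deriv (deriv φ.1) x - z ^ 2 * φ.1 x := rfl

theorem integrable_mul_test {f φ : ℝ → ℂ} (hf : MemLp f 2 volume) (hφ : IsTest φ) :
    Integrable (fun x => f x * φ x) :=
  hf.integrable_mul hφ.memLp

/-- Complex conjugation on `L²(ℝ)`. -/
def conjL2 : L2 →L[ℝ] L2 := (Complex.conjCLE : ℂ →L[ℝ] ℂ).compLpL 2 volume

theorem coeFn_conjL2 (f : L2) : conjL2 f =ᵐ[volume] fun x => conj (f x) :=
  ContinuousLinearMap.coeFn_compLpL _ _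

theorem norm_conjL2_le (f : L2) : ‖conjL2 f‖ ≤ ‖f‖ := by
  refine Lp.norm_le_norm_of_ae_le ?_
  filter_upwards [coeFn_conjL2 f] with x hx
  rw [hx, RCLike.norm_conj]

/-- The pairing `∫ f g` of `L²(ℝ)` with itself. -/
def pairing (f g : L2) : ℂ := ∫ x, f x * g x

theorem pairing_eq_inner (f g : L2) : pairing f g = inner ℂ (conjL2 f) g := by
  rw [L2.inner_def]
  refine integral_congr_ae ?_
  filter_upwards [coeFn_conjL2 f] with x h1
  rw [h1, RCLike.inner_apply]
  simp [mul_comm]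

theorem norm_pairing_le (f g : L2) : ‖pairing f g‖ ≤ ‖f‖ * ‖g‖ := by
  rw [pairing_eq_inner]
  refine (norm_inner_le_norm _ _).trans ?_
  gcongr
  exact norm_conjL2_le f

theorem pairing_sub_left (f g h : L2) : pairing (f - g) h = pairing f h - pairing g h := by
  rw [pairing_eq_inner, pairing_eq_inner, pairing_eq_inner, map_sub, inner_sub_left]

theorem continuous_pairing {X : Type*} [TopologicalSpace X] {f g : X → L2} (hf : Continuous f)
    (hg : Continuous g) : Continuous fun x => pairing (f x) (g x) := by
  simp only [pairing_eq_inner]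
  exact (conjL2.continuous.comp hf).inner hg

theorem norm_integral_mul_le {f g : ℝ → ℂ} (hf : MemLp f 2 volume) (hg : MemLp g 2 volume) :
    ‖∫ x, f x * g x‖ ≤ ‖hf.toLp‖ * ‖hg.toLp‖ := by
  have h : ∫ x, f x * g x = pairing hf.toLp hg.toLp := by
    refine integral_congr_ae ?_
    filter_upwards [hf.coeFn_toLp, hg.coeFn_toLp] with x h2 h3
    rw [h2, h3]
  rw [h]
  exact norm_pairing_le _ _

theorem integral_mul_helmholtz (z : ℂ) {f : ℝ → ℂ} (hf : IsTest f) (φ : testSpace) :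
    ∫ x, f x * (helmholtz z φ).1 x =
      (∫ x, deriv f x * deriv φ.1 x) - z ^ 2 * ∫ x, f x * φ.1 x := by
  have hi1 := integrable_mul_test hf.memLp φ.2.deriv.deriv
  have hi2 := integrable_mul_test hf.memLp φ.2
  have h1 : ∫ x, f x * deriv (deriv φ.1) x = -∫ x, deriv f x * deriv φ.1 x :=
    integral_mul_deriv_eq_deriv_mul_of_integrable
      (fun x _ => hf.differentiable.differentiableAt.hasDerivAt)
      (fun x _ => φ.2.deriv.differentiable.differentiableAt.hasDerivAt)
      hi1 (integrable_mul_test hf.deriv.memLp φ.2.deriv) (integrable_mul_test hf.memLp φ.2.deriv)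
  calc ∫ x, f x * (helmholtz z φ).1 x
      = ∫ x, (-(f x * deriv (deriv φ.1) x) - z ^ 2 * (f x * φ.1 x)) := by
        congr 1; ext x; rw [helmholtz_apply]; ring
    _ = _ := by
        rw [integral_sub (f := fun x => -(f x * deriv (deriv φ.1) x)) hi1.neg (hi2.const_mul _),
          integral_neg, h1, neg_neg,
          integral_const_mul]

theorem integral_helmholtz_symm (z : ℂ) (φ ψ : testSpace) :
    ∫ x, φ.1 x * (helmholtz z ψ).1 x = ∫ x, (helmholtz z φ).1 x * ψ.1 x := by
  have h : ∫ x, (helmholtz z φ).1 x * ψ.1 x = ∫ x, ψ.1 x * (helmholtz z φ).1 x := by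
    congr 1; ext x; ring
  rw [h, integral_mul_helmholtz z φ.2, integral_mul_helmholtz z ψ.2]
  congr 2
  · ext x; ring
  · congr 1; ext x; ring

theorem IsTest.conj {φ : ℝ → ℂ} (hφ : IsTest φ) : IsTest fun x => conj (φ x) :=
  ⟨Complex.conjCLE.contDiff.comp hφ.1, hφ.2.comp_left (g := conj) (map_zero _)⟩

theorem IsTest.deriv_conj {φ : ℝ → ℂ} (hφ : IsTest φ) (x : ℝ) :
    _root_.deriv (fun x => conj (φ x)) x = conj (_root_.deriv φ x) :=
  hφ.differentiable.differentiableAt.hasDerivAt.star.deriv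

theorem integral_conj_mul_self (f : ℝ → ℂ) :
    ∫ x, conj (f x) * f x = ((∫ x, ‖f x‖ ^ 2 : ℝ) : ℂ) := by
  rw [← integral_complex_ofReal]
  congr 1; ext x
  rw [Complex.conj_mul']
  push_cast
  rfl

/-- The energy estimate: the imaginary part of `z̄ ⟨-φ'' - z²φ, φ⟩` is
`-(Im z) (‖φ'‖² + |z|² ‖φ‖²)`. -/
theorem norm_test_le_norm_helmholtz {z : ℂ} (hz : 0 < z.im) (φ : testSpace) :
    ‖testToL2 φ‖ ≤ (‖z‖ * z.im)⁻¹ * ‖testToL2 (helmholtz z φ)‖ := by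
  have hz0 : 0 < ‖z‖ := norm_pos_iff.2 fun h => by simp [h] at hz
  set N := ‖testToL2 φ‖ with hN
  have hNsq : ∫ x, ‖φ.1 x‖ ^ 2 = N ^ 2 := by
    have h1 : ((N ^ 2 : ℝ) : ℂ) = inner ℂ (testToL2 φ) (testToL2 φ) := by
      rw [inner_self_eq_norm_sq_to_K]; push_cast; rfl
    rw [L2.inner_def] at h1
    have h2 : ∫ x, inner ℂ (testToL2 φ x) (testToL2 φ x) = ∫ x, conj (φ.1 x) * φ.1 x := by
      refine integral_congr_ae ?_
      filter_upwards [coeFn_testToL2 φ] with x hx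
      rw [hx, RCLike.inner_apply, mul_comm]
    rw [h2, integral_conj_mul_self] at h1
    exact_mod_cast h1.symm
  set D := ∫ x, ‖deriv φ.1 x‖ ^ 2 with hD
  have hD0 : 0 ≤ D := integral_nonneg fun x => by positivity
  have hform : ∫ x, conj (φ.1 x) * (helmholtz z φ).1 x = (D : ℂ) - z ^ 2 * (N ^ 2 : ℝ) := by
    rw [integral_mul_helmholtz z φ.2.conj φ, integral_conj_mul_self, hNsq]
    congr 1
    rw [hD, ← integral_conj_mul_self]
    congr 1; ext x
    rw [φ.2.deriv_conj]
  have hle : ‖(D : ℂ) - z ^ 2 * (N ^ 2 : ℝ)‖ ≤ N * ‖testToL2 (helmholtz z φ)‖ := by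
    rw [← hform]
    have h1 : ∫ x, conj (φ.1 x) * (helmholtz z φ).1 x =
        inner ℂ (testToL2 φ) (testToL2 (helmholtz z φ)) := by
      rw [L2.inner_def]
      refine integral_congr_ae ?_
      filter_upwards [coeFn_testToL2 φ, coeFn_testToL2 (helmholtz z φ)] with x h2 h3
      rw [h2, h3, RCLike.inner_apply, mul_comm]
    rw [h1]
    exact norm_inner_le_norm _ _
  have him : (conj z * ((D : ℂ) - z ^ 2 * (N ^ 2 : ℝ))).im = -(z.im * (D + ‖z‖ ^ 2 * N ^ 2)) := by
    have : conj z * ((D : ℂ) - z ^ 2 * (N ^ 2 : ℝ)) =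
        conj z * (D : ℂ) - (conj z * z) * z * (N ^ 2 : ℝ) := by ring
    rw [this, Complex.conj_mul']
    simp only [Complex.sub_im, Complex.mul_im, Complex.ofReal_re, Complex.ofReal_im,
      Complex.conj_im, Complex.mul_re, ← Complex.ofReal_pow]
    ring
  have h2 : z.im * (D + ‖z‖ ^ 2 * N ^ 2) ≤ ‖z‖ * (N * ‖testToL2 (helmholtz z φ)‖) := by
    have := Complex.abs_im_le_norm (conj z * ((D : ℂ) - z ^ 2 * (N ^ 2 : ℝ)))
    rw [him, abs_neg, abs_of_nonneg (by positivity), norm_mul, RCLike.norm_conj] at this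
    exact this.trans (by gcongr)
  rw [inv_mul_eq_div, le_div_iff₀ (by positivity)]
  rcases (norm_nonneg (testToL2 φ)).eq_or_lt with h | h
  · rw [← hN] at h
    rw [← h, zero_mul]
    positivity
  · have h3 : (‖z‖ * N) * (N * (‖z‖ * z.im)) ≤ (‖z‖ * N) * ‖testToL2 (helmholtz z φ)‖ := by
      nlinarith [mul_nonneg hz.le hD0]
    exact le_of_mul_le_mul_left h3 (by positivity)

/-- A bounded solution of `G'' = -z² G` on the line with bounded derivative is zero. -/
theorem eq_zero_of_bounded_helmholtz {z : ℂ} (hz : 0 < z.im) {G G' : ℝ → ℂ} {K : ℝ}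
    (hG : ∀ t, HasDerivAt G (G' t) t) (hG' : ∀ t, HasDerivAt G' (-z ^ 2 * G t) t)
    (hb : ∀ t, ‖G t‖ ≤ K) (hb' : ∀ t, ‖G' t‖ ≤ K) : G 0 = 0 := by
  -- `G' ± i z G` is a multiple of `exp (± i z t)`, which is unbounded on the line
  have key : ∀ c : ℂ, c ^ 2 = -z ^ 2 → c.re ≠ 0 → G' 0 + c * G 0 = 0 := by
    intro c hc hre
    set H : ℝ → ℂ := fun t => Complex.exp (-(c * t)) * (G' t + c * G t) with hH
    have hd : ∀ t, HasDerivAt H 0 t := by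
      intro t
      have h1 : HasDerivAt (fun t : ℝ => Complex.exp (-(c * t))) (Complex.exp (-(c * t)) * -c) t := by
        have : HasDerivAt (fun t : ℝ => -(c * (t : ℂ))) (-c) t := by
          have h := ((Complex.ofRealCLM.hasDerivAt (x := t)).const_mul c).neg
          rw [Complex.ofRealCLM_apply, Complex.ofReal_one, mul_one] at h
          exact h
        exact this.cexp
      have h2 := h1.mul ((hG' t).add ((hG t).const_mul c))
      refine h2.congr_deriv ?_
      simp only [Pi.add_apply]
      linear_combination -(Complex.exp (-(c * t)) * G t) * hc
    have hconst : ∀ t, H t = H 0 := fun t =>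
      is_const_of_deriv_eq_zero (fun t => (hd t).differentiableAt) (fun t => (hd t).deriv) t 0
    have hbound : ∀ t : ℝ, ‖G' 0 + c * G 0‖ ≤ Real.exp (-(c.re * t)) * (K + ‖c‖ * K) := by
      intro t
      have h1 : G' 0 + c * G 0 = H t := by rw [hconst]; simp [hH]
      rw [h1, hH]
      simp only [norm_mul, Complex.norm_exp]
      have h2 : (-(c * (t : ℂ))).re = -(c.re * t) := by simp
      rw [h2]
      gcongr
      refine (norm_add_le _ _).trans (add_le_add (hb' t) ?_)
      rw [norm_mul]
      gcongr
      exact hb t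
    have hlim : Tendsto (fun t : ℝ => Real.exp (-(c.re * (t / c.re))) * (K + ‖c‖ * K)) atTop
        (𝓝 (0 * (K + ‖c‖ * K))) := by
      refine (Real.tendsto_exp_neg_atTop_nhds_zero.congr fun t => ?_).mul_const _
      congr 2
      field_simp
    rw [zero_mul] at hlim
    have := ge_of_tendsto' hlim fun t => hbound (t / c.re)
    exact norm_le_zero_iff.1 this
  have h1 := key (Complex.I * z) (by rw [mul_pow, Complex.I_sq]; ring) (by simp; exact hz.ne')
  have h2 := key (-(Complex.I * z)) (by rw [neg_sq, mul_pow, Complex.I_sq]; ring)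
    (by simp; exact hz.ne')
  have h3 : Complex.I * z * G 0 = 0 := by linear_combination (h1 - h2) / 2
  have hz0 : z ≠ 0 := fun h => by simp [h] at hz
  exact (mul_eq_zero.1 h3).resolve_left (mul_ne_zero Complex.I_ne_zero hz0)

/-- A weak solution `v ∈ L²(ℝ)` of `-v'' = z² v`, `Im z > 0`, is zero: its convolution with a test
function is a bounded classical solution. -/
theorem eq_zero_of_weak_helmholtz {z : ℂ} (hz : 0 < z.im) {v : ℝ → ℂ} (hv : MemLp v 2 volume)
    (h : ∀ φ : testSpace, ∫ x, v x * (helmholtz z φ).1 x = 0) : v =ᵐ[volume] 0 := by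
  have hloc : LocallyIntegrable v := hv.locallyIntegrable (by norm_num)
  have htest : ∀ η, IsTest η → (v ⋆[ContinuousLinearMap.mul ℝ ℂ, volume] η) 0 = 0 := by
    intro η hη
    -- translates and reflections of a test function
    have hrefl : ∀ ψ, IsTest ψ → ∀ t : ℝ, IsTest fun x => ψ (t - x) := by
      intro ψ hψ t
      refine ⟨hψ.1.comp (contDiff_const.sub contDiff_id), ?_⟩
      exact hψ.2.comp_homeomorph (Homeomorph.subLeft t)
    have hderiv : ∀ ψ, IsTest ψ → ∀ t : ℝ, deriv (fun x => ψ (t - x)) =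
        fun x => -deriv ψ (t - x) := by
      intro ψ hψ t
      ext x
      exact (hψ.differentiable.differentiableAt.hasDerivAt.comp_const_sub t x).deriv
    have hd : ∀ ψ, IsTest ψ → ∀ t, HasDerivAt (v ⋆[ContinuousLinearMap.mul ℝ ℂ, volume] ψ)
        ((v ⋆[ContinuousLinearMap.mul ℝ ℂ, volume] deriv ψ) t) t := fun ψ hψ t =>
      hψ.2.hasDerivAt_convolution_right _ hloc (hψ.1.of_le (by exact_mod_cast le_top)) t
    have hbd : ∀ ψ, IsTest ψ → ∃ K, ∀ t,
        ‖(v ⋆[ContinuousLinearMap.mul ℝ ℂ, volume] ψ) t‖ ≤ K := by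
      intro ψ hψ
      refine ⟨‖hv.toLp‖ * ‖hψ.memLp.toLp‖, fun t => ?_⟩
      have h1 : (v ⋆[ContinuousLinearMap.mul ℝ ℂ, volume] ψ) t = ∫ x, v x * ψ (t - x) := rfl
      rw [h1]
      refine (norm_integral_mul_le hv (hrefl ψ hψ t).memLp).trans (le_of_eq ?_)
      congr 1
      rw [Lp.norm_toLp, Lp.norm_toLp]
      congr 1
      exact eLpNorm_comp_measurePreserving (hψ.memLp.1) (Measure.measurePreserving_sub_left volume t)
    obtain ⟨K₁, hK₁⟩ := hbd η hη
    obtain ⟨K₂, hK₂⟩ := hbd _ hη.deriv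
    refine eq_zero_of_bounded_helmholtz hz (K := max K₁ K₂) (hd η hη) (fun t => ?_)
      (fun t => (hK₁ t).trans (le_max_left _ _)) (fun t => (hK₂ t).trans (le_max_right _ _))
    convert hd _ hη.deriv t using 1
    have h1 := h ⟨_, hrefl η hη t⟩
    have h2 : ∀ x, (helmholtz z ⟨_, hrefl η hη t⟩).1 x =
        -deriv (deriv η) (t - x) - z ^ 2 * η (t - x) := by
      intro x
      rw [helmholtz_apply, hderiv η hη t]
      have : deriv (fun x => -deriv η (t - x)) x = deriv (deriv η) (t - x) := by
        rw [deriv.fun_neg, hderiv _ hη.deriv t, neg_neg]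
      rw [this]
    simp_rw [h2] at h1
    have hi1 := integrable_mul_test hv (hrefl _ hη.deriv.deriv t)
    have hi2 := integrable_mul_test hv (hrefl _ hη t)
    have h3 : ∫ x, v x * (-deriv (deriv η) (t - x) - z ^ 2 * η (t - x)) =
        -(∫ x, v x * deriv (deriv η) (t - x)) - z ^ 2 * ∫ x, v x * η (t - x) := by
      rw [← integral_neg, ← integral_const_mul,
        ← integral_sub (f := fun x => -(v x * deriv (deriv η) (t - x))) hi1.neg (hi2.const_mul _)]
      congr 1; ext x; ring
    rw [h3] at h1
    change -z ^ 2 * (∫ x, v x * η (t - x)) = ∫ x, v x * deriv (deriv η) (t - x)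
    linear_combination h1
  refine ae_eq_zero_of_integral_contDiff_smul_eq_zero hloc fun g hg hgs => ?_
  have hmem : IsTest fun x => ((g (-x) : ℝ) : ℂ) := by
    refine ⟨Complex.ofRealCLM.contDiff.comp (hg.comp contDiff_neg), ?_⟩
    exact (hgs.comp_homeomorph (Homeomorph.neg ℝ)).comp_left (g := Complex.ofReal) rfl
  have := htest _ hmem
  have h1 : (v ⋆[ContinuousLinearMap.mul ℝ ℂ, volume] fun x => ((g (-x) : ℝ) : ℂ)) 0 =
      ∫ x, v x * ((g (-(0 - x)) : ℝ) : ℂ) := rfl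
  rw [h1] at this
  rw [← this]
  congr 1; ext x
  rw [zero_sub, neg_neg, Complex.real_smul, mul_comm]

theorem denseRange_helmholtz {z : ℂ} (hz : 0 < z.im) :
    DenseRange (testToL2 ∘ₗ helmholtz z) := by
  have h : (LinearMap.range (testToL2 ∘ₗ helmholtz z)).topologicalClosure = ⊤ := by
    rw [Submodule.topologicalClosure_eq_top_iff, Submodule.eq_bot_iff]
    intro v hv
    have h1 : conjL2 v =ᵐ[volume] 0 := by
      refine eq_zero_of_weak_helmholtz hz (Lp.memLp (conjL2 v)) fun φ => ?_
      have h2 := Submodule.inner_left_of_mem_orthogonal (LinearMap.mem_range_self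
        (testToL2 ∘ₗ helmholtz z) φ) hv
      rw [← h2, L2.inner_def]
      refine integral_congr_ae ?_
      filter_upwards [coeFn_conjL2 v, coeFn_testToL2 (helmholtz z φ)] with x h3 h4
      rw [h3, LinearMap.comp_apply, h4, RCLike.inner_apply, mul_comm]
    refine (Lp.eq_zero_iff_ae_eq_zero).2 ?_
    filter_upwards [h1, coeFn_conjL2 v] with x h3 h4
    rw [h3] at h4
    simpa using h4.symm
  rw [← Submodule.dense_iff_topologicalClosure_eq_top] at h
  exact h

theorem pairing_testToL2 (f : L2) (φ : testSpace) :
    pairing f (testToL2 φ) = ∫ x, f x * φ.1 x := by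
  refine integral_congr_ae ?_
  filter_upwards [coeFn_testToL2 φ] with x hx
  rw [hx]

/-- The resolvent `(-d²/dx² - z²)⁻¹` for `Im z > 0`, the continuous extension of the inverse of the
operator on test functions. -/
def freeResolvent (z : ℂ) : L2 →L[ℂ] L2 :=
  testToL2.extendOfNorm (testToL2 ∘ₗ helmholtz z)

theorem freeResolvent_helmholtz {z : ℂ} (hz : 0 < z.im) (φ : testSpace) :
    freeResolvent z (testToL2 (helmholtz z φ)) = testToL2 φ :=
  LinearMap.extendOfNorm_eq (denseRange_helmholtz hz)
    ⟨_, fun φ => norm_test_le_norm_helmholtz hz φ⟩ φ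

theorem norm_freeResolvent_le {z : ℂ} (hz : 0 < z.im) : ‖freeResolvent z‖ ≤ (‖z‖ * z.im)⁻¹ :=
  ContinuousLinearMap.opNorm_le_bound _ (by positivity) fun f =>
    LinearMap.norm_extendOfNorm_apply_le (denseRange_helmholtz hz)
      _ (fun φ => norm_test_le_norm_helmholtz hz φ) f

theorem pairing_freeResolvent {z : ℂ} (hz : 0 < z.im) (f g : L2) :
    pairing (freeResolvent z f) g = pairing f (freeResolvent z g) := by
  have hd := denseRange_helmholtz hz
  refine hd.induction_on₂ (p := fun f g => pairing (freeResolvent z f) g =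
    pairing f (freeResolvent z g)) ?_ ?_ f g
  · exact isClosed_eq (continuous_pairing (by fun_prop) (by fun_prop))
      (continuous_pairing (by fun_prop) (by fun_prop))
  · intro φ ψ
    simp only [LinearMap.comp_apply, freeResolvent_helmholtz hz]
    rw [pairing_testToL2, pairing_testToL2]
    have h1 : ∫ x, (testToL2 φ) x * (helmholtz z ψ).1 x = ∫ x, φ.1 x * (helmholtz z ψ).1 x := by
      refine integral_congr_ae ?_
      filter_upwards [coeFn_testToL2 φ] with x hx
      rw [hx]
    rw [h1, integral_helmholtz_symm]
    refine integral_congr_ae ?_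
    filter_upwards [coeFn_testToL2 (helmholtz z φ)] with x hx
    rw [hx]

theorem pairing_helmholtz_iff {z : ℂ} (hz : 0 < z.im) (u f : L2) :
    freeResolvent z f = u ↔
      ∀ φ : testSpace, pairing u (testToL2 (helmholtz z φ)) = pairing f (testToL2 φ) := by
  constructor
  · rintro rfl φ
    rw [pairing_freeResolvent hz, freeResolvent_helmholtz hz]
  · intro h
    rw [← sub_eq_zero]
    set v := freeResolvent z f - u with hv
    have h1 : (v : ℝ → ℂ) =ᵐ[volume] 0 := by
      refine eq_zero_of_weak_helmholtz hz (Lp.memLp v) fun φ => ?_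
      rw [← pairing_testToL2, hv, pairing_sub_left, h, pairing_freeResolvent hz,
        freeResolvent_helmholtz hz, sub_self]
    exact (Lp.eq_zero_iff_ae_eq_zero).2 h1

/-! ### The resolvent for large imaginary part -/

/-- `U` is measurable and bounded by `B` everywhere. -/
structure IsBoundedPotential (U : ℝ → ℂ) (B : ℝ) : Prop where
  aestronglyMeasurable : AEStronglyMeasurable U volume
  bound : ∀ x, ‖U x‖ ≤ B

theorem IsBoundedPotential.nonneg {U : ℝ → ℂ} {B : ℝ} (hU : IsBoundedPotential U B) : 0 ≤ B :=
  (norm_nonneg _).trans (hU.bound 0)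

theorem IsBoundedPotential.memLp_mul {U : ℝ → ℂ} {B : ℝ} (hU : IsBoundedPotential U B) {f : ℝ → ℂ}
    (hf : MemLp f 2 volume) : MemLp (fun x => U x * f x) 2 volume :=
  hf.of_le_mul (hU.aestronglyMeasurable.mul hf.1) (c := B) (Eventually.of_forall fun x => by
    rw [norm_mul]; gcongr; exact hU.bound x)

/-- Multiplication by a bounded measurable function on `L²(ℝ)`. -/
def mulL2 {U : ℝ → ℂ} {B : ℝ} (hU : IsBoundedPotential U B) : L2 →L[ℂ] L2 :=
  LinearMap.mkContinuous
    { toFun := fun f => (hU.memLp_mul (Lp.memLp f)).toLp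
      map_add' := fun f g => by
        rw [← MemLp.toLp_add, MemLp.toLp_eq_toLp_iff]
        filter_upwards [Lp.coeFn_add f g] with x hx
        rw [hx, Pi.add_apply, Pi.add_apply, mul_add]
      map_smul' := fun c f => by
        rw [RingHom.id_apply, ← MemLp.toLp_const_smul, MemLp.toLp_eq_toLp_iff]
        filter_upwards [Lp.coeFn_smul c f] with x hx
        rw [hx, Pi.smul_apply, Pi.smul_apply, smul_eq_mul, smul_eq_mul]
        ring } B fun f => by
    refine Lp.norm_le_mul_norm_of_ae_le_mul ?_
    filter_upwards [(hU.memLp_mul (Lp.memLp f)).coeFn_toLp] with x hx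
    refine (congrArg norm hx).le.trans ?_
    rw [norm_mul]
    gcongr
    exact hU.bound x

theorem coeFn_mulL2 {U : ℝ → ℂ} {B : ℝ} (hU : IsBoundedPotential U B) (f : L2) :
    mulL2 hU f =ᵐ[volume] fun x => U x * f x :=
  (hU.memLp_mul (Lp.memLp f)).coeFn_toLp

theorem norm_mulL2_le {U : ℝ → ℂ} {B : ℝ} (hU : IsBoundedPotential U B) : ‖mulL2 hU‖ ≤ B :=
  LinearMap.mkContinuous_norm_le _ hU.nonneg _

/-- The equation of the resolvent with potential is the free one with a modified right side. -/
theorem schrodingerEq_iff {U : ℝ → ℂ} {B : ℝ} (hU : IsBoundedPotential U B) {z : ℂ}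
    (hz : 0 < z.im) (u f : L2) :
    SchrodingerEq U u (f + z ^ 2 • u) ↔ freeResolvent z (f - mulL2 hU u) = u := by
  rw [pairing_helmholtz_iff hz]
  have key : ∀ φ : testSpace, (∫ x, u x * (-(iteratedDeriv 2 φ.1 x) + U x * φ.1 x) =
      ∫ x, (f + z ^ 2 • u : L2) x * φ.1 x) ↔
      pairing u (testToL2 (helmholtz z φ)) = pairing (f - mulL2 hU u) (testToL2 φ) := by
    intro φ
    have hu := Lp.memLp u
    have i1 := integrable_mul_test hu φ.2.deriv.deriv
    have i2 := integrable_mul_test hu φ.2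
    have i3 := integrable_mul_test (Lp.memLp f) φ.2
    have i4 := integrable_mul_test (hU.memLp_mul hu) φ.2
    have e1 : ∫ x, u x * (-(iteratedDeriv 2 φ.1 x) + U x * φ.1 x) =
        -(∫ x, u x * deriv (deriv φ.1) x) + ∫ x, U x * u x * φ.1 x := by
      rw [← integral_neg, ← integral_add (f := fun x => -(u x * deriv (deriv φ.1) x)) i1.neg i4,
        iteratedDeriv_two]
      congr 1; ext x; ring
    have e2 : ∫ x, (f + z ^ 2 • u : L2) x * φ.1 x =
        (∫ x, f x * φ.1 x) + z ^ 2 * ∫ x, u x * φ.1 x := by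
      rw [← integral_const_mul, ← integral_add i3 (i2.const_mul _)]
      refine integral_congr_ae ?_
      filter_upwards [Lp.coeFn_add f (z ^ 2 • u), Lp.coeFn_smul (z ^ 2) u] with x h1 h2
      rw [h1, Pi.add_apply, h2, Pi.smul_apply, smul_eq_mul]
      ring
    have e3 : pairing u (testToL2 (helmholtz z φ)) =
        -(∫ x, u x * deriv (deriv φ.1) x) - z ^ 2 * ∫ x, u x * φ.1 x := by
      rw [pairing_testToL2, ← integral_neg, ← integral_const_mul,
        ← integral_sub (f := fun x => -(u x * deriv (deriv φ.1) x)) i1.neg (i2.const_mul _)]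
      congr 1; ext x; rw [helmholtz_apply]; ring
    have e4 : pairing (f - mulL2 hU u) (testToL2 φ) =
        (∫ x, f x * φ.1 x) - ∫ x, U x * u x * φ.1 x := by
      rw [pairing_testToL2, ← integral_sub i3 i4]
      refine integral_congr_ae ?_
      filter_upwards [Lp.coeFn_sub f (mulL2 hU u), coeFn_mulL2 hU u] with x h1 h2
      rw [h1, Pi.sub_apply, h2, sub_mul]
    rw [e1, e2, e3, e4]
    constructor <;> intro h <;> linear_combination h
  constructor
  · intro h φ
    exact (key φ).1 (h φ.1 φ.2.contDiff φ.2.compact)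
  · intro h φ h1 h2
    exact (key ⟨φ, ⟨h1, h2⟩⟩).2 (h _)

/-- The resolvent exists for large `Im z`, by a Neumann series in the free resolvent. -/
theorem exists_isResolvent {U : ℝ → ℂ} {B : ℝ} (hU : IsBoundedPotential U B) {z : ℂ}
    (hz : 0 < z.im) (hB : B < ‖z‖ * z.im) : ∃ T : L2 →L[ℂ] L2, IsResolvent U z T := by
  have hpos : 0 < ‖z‖ * z.im := hU.nonneg.trans_lt hB
  set K : L2 →L[ℂ] L2 := freeResolvent z * mulL2 hU with hK
  have hKn : ‖-K‖ < 1 := by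
    rw [norm_neg]
    calc ‖K‖ ≤ ‖freeResolvent z‖ * ‖mulL2 hU‖ := norm_mul_le _ _
      _ ≤ (‖z‖ * z.im)⁻¹ * B := by
        gcongr
        exacts [norm_freeResolvent_le hz, norm_mulL2_le hU]
      _ < 1 := by rwa [inv_mul_eq_div, div_lt_one hpos]
  -- the Neumann series inverts `1 + K`
  have hunit : IsUnit (1 - -K) := isUnit_one_sub_of_norm_lt_one hKn
  obtain ⟨w, hw⟩ := hunit
  rw [sub_neg_eq_add] at hw
  refine ⟨(↑w⁻¹ : L2 →L[ℂ] L2) * freeResolvent z, fun u f => ?_⟩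
  rw [schrodingerEq_iff hU hz]
  have h1 : ∀ v : L2, (w : L2 →L[ℂ] L2) v = v + freeResolvent z (mulL2 hU v) := by
    intro v
    rw [hw]
    rfl
  have h2 : ∀ v : L2, (↑w⁻¹ : L2 →L[ℂ] L2) ((w : L2 →L[ℂ] L2) v) = v := fun v => by
    rw [← mul_apply_eq_comp, Units.inv_mul, one_apply_eq_self]
  have h3 : ∀ v : L2, (w : L2 →L[ℂ] L2) ((↑w⁻¹ : L2 →L[ℂ] L2) v) = v := fun v => by
    rw [← mul_apply_eq_comp, Units.mul_inv, one_apply_eq_self]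
  rw [map_sub, sub_eq_iff_eq_add, ← h1, mul_apply_eq_comp]
  constructor
  · rintro rfl
    rw [h3]
  · intro h
    rw [h, h2]

theorem IsResolvent.eq {U : ℝ → ℂ} {z : ℂ} {T T' : L2 →L[ℂ] L2} (h : IsResolvent U z T)
    (h' : IsResolvent U z T') : T = T' := by
  ext1 f
  exact ((h' _ _).2 ((h _ _).1 rfl)).symm

end

section


/-! ### Volterra operators on an interval -/

theorem intervalIntegrable_L2 (f : L2) (x y : ℝ) : IntervalIntegrable f volume x y :=
  (((Lp.memLp f).locallyIntegrable (by norm_num)).integrableOn_isCompact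
    isCompact_uIcc).intervalIntegrable

theorem memLp_indicator_Icc {r : ℝ} {p : ℝ → ℂ} (hp : ContinuousOn p (Icc (-r) r)) :
    MemLp ((Icc (-r) r).indicator p) 2 volume := by
  rw [memLp_indicator_iff_restrict measurableSet_Icc]
  obtain ⟨C, hC⟩ := isCompact_Icc.exists_bound_of_continuousOn hp
  refine MemLp.of_bound (hp.aestronglyMeasurable measurableSet_Icc) C ?_
  exact (ae_restrict_iff' measurableSet_Icc).2 (Eventually.of_forall hC)

/-- The element `𝟙_[-r,r] p` of `L²(ℝ)`, for a function `p` continuous on `[-r, r]`. -/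
def truncL2 {r : ℝ} {p : ℝ → ℂ} (hp : ContinuousOn p (Icc (-r) r)) : L2 :=
  (memLp_indicator_Icc hp).toLp

theorem coeFn_truncL2 {r : ℝ} {p : ℝ → ℂ} (hp : ContinuousOn p (Icc (-r) r)) :
    truncL2 hp =ᵐ[volume] (Icc (-r) r).indicator p :=
  MemLp.coeFn_toLp _

theorem cutoff_eq_self {r : ℝ} {f : L2} {g : ℝ → ℂ} (h : f =ᵐ[volume] (Icc (-r) r).indicator g) :
    cutoff r f = f := by
  apply Lp.ext
  filter_upwards [coeFn_cutoffFun r f, h] with x h1 h2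
  refine h1.trans ?_
  by_cases hx : x ∈ Icc (-r) r
  · rw [indicator_of_mem hx]
  · rw [indicator_of_notMem hx, h2, indicator_of_notMem hx]

theorem coeFn_cutoff (r : ℝ) (f : L2) : cutoff r f =ᵐ[volume] (Icc (-r) r).indicator f :=
  coeFn_cutoffFun r f

/-- The functional `f ↦ ∫ f g` on `L²(ℝ)`. -/
def pairingL (g : L2) : L2 →L[ℂ] ℂ := innerSL ℂ (conjL2 g)

theorem pairingL_apply (g f : L2) : pairingL g f = pairing g f := (pairing_eq_inner g f).symm

theorem pairing_truncL2 {r : ℝ} (hr : 0 ≤ r) {p : ℝ → ℂ} (hp : ContinuousOn p (Icc (-r) r))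
    (f : L2) : pairing (truncL2 hp) f = ∫ y in (-r)..r, p y * f y := by
  rw [intervalIntegral.integral_of_le (by linarith), ← integral_Icc_eq_integral_Ioc,
    ← integral_indicator measurableSet_Icc]
  refine integral_congr_ae ?_
  filter_upwards [coeFn_truncL2 hp] with x hx
  rw [hx]
  by_cases h : x ∈ Icc (-r) r
  · rw [indicator_of_mem h, indicator_of_mem h]
  · rw [indicator_of_notMem h, indicator_of_notMem h, zero_mul]

theorem continuousOn_one (r : ℝ) : ContinuousOn (fun _ : ℝ => (1 : ℂ)) (Icc (-r) r) :=
  continuousOn_const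

/-- The Cauchy–Schwarz inequality on `[-r, r]`. -/
theorem integral_norm_le {r : ℝ} (hr : 0 ≤ r) (f : L2) :
    ∫ y in (-r)..r, ‖f y‖ ≤ ‖truncL2 (continuousOn_one r)‖ * ‖f‖ := by
  have hf : MemLp (fun x => ((‖f x‖ : ℝ) : ℂ)) 2 volume := (Lp.memLp f).norm.ofReal
  have h1 : ‖hf.toLp‖ = ‖f‖ := by
    rw [Lp.norm_toLp, Lp.norm_def]
    congr 1
    refine eLpNorm_congr_norm_ae (Eventually.of_forall fun x => ?_)
    simp
  have h2 := norm_pairing_le (truncL2 (continuousOn_one r)) hf.toLp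
  rw [pairing_truncL2 hr, h1] at h2
  have h3 : ∫ y in (-r)..r, (1 : ℂ) * (MemLp.toLp _ hf : L2) y = ((∫ y in (-r)..r, ‖f y‖ : ℝ) : ℂ) := by
    rw [← intervalIntegral.integral_ofReal]
    refine intervalIntegral.integral_congr_ae ?_
    filter_upwards [hf.coeFn_toLp] with x hx _
    rw [hx, one_mul]
  rw [h3, Complex.norm_real] at h2
  exact (Real.le_norm_self _).trans h2

/-- The solution `x ↦ ∫_{-r}^x (x - y) f(y) dy` of `u'' = f` with zero initial data at `-r`. -/
def volterraFun (r : ℝ) (f : ℝ → ℂ) (x : ℝ) : ℂ := ∫ y in (-r)..x, ((x : ℂ) - y) * f y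

theorem isPrim_integral {r : ℝ} (hr : 0 ≤ r) {f : ℝ → ℂ}
    (hf : IntervalIntegrable f volume (-r) r) :
    IsPrim (fun x => ∫ y in (-r)..x, f y) f (-r) r :=
  ⟨by linarith, hf, fun x _ => by rw [intervalIntegral.integral_same, zero_add]⟩

theorem isPrim_volterraFun {r : ℝ} (hr : 0 ≤ r) {f : ℝ → ℂ}
    (hf : IntervalIntegrable f volume (-r) r) :
    IsPrim (volterraFun r f) (fun x => ∫ y in (-r)..x, f y) (-r) r := by
  have h1 := isPrim_integral hr hf
  have hid : IsPrim (fun x : ℝ => (x : ℂ)) (fun _ => 1) (-r) r :=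
    IsPrim.of_hasDerivAt (by linarith) (fun x => Complex.ofRealCLM.hasDerivAt (x := x))
      continuous_const
  have h2 := hid.mul h1
  have hcont : IntervalIntegrable (fun x => ∫ y in (-r)..x, f y) volume (-r) r := by
    refine ContinuousOn.intervalIntegrable ?_
    rw [uIcc_of_le (by linarith)]
    exact h1.continuousOn
  refine ⟨by linarith, hcont, fun x hx => ?_⟩
  have hmem : (-r) ∈ Icc (-r) r := left_mem_Icc.2 (by linarith)
  have hfx : IntervalIntegrable f volume (-r) x := h1.integrable_sub hmem hx
  have hfy : IntervalIntegrable (fun y : ℝ => (y : ℂ) * f y) volume (-r) x :=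
    hfx.continuousOn_mul Complex.continuous_ofReal.continuousOn
  have hcx : IntervalIntegrable (fun x => ∫ y in (-r)..x, f y) volume (-r) x :=
    hcont.mono_set (by
      rw [uIcc_of_le (by linarith : -r ≤ r)]
      exact uIcc_subset_Icc hmem hx)
  have e1 : volterraFun r f x = (x : ℂ) * (∫ y in (-r)..x, f y) - ∫ y in (-r)..x, (y : ℂ) * f y := by
    unfold volterraFun
    rw [← intervalIntegral.integral_const_mul, ← intervalIntegral.integral_sub
      (hfx.const_mul _) hfy]
    congr 1; ext y; ring
  have e2 := h2.integral_eq hmem hx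
  simp only [one_mul, intervalIntegral.integral_same, mul_zero, sub_zero] at e2
  rw [intervalIntegral.integral_add hcx hfy] at e2
  have e3 : volterraFun r f (-r) = 0 := by
    unfold volterraFun
    rw [intervalIntegral.integral_same]
  rw [e1, e3, ← e2]
  ring

theorem norm_volterraFun_le {r : ℝ} {f : ℝ → ℂ} {g : ℝ → ℝ} {x : ℝ}
    (hx : x ∈ Icc (-r) r) (hfg : ∀ᵐ y, y ∈ Ioc (-r) x → ‖f y‖ ≤ g y)
    (hg : IntervalIntegrable g volume (-r) x) :
    ‖volterraFun r f x‖ ≤ 2 * r * ∫ y in (-r)..x, g y := by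
  unfold volterraFun
  rw [← intervalIntegral.integral_const_mul]
  refine intervalIntegral.norm_integral_le_of_norm_le hx.1 ?_ (hg.const_mul _)
  filter_upwards [hfg] with y hy hy'
  rw [norm_mul, ← Complex.ofReal_sub, Complex.norm_real, Real.norm_of_nonneg (by linarith [hy'.2])]
  have h1 : x - y ≤ 2 * r := by linarith [hx.2, hy'.1]
  have h2 : 0 ≤ x - y := by linarith [hy'.2]
  gcongr
  · linarith
  · exact hy hy'

theorem volterraFun_congr {r : ℝ} {f g : ℝ → ℂ} {x : ℝ} (hx : x ∈ Icc (-r) r)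
    (h : ∀ᵐ y, y ∈ Icc (-r) r → f y = g y) : volterraFun r f x = volterraFun r g x := by
  refine intervalIntegral.integral_congr_ae ?_
  filter_upwards [h] with y hy hy'
  rw [uIoc_of_le hx.1] at hy'
  rw [hy ⟨hy'.1.le, hy'.2.trans hx.2⟩]

theorem continuousOn_volterraFun (r : ℝ) (f : L2) :
    ContinuousOn (volterraFun r f) (Icc (-r) r) := by
  rcases le_or_gt 0 r with hr | hr
  · exact (isPrim_volterraFun hr (intervalIntegrable_L2 f _ _)).continuousOn
  · rw [Icc_eq_empty (by linarith)]
    exact continuousOn_empty _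

/-- The Volterra operator with kernel `x - y` on `[-r, r]`, as a bounded operator on `L²(ℝ)`. -/
def volterra (r : ℝ) : L2 →L[ℂ] L2 :=
  LinearMap.mkContinuous
    { toFun := fun f => truncL2 (continuousOn_volterraFun r f)
      map_add' := fun f g => by
        apply Lp.ext
        filter_upwards [Lp.coeFn_add (truncL2 (continuousOn_volterraFun r f))
          (truncL2 (continuousOn_volterraFun r g)), coeFn_truncL2 (continuousOn_volterraFun r f),
          coeFn_truncL2 (continuousOn_volterraFun r g),
          coeFn_truncL2 (continuousOn_volterraFun r (f + g))] with x h1 h2 h3 h4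
        rw [h1, Pi.add_apply, h2, h3, h4]
        by_cases hx : x ∈ Icc (-r) r
        · rw [indicator_of_mem hx, indicator_of_mem hx, indicator_of_mem hx]
          rw [volterraFun_congr (g := fun y => f y + g y) hx ((Lp.coeFn_add f g).mono
            fun y hy _ => hy)]
          unfold volterraFun
          have hc : ContinuousOn (fun y : ℝ => (x : ℂ) - y) (uIcc (-r) x) := by fun_prop
          rw [← intervalIntegral.integral_add
            ((intervalIntegrable_L2 f _ _).continuousOn_mul hc)
            ((intervalIntegrable_L2 g _ _).continuousOn_mul hc)]
          congr 1; ext y; rw [mul_add]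
        · simp only [indicator_of_notMem hx, add_zero]
      map_smul' := fun c f => by
        apply Lp.ext
        filter_upwards [Lp.coeFn_smul c (truncL2 (continuousOn_volterraFun r f)),
          coeFn_truncL2 (continuousOn_volterraFun r f),
          coeFn_truncL2 (continuousOn_volterraFun r (c • f))] with x h1 h2 h4
        rw [RingHom.id_apply, h1, Pi.smul_apply, h2, h4]
        by_cases hx : x ∈ Icc (-r) r
        · rw [indicator_of_mem hx, indicator_of_mem hx]
          rw [volterraFun_congr (g := fun y => c * f y) hx ((Lp.coeFn_smul c f).mono
            fun y hy _ => hy)]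
          unfold volterraFun
          rw [smul_eq_mul, ← intervalIntegral.integral_const_mul]
          congr 1; ext y; rw [mul_left_comm]
        · simp only [indicator_of_notMem hx, smul_zero] }
    (2 * |r| * ‖truncL2 (continuousOn_one r)‖ * ‖truncL2 (continuousOn_one r)‖) fun f => by
      have h : ‖truncL2 (continuousOn_volterraFun r f)‖ ≤
          (2 * |r| * (‖truncL2 (continuousOn_one r)‖ * ‖f‖)) * ‖truncL2 (continuousOn_one r)‖ := by
        refine Lp.norm_le_mul_norm_of_ae_le_mul ?_
        filter_upwards [coeFn_truncL2 (continuousOn_one r),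
          coeFn_truncL2 (continuousOn_volterraFun r f)] with x h1 h2
        rw [h1, h2]
        by_cases hx : x ∈ Icc (-r) r
        · have hr : 0 ≤ r := by linarith [hx.1, hx.2]
          rw [indicator_of_mem hx, indicator_of_mem hx, norm_one, mul_one, abs_of_nonneg hr]
          refine (norm_volterraFun_le hx (g := fun y => ‖f y‖)
            (Eventually.of_forall fun _ _ => le_rfl) (intervalIntegrable_L2 f _ _).norm).trans ?_
          gcongr
          refine le_trans ?_ (integral_norm_le hr f)
          exact intervalIntegral.integral_mono_interval le_rfl hx.1 hx.2
            (Eventually.of_forall fun y => norm_nonneg _) (intervalIntegrable_L2 f _ _).norm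
        · simp [indicator_of_notMem hx]
      refine h.trans (le_of_eq ?_)
      ring

theorem coeFn_volterra (r : ℝ) (f : L2) :
    volterra r f =ᵐ[volume] (Icc (-r) r).indicator (volterraFun r f) :=
  coeFn_truncL2 (continuousOn_volterraFun r f)

theorem volterra_congr {r : ℝ} {f g : L2} (h : ∀ᵐ y, y ∈ Icc (-r) r → f y = g y) :
    volterra r f = volterra r g := by
  apply Lp.ext
  filter_upwards [coeFn_volterra r f, coeFn_volterra r g] with x h1 h2
  rw [h1, h2]
  by_cases hx : x ∈ Icc (-r) r
  · rw [indicator_of_mem hx, indicator_of_mem hx, volterraFun_congr hx h]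
  · rw [indicator_of_notMem hx, indicator_of_notMem hx]

variable {U : ℝ → ℂ} {B : ℝ}

/-- Multiplication by `U - z²` on `L²(ℝ)`. -/
def mulSub (hU : IsBoundedPotential U B) (z : ℂ) : L2 →L[ℂ] L2 := mulL2 hU - z ^ 2 • 1

theorem coeFn_mulSub (hU : IsBoundedPotential U B) (z : ℂ) (f : L2) :
    mulSub hU z f =ᵐ[volume] fun x => (U x - z ^ 2) * f x := by
  have h : mulSub hU z f = mulL2 hU f - z ^ 2 • f := rfl
  rw [h]
  filter_upwards [Lp.coeFn_sub (mulL2 hU f) (z ^ 2 • f), Lp.coeFn_smul (z ^ 2) f,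
    coeFn_mulL2 hU f] with x h1 h2 h3
  rw [h1, Pi.sub_apply, h2, h3, Pi.smul_apply, smul_eq_mul]
  ring

theorem norm_mulSub_apply_le (hU : IsBoundedPotential U B) (z : ℂ) (f : L2) :
    ∀ᵐ x, ‖mulSub hU z f x‖ ≤ (B + ‖z‖ ^ 2) * ‖f x‖ := by
  filter_upwards [coeFn_mulSub hU z f] with x hx
  rw [hx, norm_mul]
  gcongr
  refine (norm_sub_le _ _).trans ?_
  rw [norm_pow]
  gcongr
  exact hU.bound x

/-- The operator `A` for which `u = g + A u` is the integral form of `u'' = (U - z²) u` on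
`[-r, r]`. -/
def volterraPot (hU : IsBoundedPotential U B) (r : ℝ) (z : ℂ) : L2 →L[ℂ] L2 :=
  volterra r * mulSub hU z

/-- Iterated Volterra operators decay factorially. -/
theorem norm_volterraPot_pow_apply_le (hU : IsBoundedPotential U B) {r : ℝ} (hr : 0 ≤ r) (z : ℂ)
    (n : ℕ) (f : L2) : ∀ᵐ x, ‖(volterraPot hU r z ^ (n + 1)) f x‖ ≤
      (Icc (-r) r).indicator (fun x => (2 * r * (B + ‖z‖ ^ 2)) ^ (n + 1) *
        (‖truncL2 (continuousOn_one r)‖ * ‖f‖) * ((x + r) ^ n / n.factorial)) x := by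
  have hB := hU.nonneg
  set c := ‖truncL2 (continuousOn_one r)‖ * ‖f‖ with hc
  set b := B + ‖z‖ ^ 2 with hb
  have hb0 : 0 ≤ b := by positivity
  -- one application of the operator, given a bound of the argument
  have step : ∀ (h : L2) (g G : ℝ → ℝ), (∀ᵐ y, y ∈ Icc (-r) r → ‖h y‖ ≤ g y) →
      IntervalIntegrable g volume (-r) r → (∀ x ∈ Icc (-r) r, ∫ y in (-r)..x, g y ≤ G x) →
      ∀ᵐ x, ‖volterraPot hU r z h x‖ ≤ (Icc (-r) r).indicator (fun x => 2 * r * b * G x) x := by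
    intro h g G hg hgi hG
    filter_upwards [coeFn_volterra r (mulSub hU z h)] with x hx
    have : volterraPot hU r z h x = volterra r (mulSub hU z h) x := rfl
    rw [this, hx]
    by_cases hx' : x ∈ Icc (-r) r
    · rw [indicator_of_mem hx', indicator_of_mem hx']
      have hgx : IntervalIntegrable g volume (-r) x := hgi.mono_set (by
        rw [uIcc_of_le (by linarith : -r ≤ r), uIcc_of_le hx'.1]
        exact Icc_subset_Icc_right hx'.2)
      refine (norm_volterraFun_le hx' (g := fun y => b * g y) ?_ (hgx.const_mul _)).trans ?_
      · filter_upwards [hg, norm_mulSub_apply_le hU z h] with y h1 h2 h3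
        refine h2.trans ?_
        gcongr
        exact h1 ⟨h3.1.le, h3.2.trans hx'.2⟩
      · rw [intervalIntegral.integral_const_mul, ← mul_assoc]
        gcongr
        exact hG x hx'
    · simp [indicator_of_notMem hx']
  induction n with
  | zero =>
    have h := step f (fun y => ‖f y‖) (fun _ => c) (Eventually.of_forall fun _ _ => le_rfl)
      (intervalIntegrable_L2 f _ _).norm (fun x hx => by
        refine le_trans ?_ (integral_norm_le hr f)
        exact intervalIntegral.integral_mono_interval le_rfl hx.1 hx.2
          (Eventually.of_forall fun y => norm_nonneg _) (intervalIntegrable_L2 f _ _).norm)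
    filter_upwards [h] with x hx
    simpa using hx
  | succ n ih =>
    have h := step ((volterraPot hU r z ^ (n + 1)) f)
      (fun y => (2 * r * b) ^ (n + 1) * c * ((y + r) ^ n / n.factorial))
      (fun x => (2 * r * b) ^ (n + 1) * c * ((x + r) ^ (n + 1) / (n + 1).factorial))
      (by
        filter_upwards [ih] with y h1 h2
        rwa [indicator_of_mem h2] at h1)
      (Continuous.intervalIntegrable (by fun_prop) _ _)
      (fun x hx => by
        rw [intervalIntegral.integral_const_mul, intervalIntegral.integral_div,
          intervalIntegral.integral_comp_add_right (fun y => y ^ n), integral_pow,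
          Nat.factorial_succ]
        refine le_of_eq ?_
        push_cast
        rw [neg_add_cancel, zero_pow (by omega), sub_zero, div_div])
    rw [pow_succ', mul_apply_eq_comp]
    filter_upwards [h] with x hx
    refine hx.trans (le_of_eq ?_)
    congr 1
    ext y
    ring

theorem isUnit_one_sub_volterraPot (hU : IsBoundedPotential U B) {r : ℝ} (hr : 0 ≤ r) (z : ℂ) :
    IsUnit (1 - volterraPot hU r z) := by
  set A := volterraPot hU r z with hA
  set e := ‖truncL2 (continuousOn_one r)‖ with he
  set K := 2 * r * (B + ‖z‖ ^ 2) with hK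
  have hB := hU.nonneg
  have hK0 : 0 ≤ K := by positivity
  have hle : ∀ n, ‖A ^ (n + 1)‖ ≤ K * e * e * ((K * (2 * r)) ^ n / n.factorial) := by
    intro n
    refine ContinuousLinearMap.opNorm_le_bound _ (by positivity) fun f => ?_
    have h : ‖(A ^ (n + 1)) f‖ ≤ (K ^ (n + 1) * (e * ‖f‖) * ((2 * r) ^ n / n.factorial)) *
        ‖truncL2 (continuousOn_one r)‖ := by
      refine Lp.norm_le_mul_norm_of_ae_le_mul ?_
      filter_upwards [norm_volterraPot_pow_apply_le hU hr z n f,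
        coeFn_truncL2 (continuousOn_one r)] with x h1 h2
      refine h1.trans ?_
      rw [h2]
      by_cases hx : x ∈ Icc (-r) r
      · rw [indicator_of_mem hx, indicator_of_mem hx, norm_one, mul_one]
        have h3 : 0 ≤ x + r := by linarith [hx.1]
        have h4 : x + r ≤ 2 * r := by linarith [hx.2]
        gcongr
      · simp [indicator_of_notMem hx]
    refine h.trans (le_of_eq ?_)
    rw [← he]
    ring_nf
  have hlim : Tendsto (fun n : ℕ => K * e * e * ((K * (2 * r)) ^ n / n.factorial)) atTop (𝓝 0) := by
    simpa using (FloorSemiring.tendsto_pow_div_factorial_atTop (K * (2 * r))).const_mul (K * e * e)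
  obtain ⟨n, hn⟩ := (hlim.eventually (gt_mem_nhds one_pos)).exists
  have h1 : IsUnit (1 - A ^ (n + 1)) := isUnit_one_sub_of_norm_lt_one ((hle n).trans_lt hn)
  rw [← mul_neg_geom_sum] at h1
  have hcomm : Commute (1 - A) (∑ i ∈ Finset.range (n + 1), A ^ i) :=
    Commute.sum_right _ _ _ fun i _ => ((Commute.one_left A).sub_left (Commute.refl A)).pow_right i
  exact (hcomm.isUnit_mul_iff.1 h1).1

/-- The inverse of `1 - A`. -/
def volterraInv (hU : IsBoundedPotential U B) (r : ℝ) (z : ℂ) : L2 →L[ℂ] L2 :=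
  Ring.inverse (1 - volterraPot hU r z)

theorem analyticAt_mulSub (hU : IsBoundedPotential U B) (z : ℂ) :
    AnalyticAt ℂ (fun z => mulSub hU z) z := by
  unfold mulSub
  fun_prop

theorem analyticAt_volterraInv (hU : IsBoundedPotential U B) {r : ℝ} (hr : 0 ≤ r) (z : ℂ) :
    AnalyticAt ℂ (fun z => volterraInv hU r z) z := by
  obtain ⟨w, hw⟩ := isUnit_one_sub_volterraPot hU hr z
  have h1 : AnalyticAt ℂ Ring.inverse (1 - volterraPot hU r z) := hw ▸ analyticAt_inverse w
  have h2 : AnalyticAt ℂ (fun z => 1 - volterraPot hU r z) z :=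
    analyticAt_const.sub (analyticAt_const.mul (analyticAt_mulSub hU z))
  exact h1.fun_comp_of_eq h2 rfl

theorem volterraInv_eq_iff (hU : IsBoundedPotential U B) {r : ℝ} (hr : 0 ≤ r) (z : ℂ) (u g : L2) :
    volterraInv hU r z g = u ↔ u = g + volterra r (mulSub hU z u) := by
  obtain ⟨w, hw⟩ := isUnit_one_sub_volterraPot hU hr z
  have h0 : volterraInv hU r z = (↑w⁻¹ : L2 →L[ℂ] L2) := by
    rw [volterraInv, ← hw, Ring.inverse_unit]
  have h1 : ∀ v : L2, (w : L2 →L[ℂ] L2) v = v - volterra r (mulSub hU z v) := by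
    intro v
    rw [hw]
    rfl
  rw [h0]
  constructor
  · rintro rfl
    have := h1 ((↑w⁻¹ : L2 →L[ℂ] L2) g)
    rw [← mul_apply_eq_comp, Units.mul_inv, one_apply_eq_self] at this
    exact eq_add_of_sub_eq this.symm
  · intro h
    have h2 := h1 u
    rw [sub_eq_of_eq_add h] at h2
    rw [← h2, ← mul_apply_eq_comp, Units.inv_mul, one_apply_eq_self]

end

section


/-! ### Outgoing solutions on an interval -/

section Outgoing

variable {U : ℝ → ℂ} {B r : ℝ} {z : ℂ}

/-- `v` solves `-v'' + U v - z² v = f` on `[-r, r]`, and `v'` is its derivative. -/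
structure IsSolution (U : ℝ → ℂ) (z : ℂ) (r : ℝ) (f v v' : ℝ → ℂ) : Prop where
  prim : IsPrim v v' (-r) r
  prim_slope : IsPrim v' (fun t => (U t - z ^ 2) * v t - f t) (-r) r

theorem continuousOn_add_const (r : ℝ) : ContinuousOn (fun x : ℝ => (x : ℂ) + r) (Icc (-r) r) := by
  fun_prop

theorem continuousOn_const_sub (r : ℝ) : ContinuousOn (fun x : ℝ => (r : ℂ) - x) (Icc (-r) r) := by
  fun_prop

/-- The function `1 - iz(x + r)` on `[-r, r]`, with the initial data of `e^{-iz(x + r)}`. -/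
def leftData (r : ℝ) (z : ℂ) : L2 :=
  truncL2 (continuousOn_one r) - (Complex.I * z) • truncL2 (continuousOn_add_const r)

/-- The restriction to `[-r, r]` of the solution of `-v'' + U v = z² v` that is outgoing on the left,
that is `v(-r) = 1` and `v'(-r) = -iz`. -/
def leftSol (hU : IsBoundedPotential U B) (r : ℝ) (z : ℂ) : L2 :=
  volterraInv hU r z (leftData r z)

/-- The functional that gives `v'(r) - iz v(r)` in terms of `v''`, for `v` with zero initial data at
`-r`. -/
def radiation (r : ℝ) (z : ℂ) : L2 →L[ℂ] ℂ :=
  pairingL (truncL2 (continuousOn_one r)) -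
    (Complex.I * z) • pairingL (truncL2 (continuousOn_const_sub r))

/-- The value `v'(r) - iz v(r)` for the solution `v` outgoing on the left; it vanishes if and only if
there is a nonzero solution outgoing on both sides. -/
def jostDet (hU : IsBoundedPotential U B) (r : ℝ) (z : ℂ) : ℂ :=
  -2 * Complex.I * z * (1 - Complex.I * z * r) + radiation r z (mulSub hU z (leftSol hU r z))

/-- The value `p'(r) - iz p(r)` for the solution `p` of `-p'' + U p - z² p = f` with zero initial
data at `-r`. -/
def defect (hU : IsBoundedPotential U B) (r : ℝ) (z : ℂ) : L2 →L[ℂ] ℂ :=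
  -(radiation r z ∘L (mulSub hU z * (volterraInv hU r z * volterra r) + 1))

theorem radiation_apply (hr : 0 ≤ r) (h : L2) :
    radiation r z h = (∫ y in (-r)..r, h y) - Complex.I * z * volterraFun r h r := by
  have h1 : radiation r z h = pairing (truncL2 (continuousOn_one r)) h -
      (Complex.I * z) * pairing (truncL2 (continuousOn_const_sub r)) h := by
    rw [← pairingL_apply, ← pairingL_apply]
    rfl
  rw [h1, pairing_truncL2 hr, pairing_truncL2 hr]
  simp only [one_mul]
  rfl

theorem leftData_ae (r : ℝ) (z : ℂ) : leftData r z =ᵐ[volume]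
    (Icc (-r) r).indicator fun x : ℝ => 1 - Complex.I * z * (x + r) := by
  filter_upwards [Lp.coeFn_sub (truncL2 (continuousOn_one r))
    ((Complex.I * z) • truncL2 (continuousOn_add_const r)),
    Lp.coeFn_smul (Complex.I * z) (truncL2 (continuousOn_add_const r)),
    coeFn_truncL2 (continuousOn_one r), coeFn_truncL2 (continuousOn_add_const r)] with x h1 h2 h3 h4
  refine h1.trans ?_
  rw [Pi.sub_apply, h2, Pi.smul_apply, h3, h4]
  by_cases hx : x ∈ Icc (-r) r
  · simp only [indicator_of_mem hx, smul_eq_mul]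
  · simp only [indicator_of_notMem hx, smul_zero, sub_zero]

theorem defect_apply (hU : IsBoundedPotential U B) (f : L2) :
    defect hU r z f = radiation r z (mulSub hU z (-(volterraInv hU r z (volterra r f))) - f) := by
  rw [map_neg, ← neg_add', map_neg]
  rfl

/-- Solutions with the outgoing condition on the left, for a source `f`. -/
theorem exists_solution (hU : IsBoundedPotential U B) (hr : 0 ≤ r) (z c : ℂ) (f : L2) :
    ∃ v v' : ℝ → ℂ, IsSolution U z r f v v' ∧ v (-r) = c ∧ v' (-r) = -(Complex.I * z * c) ∧
      v' r - Complex.I * z * v r = c * jostDet hU r z + defect hU r z f ∧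
      (c • leftSol hU r z - volterraInv hU r z (volterra r f) : L2) =ᵐ[volume]
        (Icc (-r) r).indicator v := by
  set u : L2 := c • leftSol hU r z - volterraInv hU r z (volterra r f) with hu
  have hu' : volterraInv hU r z (c • leftData r z - volterra r f) = u := by
    rw [map_sub, map_smul]
    rfl
  have hfix := (volterraInv_eq_iff hU hr z _ _).1 hu'
  set h : L2 := mulSub hU z u - f with hh
  have hfix' : u = c • leftData r z + volterra r h := by
    rw [hh, map_sub]
    nth_rw 1 [hfix]
    abel
  set v : ℝ → ℂ := fun x => c * (1 - Complex.I * z * (x + r)) + volterraFun r h x with hv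
  set v' : ℝ → ℂ := fun x => -(Complex.I * z * c) + ∫ y in (-r)..x, h y with hv'
  have huv : u =ᵐ[volume] (Icc (-r) r).indicator v := by
    have h1 := Lp.coeFn_add (c • leftData r z) (volterra r h)
    rw [← hfix'] at h1
    filter_upwards [h1, Lp.coeFn_smul c (leftData r z), leftData_ae r z, coeFn_volterra r h]
      with x h1 h2 h3 h4
    rw [h1, Pi.add_apply, h2, Pi.smul_apply, h3, h4]
    by_cases hx : x ∈ Icc (-r) r
    · simp only [indicator_of_mem hx, smul_eq_mul, hv]
    · simp only [indicator_of_notMem hx, smul_zero, add_zero]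
  have hhi := intervalIntegrable_L2 h (-r) r
  have hlin : IsPrim (fun x : ℝ => c * (1 - Complex.I * z * (x + r)))
      (fun _ => -(Complex.I * z * c)) (-r) r := by
    refine IsPrim.of_hasDerivAt (by linarith) (fun x => ?_) continuous_const
    have h1 := (((Complex.ofRealCLM.hasDerivAt (x := x)).add_const (r : ℂ)).const_mul
      (Complex.I * z)).const_sub 1 |>.const_mul c
    refine h1.congr_deriv ?_
    rw [Complex.ofRealCLM_apply, Complex.ofReal_one]
    ring
  have hconst : IsPrim (fun _ : ℝ => -(Complex.I * z * c)) (fun _ => 0) (-r) r :=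
    IsPrim.of_hasDerivAt (by linarith) (fun x => hasDerivAt_const _ _) continuous_const
  refine ⟨v, v', ⟨?_, ?_⟩, ?_, ?_, ?_, huv⟩
  · exact hlin.add (isPrim_volterraFun hr hhi)
  · refine (hconst.add (isPrim_integral hr hhi)).congr (fun _ _ => rfl) ?_
    filter_upwards [Lp.coeFn_sub (mulSub hU z u) f, coeFn_mulSub hU z u, huv] with x h1 h2 h3 hx
    rw [zero_add]
    refine Eq.symm (h1.trans ?_)
    have hx' : x ∈ Icc (-r) r := ⟨hx.1.le, hx.2⟩
    rw [Pi.sub_apply, h2, h3, indicator_of_mem hx']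
  · simp [hv, volterraFun]
  · simp [hv']
  · have h1 := radiation_apply (z := z) hr h
    have h2 : radiation r z h = c * radiation r z (mulSub hU z (leftSol hU r z)) +
        defect hU r z f := by
      rw [defect_apply, hh, hu, ← smul_eq_mul, ← map_smul, ← map_smul, ← map_add]
      congr 1
      rw [map_neg, map_sub]
      abel
    simp only [hv, hv', jostDet]
    linear_combination -h1 + h2

/-- The solution that is outgoing on the left determines a Jost solution, and the determinant is
the quantity `w - q / s` up to an elementary factor. -/
theorem exists_isJostSol (hU : IsBoundedPotential U B) {a b : ℝ} (hab : a ≤ b) (ha : -r ≤ a)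
    (hb : b ≤ r) (hU0 : ∀ x, x ∉ Icc a b → U x = 0) (s : ℂ) :
    ∃ w q, IsJostSol U s a b w q ∧
      s * w b - q b = -(Complex.exp (s * r) * jostDet hU r (s / (2 * Complex.I))) := by
  have hr : 0 ≤ r := by linarith
  obtain ⟨z, hs⟩ : ∃ z, s = 2 * Complex.I * z := ⟨s / (2 * Complex.I), by field_simp⟩
  have hz : s / (2 * Complex.I) = z := by rw [hs]; field_simp
  rw [hz]
  obtain ⟨v, v', hsol, h0, h0', hdet, -⟩ := exists_solution hU hr z 1 0
  have hprim' : IsPrim v' (fun t => (U t - z ^ 2) * v t) (-r) r := by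
    refine hsol.prim_slope.congr (fun _ _ => rfl) ?_
    filter_upwards [Lp.coeFn_zero ℂ 2 (volume : Measure ℝ)] with x hx _
    rw [hx, Pi.zero_apply, sub_zero]
  rw [map_zero, add_zero, one_mul] at hdet
  have hexp : IsPrim (fun x : ℝ => Complex.exp (Complex.I * z * (x + r)))
      (fun x : ℝ => Complex.I * z * Complex.exp (Complex.I * z * (x + r))) (-r) r := by
    refine IsPrim.of_hasDerivAt (by linarith) (fun x => ?_) (by fun_prop)
    have h1 := (((Complex.ofRealCLM.hasDerivAt (x := x)).add_const (r : ℂ)).const_mul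
      (Complex.I * z)).cexp
    refine h1.congr_deriv ?_
    rw [Complex.ofRealCLM_apply, Complex.ofRealCLM_apply, Complex.ofReal_one]
    ring
  set w : ℝ → ℂ := fun x => Complex.exp (Complex.I * z * (x + r)) * v x with hw
  set q : ℝ → ℂ := fun x => Complex.exp (Complex.I * z * (x + r)) * (v' x + Complex.I * z * v x)
    with hq
  have hwq : IsPrim w q (-r) r :=
    (hexp.mul hsol.prim).congr (fun _ _ => rfl) (ae_of_all _ fun x _ => by simp only [hq]; ring)
  have hqq : IsPrim q (fun t => s * q t + U t * w t) (-r) r := by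
    refine (hexp.mul (hprim'.add (hsol.prim.const_mul (Complex.I * z)))).congr (fun _ _ => rfl)
      (ae_of_all _ fun x _ => ?_)
    simp only [hq, hw, hs]
    linear_combination (Complex.exp (Complex.I * z * (x + r)) * z ^ 2 * v x) * Complex.I_sq
  have hw0 : w (-r) = 1 := by simp [hw, h0]
  have hq0 : q (-r) = 0 := by simp [hq, h0, h0']
  -- to the left of `a` the solution is an exponential
  have hqa : ∀ x ∈ Icc (-r) a, q x = 0 := by
    intro x hx
    have h1 : IsPrim q (fun t => s * q t + (0 : ℝ → ℂ) t) (-r) a := by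
      refine (hqq.mono le_rfl ha (hab.trans hb)).congr (fun _ _ => rfl) ?_
      filter_upwards [Measure.ae_ne volume a] with t ht ht'
      rw [hU0 t (fun h => ht (le_antisymm ht'.2 h.1)), zero_mul, Pi.zero_apply]
    rw [h1.variation_of_constants hx, hq0]
    simp
  have hwa : w a = 1 := by
    have h1 := (hwq.mono le_rfl ha (hab.trans hb)).eq a (right_mem_Icc.2 ha)
    rw [h1, hw0, intervalIntegral.integral_congr (g := fun _ => (0 : ℂ)) (fun t ht => ?_)]
    · simp
    · rw [uIcc_of_le ha] at ht
      exact hqa t ht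
  -- to the right of `b` the quantity `s w - q` is constant
  have hcons : s * w r - q r = s * w b - q b := by
    have hb' : -r ≤ b := ha.trans hab
    have h1 : IsPrim (fun x => s * w x - q x) (fun _ => 0) b r := by
      refine (((hwq.const_mul s).sub hqq).mono hb' hb le_rfl).congr (fun _ _ => rfl)
        (ae_of_all _ fun t ht => ?_)
      rw [hU0 t (fun h => absurd h.2 (not_le.2 ht.1))]
      ring
    have h2 := h1.eq r (right_mem_Icc.2 hb)
    simpa using h2
  refine ⟨w, q, ⟨hwa, hqa a (right_mem_Icc.2 ha), hwq.mono ha hab hb, hqq.mono ha hab hb⟩, ?_⟩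
  rw [← hcons, ← hdet]
  have he : Complex.exp (s * r) = Complex.exp (Complex.I * z * (r + r)) := by
    rw [hs]; ring_nf
  rw [he]
  simp only [hw, hq, hs]
  ring

end Outgoing

end

section


/-! ### Extension of outgoing solutions to the line -/

theorem IsPrim.glue {f f' : ℝ → ℂ} {a b c : ℝ} (h1 : IsPrim f f' a b) (h2 : IsPrim f f' b c) :
    IsPrim f f' a c := by
  refine ⟨h1.le.trans h2.le, h1.integrable.trans h2.integrable, fun x hx => ?_⟩
  rcases le_total x b with h | h
  · exact h1.eq x ⟨hx.1, h⟩
  · have hb : b ∈ Icc b c := left_mem_Icc.2 h2.le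
    rw [← intervalIntegral.integral_add_adjacent_intervals h1.integrable
      (h2.integrable_sub hb ⟨h, hx.2⟩), h2.integral_eq hb ⟨h, hx.2⟩,
      h1.integral_eq (left_mem_Icc.2 h1.le) (right_mem_Icc.2 h1.le)]
    ring

theorem IsTest.exists_eq_zero {φ : ℝ → ℂ} (hφ : IsTest φ) : ∃ R, ∀ x, R ≤ |x| → φ x = 0 := by
  obtain ⟨R, hR⟩ := hφ.compact.isBounded.subset_ball 0
  refine ⟨R, fun x hx => image_eq_zero_of_notMem_tsupport fun h => ?_⟩
  have := hR h
  rw [Metric.mem_ball, dist_zero_right, Real.norm_eq_abs] at this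
  linarith

theorem IsTest.isPrim {φ : ℝ → ℂ} (hφ : IsTest φ) {a b : ℝ} (hab : a ≤ b) :
    IsPrim φ (_root_.deriv φ) a b :=
  IsPrim.of_hasDerivAt hab (fun _ => hφ.differentiable.differentiableAt.hasDerivAt)
    hφ.deriv.continuous

/-- A classical solution in `L²(ℝ)` is a weak solution. -/
theorem schrodingerEq_of_isPrim {U : ℝ → ℂ} {B : ℝ} (hU : IsBoundedPotential U B) {z : ℂ}
    {u f : L2} {v v' : ℝ → ℂ} {R₀ : ℝ} (huv : u =ᵐ[volume] v)
    (h1 : ∀ R, R₀ ≤ R → IsPrim v v' (-R) R)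
    (h2 : ∀ R, R₀ ≤ R → IsPrim v' (fun t => (U t - z ^ 2) * v t - f t) (-R) R) :
    SchrodingerEq U u (f + z ^ 2 • u) := by
  intro φ hφ1 hφ2
  have hφ : IsTest φ := ⟨hφ1, hφ2⟩
  obtain ⟨R₁, hR₁⟩ := hφ.exists_eq_zero
  obtain ⟨R₂, hR₂⟩ := hφ.deriv.exists_eq_zero
  obtain ⟨R₃, hR₃⟩ := hφ.deriv.deriv.exists_eq_zero
  set R := max (max R₀ R₁) (max R₂ R₃) with hR
  have hRpos : -R ≤ R := (h1 R ((le_max_left _ _).trans (le_max_left _ _))).le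
  have habs : ∀ x, x ∉ Ioc (-R) R → R ≤ |x| := by
    intro x hx
    rw [mem_Ioc, not_and_or, not_lt, not_le] at hx
    rcases hx with hx | hx
    · exact (by linarith : R ≤ -x).trans (neg_le_abs x)
    · exact hx.le.trans (le_abs_self x)
  have hRR : R ≤ |R| := le_abs_self R
  have hRR' : R ≤ |-R| := by rw [abs_neg]; exact hRR
  have e0 : ∀ x, R ≤ |x| → φ x = 0 := fun x hx =>
    hR₁ x (((le_max_right _ _).trans (le_max_left _ _)).trans hx)
  have e1 : ∀ x, R ≤ |x| → deriv φ x = 0 := fun x hx =>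
    hR₂ x (((le_max_left _ _).trans (le_max_right _ _)).trans hx)
  have e2 : ∀ x, R ≤ |x| → deriv (deriv φ) x = 0 := fun x hx =>
    hR₃ x (((le_max_right _ _).trans (le_max_right _ _)).trans hx)
  -- integration by parts on `[-R, R]`
  have hprim := ((h1 R ((le_max_left _ _).trans (le_max_left _ _))).mul (hφ.deriv.isPrim hRpos)).sub
    ((h2 R ((le_max_left _ _).trans (le_max_left _ _))).mul (hφ.isPrim hRpos))
  have hzero := hprim.integral_eq (left_mem_Icc.2 hRpos) (right_mem_Icc.2 hRpos)
  rw [e0 _ hRR, e0 _ hRR', e1 _ hRR, e1 _ hRR'] at hzero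
  simp only [mul_zero, sub_zero] at hzero
  have hu := Lp.memLp u
  have i1 := integrable_mul_test hu hφ.deriv.deriv
  have i2 := integrable_mul_test hu hφ
  have i3 := integrable_mul_test (Lp.memLp f) hφ
  have i4 := integrable_mul_test (hU.memLp_mul hu) hφ
  have iA : Integrable fun x => u x * (-(iteratedDeriv 2 φ x) + U x * φ x) := by
    refine (i1.neg.add i4).congr (ae_of_all _ fun x => ?_)
    rw [iteratedDeriv_two, Pi.add_apply, Pi.neg_apply]
    ring
  have iB : Integrable fun x => (f + z ^ 2 • u : L2) x * φ x := integrable_mul_test (Lp.memLp _) hφ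
  rw [← sub_eq_zero, ← integral_sub iA iB, ← neg_eq_zero, ← integral_neg, ← hzero,
    intervalIntegral.integral_eq_integral_of_support_subset]
  · refine integral_congr_ae ?_
    filter_upwards [huv, Lp.coeFn_add f (z ^ 2 • u), Lp.coeFn_smul (z ^ 2) u] with x h3 h4 h5
    rw [h4, Pi.add_apply, h5, Pi.smul_apply, smul_eq_mul, h3, iteratedDeriv_two]
    ring
  · intro x hx
    by_contra hx'
    refine hx ?_
    beta_reduce
    rw [e0 _ (habs x hx'), e1 _ (habs x hx'), e2 _ (habs x hx')]
    ring

section Extend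

variable {r : ℝ} {z : ℂ} {v v' : ℝ → ℂ}

/-- The extension of a function on `[-r, r]` by the values `c₁ e^{-iz(x+r)}` on the left and
`c₂ e^{iz(x-r)}` on the right. -/
def extendOutgoing (r : ℝ) (z c₁ c₂ : ℂ) (v : ℝ → ℂ) (x : ℝ) : ℂ :=
  if x < -r then c₁ * Complex.exp (-(Complex.I * z) * (x + r))
  else if x ≤ r then v x else c₂ * Complex.exp (Complex.I * z * (x - r))

theorem extendOutgoing_of_mem {c₁ c₂ : ℂ} {x : ℝ} (hx : x ∈ Icc (-r) r) :
    extendOutgoing r z c₁ c₂ v x = v x := by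
  rw [extendOutgoing, if_neg (not_lt.2 hx.1), if_pos hx.2]

theorem extendOutgoing_of_le (hr : 0 ≤ r) {c₁ c₂ : ℂ} (h : v (-r) = c₁) {x : ℝ} (hx : x ≤ -r) :
    extendOutgoing r z c₁ c₂ v x = c₁ * Complex.exp (-(Complex.I * z) * (x + r)) := by
  rcases hx.lt_or_eq with hx | rfl
  · rw [extendOutgoing, if_pos hx]
  · rw [extendOutgoing_of_mem (left_mem_Icc.2 (by linarith)), h]
    simp

theorem extendOutgoing_of_ge (hr : 0 ≤ r) {c₁ c₂ : ℂ} (h : v r = c₂) {x : ℝ} (hx : r ≤ x) :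
    extendOutgoing r z c₁ c₂ v x = c₂ * Complex.exp (Complex.I * z * (x - r)) := by
  rcases hx.lt_or_eq with hx | rfl
  · rw [extendOutgoing, if_neg (not_lt.2 (by linarith)), if_neg (not_le.2 hx)]
  · rw [extendOutgoing_of_mem (right_mem_Icc.2 (by linarith)), h]
    simp

theorem isPrim_const_mul_cexp (c k d : ℂ) {a b : ℝ} (hab : a ≤ b) :
    IsPrim (fun x : ℝ => c * Complex.exp (k * (x + d)))
      (fun x : ℝ => c * k * Complex.exp (k * (x + d))) a b := by
  refine IsPrim.of_hasDerivAt hab (fun x => ?_) (by fun_prop)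
  have h1 := ((((Complex.ofRealCLM.hasDerivAt (x := x)).add_const d).const_mul k).cexp).const_mul c
  refine h1.congr_deriv ?_
  rw [Complex.ofRealCLM_apply, Complex.ofRealCLM_apply, Complex.ofReal_one]
  ring

/-- Primitives on `[-r, r]` extend, if the derivative of the extension matches outside. -/
theorem IsPrim.extendOutgoing (hr : 0 ≤ r) {F : ℝ → ℂ} (hv : IsPrim v v' (-r) r)
    (hF : ∀ᵐ x, x ∈ Icc (-r) r → F x = v' x)
    (hl : ∀ᵐ x, x < -r → F x = -(Complex.I * z * v (-r)) * Complex.exp (-(Complex.I * z) * (x + r)))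
    (hg : ∀ᵐ x, r < x → F x = Complex.I * z * v r * Complex.exp (Complex.I * z * (x - r)))
    {R : ℝ} (hR : r ≤ R) : IsPrim (extendOutgoing r z (v (-r)) (v r) v) F (-R) R := by
  have h1 : IsPrim (Resonances.extendOutgoing r z (v (-r)) (v r) v) F (-R) (-r) := by
    refine (isPrim_const_mul_cexp (v (-r)) (-(Complex.I * z)) r (by linarith)).congr
      (fun x hx => extendOutgoing_of_le hr rfl hx.2) ?_
    filter_upwards [hl, Measure.ae_ne volume (-r)] with x h1 h2 h3
    rw [h1 (lt_of_le_of_ne h3.2 h2)]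
    ring
  have h2 : IsPrim (Resonances.extendOutgoing r z (v (-r)) (v r) v) F (-r) r := by
    refine hv.congr (fun x hx => extendOutgoing_of_mem hx) ?_
    filter_upwards [hF] with x h1 h2 using h1 ⟨h2.1.le, h2.2⟩
  have h3 : IsPrim (Resonances.extendOutgoing r z (v (-r)) (v r) v) F r R := by
    refine (isPrim_const_mul_cexp (v r) (Complex.I * z) (-r) hR).congr
      (fun x hx => (extendOutgoing_of_ge hr rfl hx.1).trans (by rw [sub_eq_add_neg])) ?_
    filter_upwards [hg] with x h1 h3
    rw [h1 h3.1, sub_eq_add_neg]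
    ring
  exact (h1.glue h2).glue h3

theorem memLp_extendOutgoing (hr : 0 ≤ r) (hz : 0 < z.im) (hv : ContinuousOn v (Icc (-r) r)) (c₁ c₂ : ℂ) :
    MemLp (extendOutgoing r z c₁ c₂ v) 2 volume := by
  have hleft : MemLp ((Iio (-r)).indicator fun x : ℝ =>
      c₁ * Complex.exp (-(Complex.I * z) * (x + r))) 2 volume := by
    rw [memLp_indicator_iff_restrict measurableSet_Iio, memLp_two_iff_integrable_sq_norm
      (Continuous.aestronglyMeasurable (by fun_prop))]
    have h1 : IntegrableOn (fun x : ℝ => (‖c₁‖ ^ 2 * Real.exp (2 * z.im * r)) *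
        Real.exp (2 * z.im * x)) (Iio (-r)) :=
      ((integrableOn_exp_mul_Iic (by positivity) (-r)).mono_set Iio_subset_Iic_self).const_mul _
    refine h1.congr (ae_of_all _ fun x => ?_)
    have h2 : (-(Complex.I * z) * (x + r) : ℂ).re = z.im * (x + r) := by simp
    simp only [norm_mul, Complex.norm_exp, h2, mul_pow]
    rw [← Real.exp_nat_mul, mul_assoc, ← Real.exp_add]
    congr 2
    push_cast
    ring
  have hright : MemLp ((Ioi r).indicator fun x : ℝ =>
      c₂ * Complex.exp (Complex.I * z * (x - r))) 2 volume := by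
    rw [memLp_indicator_iff_restrict measurableSet_Ioi, memLp_two_iff_integrable_sq_norm
      (Continuous.aestronglyMeasurable (by fun_prop))]
    have h1 : IntegrableOn (fun x : ℝ => (‖c₂‖ ^ 2 * Real.exp (2 * z.im * r)) *
        Real.exp (-(2 * z.im) * x)) (Ioi r) :=
      (integrableOn_exp_mul_Ioi (by linarith) r).const_mul _
    refine h1.congr (ae_of_all _ fun x => ?_)
    have h2 : (Complex.I * z * (x - r) : ℂ).re = -(z.im * (x - r)) := by simp
    simp only [norm_mul, Complex.norm_exp, h2, mul_pow]
    rw [← Real.exp_nat_mul, mul_assoc, ← Real.exp_add]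
    congr 2
    push_cast
    ring
  refine ((hleft.add (memLp_indicator_Icc hv)).add hright).ae_eq (ae_of_all _ fun x => ?_)
  simp only [Pi.add_apply, extendOutgoing]
  rcases lt_or_ge x (-r) with h1 | h1
  · rw [if_pos h1, indicator_of_mem (show x ∈ Iio (-r) from h1),
      indicator_of_notMem (fun h => absurd h.1 (not_le.2 h1)),
      indicator_of_notMem (show x ∉ Ioi r from fun h : r < x => by linarith), add_zero, add_zero]
  · rw [if_neg (not_lt.2 h1), indicator_of_notMem (show x ∉ Iio (-r) from fun h : x < -r => by linarith), zero_add]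
    rcases le_or_gt x r with h2 | h2
    · rw [if_pos h2, indicator_of_mem (show x ∈ Icc (-r) r from ⟨h1, h2⟩),
        indicator_of_notMem (show x ∉ Ioi r from fun h : r < x => by linarith), add_zero]
    · rw [if_neg (not_le.2 h2), indicator_of_notMem (fun h => absurd h.2 (not_le.2 h2)),
        indicator_of_mem (show x ∈ Ioi r from h2), zero_add]

/-- A solution that is outgoing on both sides is the restriction of the resolvent. -/
theorem IsSolution.cutoff_resolvent_eq {U : ℝ → ℂ} {B : ℝ} (hU : IsBoundedPotential U B)
    (hr : 0 ≤ r) (hU0 : ∀ x, x ∉ Icc (-r) r → U x = 0) (hz : 0 < z.im) {T : L2 →L[ℂ] L2}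
    (hT : IsResolvent U z T) {f : L2} (hf : cutoff r f = f) (hv : IsSolution U z r f v v')
    (hl : v' (-r) = -(Complex.I * z * v (-r))) (hg : v' r = Complex.I * z * v r) :
    cutoff r (T f) =ᵐ[volume] (Icc (-r) r).indicator v := by
  set u := extendOutgoing r z (v (-r)) (v r) v with hu
  set u' := extendOutgoing r z (v' (-r)) (v' r) v' with hu'
  have hmem : MemLp u 2 volume := memLp_extendOutgoing hr hz hv.prim.continuousOn _ _
  have hf0 : ∀ᵐ x, x ∉ Icc (-r) r → f x = 0 := by
    have h1 := coeFn_cutoff r f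
    rw [hf] at h1
    filter_upwards [h1] with x hx hx'
    rw [hx, indicator_of_notMem hx']
  have hTu : T f = hmem.toLp := by
    refine (hT _ _).2 (schrodingerEq_of_isPrim hU (R₀ := r) hmem.coeFn_toLp (v' := u')
      (fun R hR => ?_) (fun R hR => ?_))
    · refine hv.prim.extendOutgoing hr (ae_of_all _ fun x hx => extendOutgoing_of_mem hx)
        (ae_of_all _ fun x hx => ?_) (ae_of_all _ fun x hx => ?_) hR
      · rw [extendOutgoing_of_le hr rfl hx.le, hl]
      · rw [extendOutgoing_of_ge hr rfl hx.le, hg]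
    · refine hv.prim_slope.extendOutgoing hr (ae_of_all _ fun x hx => ?_) ?_ ?_ hR
      · rw [hu, extendOutgoing_of_mem hx]
      · filter_upwards [hf0] with x hx hx'
        have hn : x ∉ Icc (-r) r := fun h => absurd h.1 (not_le.2 hx')
        rw [hx hn, hU0 x hn, hu, extendOutgoing_of_le hr rfl hx'.le, hl]
        linear_combination (-(z ^ 2 * v (-r) *
          Complex.exp (-(Complex.I * z) * (x + r)))) * Complex.I_sq
      · filter_upwards [hf0] with x hx hx'
        have hn : x ∉ Icc (-r) r := fun h => absurd h.2 (not_le.2 hx')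
        rw [hx hn, hU0 x hn, hu, extendOutgoing_of_ge hr rfl hx'.le, hg]
        linear_combination (-(z ^ 2 * v r *
          Complex.exp (Complex.I * z * (x - r)))) * Complex.I_sq
  rw [hTu]
  filter_upwards [coeFn_cutoff r hmem.toLp, hmem.coeFn_toLp] with x h1 h2
  rw [h1]
  by_cases hx : x ∈ Icc (-r) r
  · rw [indicator_of_mem hx, indicator_of_mem hx, h2, hu, extendOutgoing_of_mem hx]
  · rw [indicator_of_notMem hx, indicator_of_notMem hx]

end Extend

end

section


/-! ### The meromorphic continuation of the resolvent -/

section Continuation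

variable {U : ℝ → ℂ} {B r : ℝ} {z : ℂ}

theorem differentiable_mulSub (hU : IsBoundedPotential U B) :
    Differentiable ℂ fun z => mulSub hU z := fun z => (analyticAt_mulSub hU z).differentiableAt

theorem differentiable_volterraInv (hU : IsBoundedPotential U B) (hr : 0 ≤ r) :
    Differentiable ℂ fun z => volterraInv hU r z :=
  fun z => (analyticAt_volterraInv hU hr z).differentiableAt

theorem differentiable_radiation (r : ℝ) : Differentiable ℂ fun z => radiation r z := by
  unfold radiation
  fun_prop

theorem differentiable_leftSol (hU : IsBoundedPotential U B) (hr : 0 ≤ r) :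
    Differentiable ℂ fun z => leftSol hU r z := by
  have h : Differentiable ℂ fun z => leftData r z := by
    unfold leftData
    fun_prop
  exact (differentiable_volterraInv hU hr).clm_apply h

theorem differentiable_jostDet (hU : IsBoundedPotential U B) (hr : 0 ≤ r) :
    Differentiable ℂ fun z => jostDet hU r z := by
  have h : Differentiable ℂ fun z => radiation r z (mulSub hU z (leftSol hU r z)) :=
    (differentiable_radiation r).clm_apply
      ((differentiable_mulSub hU).clm_apply (differentiable_leftSol hU hr))
  unfold jostDet
  fun_prop

theorem differentiable_defect (hU : IsBoundedPotential U B) (hr : 0 ≤ r) :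
    Differentiable ℂ fun z => defect hU r z := by
  have h1 : Differentiable ℂ fun z => mulSub hU z * (volterraInv hU r z * volterra r) + 1 :=
    ((differentiable_mulSub hU).mul
      ((differentiable_volterraInv hU hr).mul (differentiable_const _))).add (differentiable_const _)
  exact ((differentiable_radiation r).clm_comp h1).neg

/-- The numerator of the singular part of the resolvent on `[-r, r]`. -/
def singularPart (hU : IsBoundedPotential U B) (r : ℝ) (z : ℂ) : L2 →L[ℂ] L2 :=
  (defect hU r z).smulRight (leftSol hU r z)

theorem differentiable_singularPart (hU : IsBoundedPotential U B) (hr : 0 ≤ r) :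
    Differentiable ℂ fun z => singularPart hU r z := by
  have h : Differentiable ℂ fun z =>
      ContinuousLinearMap.smulRightL ℂ L2 L2 (defect hU r z) (leftSol hU r z) :=
    ((ContinuousLinearMap.differentiable _).comp (differentiable_defect hU hr)).clm_apply
      (differentiable_leftSol hU hr)
  exact h

/-- The resolvent on `[-r, r]`: the solution with zero initial data at `-r`, corrected by a multiple
of the solution outgoing on the left. -/
def cutResolvent (hU : IsBoundedPotential U B) (r : ℝ) (z : ℂ) : L2 →L[ℂ] L2 :=
  -(volterraInv hU r z * volterra r) - (jostDet hU r z)⁻¹ • singularPart hU r z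

theorem meromorphicAt_cutResolvent (hU : IsBoundedPotential U B) (hr : 0 ≤ r) (z : ℂ) :
    MeromorphicAt (cutResolvent hU r) z := by
  have h1 : AnalyticAt ℂ (fun z => -(volterraInv hU r z * volterra r)) z :=
    ((differentiable_volterraInv hU hr).mul (differentiable_const _)).neg.analyticAt z
  have h2 := (differentiable_singularPart hU hr).analyticAt z
  have h3 := (differentiable_jostDet hU hr).analyticAt z
  exact h1.meromorphicAt.sub (h3.meromorphicAt.inv.smul h2.meromorphicAt)

theorem analyticAt_cutResolvent (hU : IsBoundedPotential U B) (hr : 0 ≤ r)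
    (hz : jostDet hU r z ≠ 0) : AnalyticAt ℂ (cutResolvent hU r) z := by
  have h1 : AnalyticAt ℂ (fun z => -(volterraInv hU r z * volterra r)) z :=
    ((differentiable_volterraInv hU hr).mul (differentiable_const _)).neg.analyticAt z
  have h2 := (differentiable_singularPart hU hr).analyticAt z
  have h3 := (differentiable_jostDet hU hr).analyticAt z
  exact h1.sub ((h3.inv hz).smul h2)

theorem radiation_congr (hr : 0 ≤ r) {f g : L2} (h : ∀ᵐ y, y ∈ Icc (-r) r → f y = g y) :
    radiation r z f = radiation r z g := by
  rw [radiation_apply hr, radiation_apply hr,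
    volterraFun_congr (right_mem_Icc.2 (by linarith)) h]
  congr 1
  refine intervalIntegral.integral_congr_ae ?_
  filter_upwards [h] with y hy hy'
  rw [uIoc_of_le (by linarith)] at hy'
  exact hy ⟨hy'.1.le, hy'.2⟩

theorem cutoff_ae (r : ℝ) (f : L2) : ∀ᵐ y, y ∈ Icc (-r) r → cutoff r f y = f y := by
  filter_upwards [coeFn_cutoff r f] with y h1 h2
  rw [h1, indicator_of_mem h2]

theorem cutResolvent_cutoff (hU : IsBoundedPotential U B) (hr : 0 ≤ r) (f : L2) :
    cutResolvent hU r z (cutoff r f) = cutResolvent hU r z f := by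
  have h1 : volterra r (cutoff r f) = volterra r f := volterra_congr (cutoff_ae r f)
  have h2 : defect hU r z (cutoff r f) = defect hU r z f := by
    rw [defect_apply, defect_apply, h1]
    refine radiation_congr hr ?_
    set p := mulSub hU z (-(volterraInv hU r z (volterra r f)))
    filter_upwards [Lp.coeFn_sub p (cutoff r f), Lp.coeFn_sub p f, cutoff_ae r f] with y h2 h3 h4 h5
    rw [h2, h3, Pi.sub_apply, Pi.sub_apply, h4 h5]
  have h3 : ∀ g, cutResolvent hU r z g = -(volterraInv hU r z (volterra r g)) -
      (jostDet hU r z)⁻¹ • (defect hU r z g • leftSol hU r z) := fun g => rfl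
  rw [h3, h3, h1, h2]

/-- Where the determinant does not vanish, the cut-off resolvent has the expected form. -/
theorem cutResolvent_eq (hU : IsBoundedPotential U B) (hr : 0 ≤ r)
    (hU0 : ∀ x, x ∉ Icc (-r) r → U x = 0) (hz : 0 < z.im) (hdet : jostDet hU r z ≠ 0)
    {T : L2 →L[ℂ] L2} (hT : IsResolvent U z T) :
    cutResolvent hU r z = (cutoff r).comp (T.comp (cutoff r)) := by
  ext1 g
  rw [← cutResolvent_cutoff hU hr, ContinuousLinearMap.comp_apply, ContinuousLinearMap.comp_apply]
  set f := cutoff r g with hf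
  have hff : cutoff r f = f := cutoff_eq_self (coeFn_cutoff r g)
  obtain ⟨v, v', hv, h0, h0', h1, h2⟩ :=
    exists_solution hU hr z (-((jostDet hU r z)⁻¹ * defect hU r z f)) f
  have h3 : v' r - Complex.I * z * v r = 0 := by
    rw [h1]; field_simp; ring
  have h4 := hv.cutoff_resolvent_eq hU hr hU0 hz hT hff (by rw [h0', h0]) (sub_eq_zero.1 h3)
  have h5 : cutResolvent hU r z f = -((jostDet hU r z)⁻¹ * defect hU r z f) • leftSol hU r z -
      volterraInv hU r z (volterra r f) := by
    have : cutResolvent hU r z f = -(volterraInv hU r z (volterra r f)) -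
      (jostDet hU r z)⁻¹ • (defect hU r z f • leftSol hU r z) := rfl
    rw [this, smul_smul, neg_smul]
    abel
  rw [h5]
  exact Lp.ext (h2.trans h4.symm)

/-- The quantity `w(b) - q(b) / s` of the Jost solution, as a function of `s`. -/
def jostFun (hU : IsBoundedPotential U B) (r : ℝ) (s : ℂ) : ℂ :=
  -(Complex.exp (s * r) * jostDet hU r (s / (2 * Complex.I))) / s

theorem jostFun_eq (hU : IsBoundedPotential U B) {a b : ℝ} (hab : a ≤ b) (ha : -r ≤ a)
    (hb : b ≤ r) (hU0 : ∀ x, x ∉ Icc a b → U x = 0) {s : ℂ} (hs : s ≠ 0) :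
    ∃ w q, IsJostSol U s a b w q ∧ jostFun hU r s = w b - q b / s := by
  obtain ⟨w, q, h1, h2⟩ := exists_isJostSol hU hab ha hb hU0 s
  refine ⟨w, q, h1, ?_⟩
  rw [jostFun, ← h2]
  field_simp

theorem analyticAt_jostFun (hU : IsBoundedPotential U B) (hr : 0 ≤ r) {s : ℂ} (hs : s ≠ 0) :
    AnalyticAt ℂ (jostFun hU r) s := by
  have h1 : Differentiable ℂ fun s => jostDet hU r (s / (2 * Complex.I)) :=
    (differentiable_jostDet hU hr).comp (by fun_prop)
  have h2 : Differentiable ℂ fun s => -(Complex.exp (s * r) * jostDet hU r (s / (2 * Complex.I))) := by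
    fun_prop
  exact (h2.analyticAt s).div analyticAt_id hs

/-- For large `|s|` the function does not depend on the interval. -/
theorem jostFun_eq_jostFun (hU : IsBoundedPotential U B) {a b r' : ℝ} (hab : a ≤ b) (ha : -r ≤ a)
    (hb : b ≤ r) (hrr' : r ≤ r') (hU0 : ∀ x, x ∉ Icc a b → U x = 0) {s : ℂ} (hs : s ≠ 0)
    (hsB : 4 * (b - a) * B ≤ ‖s‖) : jostFun hU r s = jostFun hU r' s := by
  obtain ⟨w, q, h1, h2⟩ := jostFun_eq hU hab ha hb hU0 hs
  obtain ⟨w', q', h1', h2'⟩ := jostFun_eq (r := r') hU hab (by linarith) (by linarith) hU0 hs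
  obtain ⟨h3, h4⟩ := h1.unique h1' hU.bound hsB hs
  rw [h2, h2', h3, h4]

theorem jostDet_eq (hU : IsBoundedPotential U B) {z : ℂ} (hz : z ≠ 0) :
    jostDet hU r z = -(2 * Complex.I * z * Complex.exp (-(2 * Complex.I * z * r))) *
      jostFun hU r (2 * Complex.I * z) := by
  have h1 : 2 * Complex.I * z / (2 * Complex.I) = z := by field_simp
  rw [jostFun, h1, Complex.exp_neg]
  have := Complex.exp_ne_zero (2 * Complex.I * z * r)
  field_simp

theorem jostFun_ne_zero_of_im_pos (hU : IsBoundedPotential U B) {a b : ℝ} (hab : a ≤ b)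
    (ha : -r ≤ a) (hb : b ≤ r) (hU0 : ∀ x, x ∉ Icc a b → U x = 0) {s : ℂ} (hs : s.re < 0)
    (hsB : 4 * (b - a) * B ≤ ‖s‖) : jostFun hU r s ≠ 0 := by
  have hs0 : s ≠ 0 := fun h => by simp [h] at hs
  have hspos : 0 < ‖s‖ := norm_pos_iff.2 hs0
  obtain ⟨w, q, h1, h2⟩ := jostFun_eq hU hab ha hb hU0 hs0
  have hUi : IntervalIntegrable U volume a b := by
    rw [intervalIntegrable_iff_integrableOn_Ioc_of_le hab]
    exact Measure.integrableOn_of_bounded (by simp) hU.aestronglyMeasurable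
      (ae_of_all _ hU.bound)
  have h3 := jost_crude_bound h1 hUi hU.bound hsB hs0
  rw [max_eq_right hs.le, zero_mul, Real.exp_zero, mul_one, ← h2] at h3
  intro h
  rw [h, zero_sub, norm_neg, norm_one] at h3
  have h4 : (b - a) * B / ‖s‖ ≤ 1 / 4 := by
    rw [div_le_iff₀ hspos]; linarith
  have h5 : 0 ≤ (b - a) * B / ‖s‖ := by
    have := hU.nonneg
    have : 0 ≤ b - a := by linarith
    positivity
  have h6 : 4 * ((b - a) * B) / ‖s‖ = 4 * ((b - a) * B / ‖s‖) := by ring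
  rw [h6] at h3
  nlinarith

/-- The meromorphic continuation of the resolvent, in terms of `[-r, r]` for every `r ≥ r₀`. -/
def continuation (hU : IsBoundedPotential U B) (r₀ r : ℝ) (z : ℂ) : L2 →L[ℂ] L2 :=
  if r₀ ≤ r then cutResolvent hU r z
  else (cutoff r).comp ((cutResolvent hU r₀ z).comp (cutoff r))

theorem continuation_of_le (hU : IsBoundedPotential U B) {r₀ r : ℝ} (h : r₀ ≤ r) :
    continuation hU r₀ r = cutResolvent hU r := by
  ext1 z
  rw [continuation, if_pos h]

/-- The map `T ↦ 𝟙_[-r,r] T 𝟙_[-r,r]`. -/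
def cutoffConj (r : ℝ) : (L2 →L[ℂ] L2) →L[ℂ] (L2 →L[ℂ] L2) :=
  (ContinuousLinearMap.compL ℂ L2 L2 L2 (cutoff r)) ∘L
    ((ContinuousLinearMap.compL ℂ L2 L2 L2).flip (cutoff r))

theorem continuation_of_lt (hU : IsBoundedPotential U B) {r₀ r : ℝ} (h : r < r₀) :
    continuation hU r₀ r = fun z => cutoffConj r (cutResolvent hU r₀ z) := by
  ext1 z
  rw [continuation, if_neg (not_le.2 h)]
  rfl

theorem cutoff_comp_cutoff {r r₀ : ℝ} (h : r ≤ r₀) (f : L2) :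
    cutoff r (cutoff r₀ f) = cutoff r f := by
  apply Lp.ext
  filter_upwards [coeFn_cutoff r (cutoff r₀ f), coeFn_cutoff r f, cutoff_ae r₀ f] with x h1 h2 h3
  rw [h1, h2]
  by_cases hx : x ∈ Icc (-r) r
  · rw [indicator_of_mem hx, indicator_of_mem hx, h3 ⟨by linarith [hx.1], hx.2.trans h⟩]
  · rw [indicator_of_notMem hx, indicator_of_notMem hx]

theorem cutoff_comp_cutoff' {r r₀ : ℝ} (h : r ≤ r₀) (f : L2) :
    cutoff r₀ (cutoff r f) = cutoff r f := by
  apply Lp.ext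
  filter_upwards [coeFn_cutoff r₀ (cutoff r f), coeFn_cutoff r f] with x h1 h2
  rw [h1]
  by_cases hx : x ∈ Icc (-r₀) r₀
  · rw [indicator_of_mem hx]
  · rw [indicator_of_notMem hx, h2,
      indicator_of_notMem fun h' => hx ⟨by linarith [h'.1], h'.2.trans h⟩]

theorem isResolventContinuation_continuation (hU : IsBoundedPotential U B) {a b r₀ : ℝ}
    (hab : a ≤ b) (ha : -r₀ ≤ a) (hb : b ≤ r₀) (hU0 : ∀ x, x ∉ Icc a b → U x = 0) :
    IsResolventContinuation U (continuation hU r₀) := by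
  have hr₀ : 0 ≤ r₀ := by linarith
  constructor
  · intro r z _
    rcases le_or_gt r₀ r with h | h
    · rw [continuation_of_le hU h]
      exact meromorphicAt_cutResolvent hU (hr₀.trans h) z
    · rw [continuation_of_lt hU h]
      obtain ⟨n, hn⟩ := meromorphicAt_cutResolvent hU hr₀ z
      refine ⟨n, (((cutoffConj r).analyticAt _).fun_comp hn).congr (Eventually.of_forall fun w => ?_)⟩
      exact map_smul (cutoffConj r) _ _
  · refine ⟨max 1 (max B (4 * (b - a) * B)), fun z hz => ?_⟩
    have h1 : 1 < z.im := (le_max_left _ _).trans_lt hz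
    have h2 : B < z.im := ((le_max_left _ _).trans (le_max_right _ _)).trans_lt hz
    have h3 : 4 * (b - a) * B < z.im := ((le_max_right _ _).trans (le_max_right _ _)).trans_lt hz
    have h4 : z.im ≤ ‖z‖ := (le_abs_self _).trans (Complex.abs_im_le_norm z)
    have hz0 : z ≠ 0 := fun h => by simp [h] at h1; linarith
    obtain ⟨T, hT⟩ := exists_isResolvent hU (z := z) (by linarith) (by nlinarith)
    have hdet : ∀ r, r₀ ≤ r → cutResolvent hU r z = (cutoff r).comp (T.comp (cutoff r)) := by
      intro r hr
      refine cutResolvent_eq hU (hr₀.trans hr) (fun x hx => hU0 x fun h =>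
        hx ⟨by linarith [h.1], by linarith [h.2]⟩) (by linarith) ?_ hT
      rw [jostDet_eq hU hz0]
      refine mul_ne_zero (neg_ne_zero.2 (mul_ne_zero (mul_ne_zero (by simp) hz0)
        (Complex.exp_ne_zero _))) ?_
      refine jostFun_ne_zero_of_im_pos hU hab (by linarith) (by linarith) hU0 ?_ ?_
      · have : (2 * Complex.I * z).re = -2 * z.im := by simp
        rw [this]; linarith
      · have : ‖2 * Complex.I * z‖ = 2 * ‖z‖ := by simp
        rw [this]; linarith
    refine ⟨T, hT, fun r => ?_⟩
    rcases le_or_gt r₀ r with h | h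
    · rw [continuation_of_le hU h, hdet r h]
    · rw [continuation_of_lt hU h]
      beta_reduce
      rw [hdet r₀ le_rfl]
      ext1 f
      change cutoff r (cutoff r₀ (T (cutoff r₀ (cutoff r f)))) = cutoff r (T (cutoff r f))
      rw [cutoff_comp_cutoff h.le, cutoff_comp_cutoff' h.le]

/-- The meromorphic continuation is unique, up to its values on a discrete set. -/
theorem IsResolventContinuation.meromorphicOrderAt_eq {U : ℝ → ℂ}
    {Rc Rc' : ℝ → ℂ → (L2 →L[ℂ] L2)} (h : IsResolventContinuation U Rc)
    (h' : IsResolventContinuation U Rc') (r : ℝ) (z : ℂ) :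
    meromorphicOrderAt (Rc r) z = meromorphicOrderAt (Rc' r) z := by
  obtain ⟨A, hA⟩ := h.eq_resolvent
  obtain ⟨A', hA'⟩ := h'.eq_resolvent
  have heq : ∀ w : ℂ, max A A' < w.im → Rc r w = Rc' r w := by
    intro w hw
    obtain ⟨T, hT, hT'⟩ := hA w ((le_max_left _ _).trans_lt hw)
    obtain ⟨T₁, hT₁, hT₁'⟩ := hA' w ((le_max_right _ _).trans_lt hw)
    rw [hT', hT₁', hT.eq hT₁]
  have hmer : MeromorphicOn (Rc r - Rc' r) univ := (h.meromorphic r).sub (h'.meromorphic r)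
  set w₀ : ℂ := ((max A A' + 1 : ℝ) : ℂ) * Complex.I with hw₀
  have hw₀im : max A A' < w₀.im := by simp [hw₀]
  have hopen : IsOpen {w : ℂ | max A A' < w.im} := isOpen_lt continuous_const Complex.continuous_im
  have htop : meromorphicOrderAt (Rc r - Rc' r) w₀ = ⊤ := by
    rw [meromorphicOrderAt_eq_top_iff]
    filter_upwards [nhdsWithin_le_nhds (hopen.mem_nhds hw₀im)] with w hw
    rw [Pi.sub_apply, heq w hw, sub_self]
  have htop' : meromorphicOrderAt (Rc r - Rc' r) z = ⊤ := by
    by_contra hne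
    exact (hmer.exists_meromorphicOrderAt_ne_top_iff_forall isConnected_univ).1
      ⟨⟨z, mem_univ z⟩, hne⟩ ⟨w₀, mem_univ w₀⟩ htop
  rw [meromorphicOrderAt_eq_top_iff] at htop'
  refine meromorphicOrderAt_congr ?_
  filter_upwards [htop'] with w hw
  exact sub_eq_zero.1 hw

theorem jostFun_eq_zero_of_mem_resonances (hU : IsBoundedPotential U B) {a b r₀ : ℝ}
    (hab : a ≤ b) (ha : -r₀ ≤ a) (hb : b ≤ r₀) (hU0 : ∀ x, x ∉ Icc a b → U x = 0)
    (hz : z ≠ 0) (hzB : 4 * (b - a) * B ≤ ‖2 * Complex.I * z‖) (hres : z ∈ resonances U) :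
    jostFun hU r₀ (2 * Complex.I * z) = 0 := by
  by_contra hne
  have hr₀ : 0 ≤ r₀ := by linarith
  obtain ⟨Rc, hRc, r, hr⟩ := hres
  rw [hRc.meromorphicOrderAt_eq (isResolventContinuation_continuation hU hab ha hb hU0)] at hr
  refine absurd hr (not_lt.2 (AnalyticAt.meromorphicOrderAt_nonneg ?_))
  have hs : 2 * Complex.I * z ≠ 0 := mul_ne_zero (by simp) hz
  have hdet : ∀ r, r₀ ≤ r → jostDet hU r z ≠ 0 := by
    intro r hr
    rw [jostDet_eq hU hz, ← jostFun_eq_jostFun hU hab ha hb hr hU0 hs hzB]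
    exact mul_ne_zero (neg_ne_zero.2 (mul_ne_zero hs (Complex.exp_ne_zero _))) hne
  rcases le_or_gt r₀ r with h | h
  · rw [continuation_of_le hU h]
    exact analyticAt_cutResolvent hU (hr₀.trans h) (hdet r h)
  · rw [continuation_of_lt hU h]
    exact ((cutoffConj r).analyticAt _).comp (analyticAt_cutResolvent hU hr₀ (hdet r₀ le_rfl))

end Continuation

end

section


/-! ### Simple zeros of the determinant are resonances of multiplicity one -/

section Multiplicity

variable {U : ℝ → ℂ} {B r : ℝ} {z : ℂ}

theorem integral_sub_eq (r x : ℝ) : ∫ y in (-r)..x, ((x : ℂ) - y) = ((x : ℂ) + r) ^ 2 / 2 := by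
  have h : ∀ y : ℝ, HasDerivAt (fun y : ℝ => -((x : ℂ) - y) ^ 2 / 2) ((x : ℂ) - y) y := by
    intro y
    have h1 := ((((Complex.ofRealCLM.hasDerivAt (x := y)).const_sub (x : ℂ)).pow 2).neg).div_const 2
    refine h1.congr_deriv ?_
    rw [Complex.ofRealCLM_apply, Complex.ofRealCLM_apply, Complex.ofReal_one]
    simp
  rw [intervalIntegral.integral_eq_sub_of_hasDerivAt (fun y _ => h y)
    (Continuous.intervalIntegrable (by fun_prop) _ _)]
  push_cast
  ring

theorem volterraFun_one {x : ℝ} (hx : x ∈ Icc (-r) r) :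
    volterraFun r (truncL2 (continuousOn_one r)) x = ((x : ℂ) + r) ^ 2 / 2 := by
  rw [volterraFun_congr (g := fun _ => 1) hx, volterraFun]
  · simp only [mul_one]
    exact integral_sub_eq r x
  · filter_upwards [coeFn_truncL2 (continuousOn_one r)] with y h1 h2
    rw [h1, indicator_of_mem h2]

theorem radiation_one (hr : 0 ≤ r) : radiation r z (truncL2 (continuousOn_one r)) =
    2 * r * (1 - Complex.I * z * r) := by
  rw [radiation_apply hr, volterraFun_one (right_mem_Icc.2 (by linarith))]
  have h1 : ∫ y in (-r)..r, truncL2 (continuousOn_one r) y = ∫ y in (-r)..r, (1 : ℂ) := by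
    refine intervalIntegral.integral_congr_ae ?_
    filter_upwards [coeFn_truncL2 (continuousOn_one r)] with y h1 h2
    rw [uIoc_of_le (by linarith)] at h2
    have h3 : y ∈ Icc (-r) r := ⟨h2.1.le, h2.2⟩
    rw [h1, indicator_of_mem h3]
  rw [h1, intervalIntegral.integral_const]
  simp only [sub_neg_eq_add, Complex.real_smul, mul_one]
  push_cast
  ring

/-- The test case is the solution `(x + r)²`, which has zero initial data at `-r`. -/
theorem defect_ne_zero (hU : IsBoundedPotential U B) (hr : 0 < r)
    (hz : 1 - Complex.I * z * r ≠ 0) : defect hU r z ≠ 0 := by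
  have hc : ContinuousOn (fun x : ℝ => ((x : ℂ) + r) ^ 2) (Icc (-r) r) := by fun_prop
  set e := truncL2 (continuousOn_one r) with he
  set p := truncL2 hc with hp
  have hKe : volterra r ((2 : ℂ) • e) = p := by
    rw [map_smul]
    apply Lp.ext
    filter_upwards [Lp.coeFn_smul (2 : ℂ) (volterra r e), coeFn_volterra r e, coeFn_truncL2 hc]
      with x h1 h2 h3
    rw [h1, Pi.smul_apply, h2, h3]
    by_cases hx : x ∈ Icc (-r) r
    · rw [indicator_of_mem hx, indicator_of_mem hx, volterraFun_one hx, smul_eq_mul]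
      ring
    · rw [indicator_of_notMem hx, indicator_of_notMem hx, smul_zero]
  set f := mulSub hU z p - (2 : ℂ) • e with hf
  have h1 : volterraInv hU r z (-(volterra r f)) = p := by
    rw [volterraInv_eq_iff hU hr.le, hf, map_sub, hKe]
    abel
  have h2 : defect hU r z f = 2 * (2 * r * (1 - Complex.I * z * r)) := by
    rw [defect_apply, ← map_neg, h1, hf, sub_sub_cancel, map_smul, radiation_one hr.le, smul_eq_mul]
  intro h
  rw [h, zero_apply] at h2
  have hr' : (r : ℂ) ≠ 0 := by exact_mod_cast hr.ne'
  exact mul_ne_zero two_ne_zero (mul_ne_zero (mul_ne_zero two_ne_zero hr') hz) h2.symm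

theorem leftSol_ne_zero (hU : IsBoundedPotential U B) (hz0 : z ≠ 0)
    (hz : 1 - Complex.I * z * r ≠ 0) (hdet : jostDet hU r z = 0) : leftSol hU r z ≠ 0 := by
  intro h
  rw [jostDet, h, map_zero, map_zero, add_zero] at hdet
  exact mul_ne_zero (mul_ne_zero (by simp) hz0) hz hdet

theorem rank_smul_smulRight {c : ℂ} (hc : c ≠ 0) {φ : L2 →L[ℂ] ℂ} (hφ : φ ≠ 0) {v : L2}
    (hv : v ≠ 0) : LinearMap.rank ((c • φ.smulRight v : L2 →L[ℂ] L2) : L2 →ₗ[ℂ] L2) = 1 := by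
  have h1 : ((c • φ.smulRight v : L2 →L[ℂ] L2) : L2 →ₗ[ℂ] L2) =
      (φ : L2 →ₗ[ℂ] ℂ).smulRight (c • v) := by
    ext1 f
    simp [smul_comm c]
  have h2 : (φ : L2 →ₗ[ℂ] ℂ) ≠ 0 := fun h => hφ (by ext1 f; exact DFunLike.congr_fun h f)
  rw [h1, LinearMap.rank, LinearMap.range_smulRight_apply h2,
    rank_submodule_eq_one_iff]
  refine ⟨c • v, Submodule.mem_span_singleton_self _, smul_ne_zero hc hv, le_rfl⟩

/-- Near a simple zero of the determinant the resolvent has a simple pole with residue of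
rank one. -/
theorem cutResolvent_simple_pole (hU : IsBoundedPotential U B) (hr : 0 < r) (hz0 : z ≠ 0)
    (hzr : 1 - Complex.I * z * r ≠ 0) (hdet : jostDet hU r z = 0)
    (hderiv : deriv (fun z => jostDet hU r z) z ≠ 0) :
    ∃ g : ℂ → (L2 →L[ℂ] L2), AnalyticAt ℂ g z ∧ g z ≠ 0 ∧
      LinearMap.rank (g z : L2 →ₗ[ℂ] L2) = 1 ∧
      ∀ᶠ w in 𝓝[≠] z, cutResolvent hU r w = (w - z)⁻¹ • g w := by
  set k := dslope (fun z => jostDet hU r z) z with hk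
  have hkd : Differentiable ℂ k := by
    rw [← differentiableOn_univ]
    exact (Complex.differentiableOn_dslope univ_mem).2
      (differentiable_jostDet hU hr.le).differentiableOn
  have hkz : k z ≠ 0 := by rwa [hk, dslope_same]
  have hfac : ∀ w, jostDet hU r w = (w - z) * k w := by
    intro w
    have := sub_smul_dslope (fun z => jostDet hU r z) z w
    rw [smul_eq_mul] at this
    rw [hk, this]
    simp [hdet]
  set g : ℂ → (L2 →L[ℂ] L2) := fun w =>
    (w - z) • (-(volterraInv hU r w * volterra r)) - (k w)⁻¹ • singularPart hU r w with hg
  have hga : AnalyticAt ℂ g z := by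
    have h1 : Differentiable ℂ fun w => (w - z) • (-(volterraInv hU r w * volterra r)) :=
      (differentiable_id.sub_const z).smul
        ((differentiable_volterraInv hU hr.le).mul (differentiable_const _)).neg
    exact (h1.analyticAt z).sub (((hkd.analyticAt z).inv hkz).smul
      ((differentiable_singularPart hU hr.le).analyticAt z))
  have hgz : g z = (-(k z)⁻¹) • (defect hU r z).smulRight (leftSol hU r z) := by
    rw [hg]
    simp only [sub_self, zero_smul, zero_sub, neg_smul]
    rfl
  have hrank : LinearMap.rank (g z : L2 →ₗ[ℂ] L2) = 1 := by
    rw [hgz]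
    exact rank_smul_smulRight (neg_ne_zero.2 (inv_ne_zero hkz)) (defect_ne_zero hU hr hzr)
      (leftSol_ne_zero hU hz0 hzr hdet)
  refine ⟨g, hga, fun h => ?_, hrank, ?_⟩
  · rw [h] at hrank
    exact zero_ne_one (LinearMap.rank_zero.symm.trans hrank)
  · filter_upwards [self_mem_nhdsWithin] with w hw
    have hw' : w - z ≠ 0 := sub_ne_zero.2 hw
    rw [cutResolvent, hfac, hg]
    simp only [smul_sub, smul_smul]
    rw [inv_mul_cancel₀ hw', one_smul, mul_inv]

theorem isResidue_of_simple_pole {F g : ℂ → (L2 →L[ℂ] L2)} (hg : AnalyticAt ℂ g z)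
    (hF : ∀ᶠ w in 𝓝[≠] z, F w = (w - z)⁻¹ • g w) : IsResidue F z (g z) := by
  have h1 : ∀ᶠ w in 𝓝 z, AnalyticAt ℂ g w ∧ (w ≠ z → F w = (w - z)⁻¹ • g w) :=
    hg.eventually_analyticAt.and (eventually_nhdsWithin_iff.1 hF)
  obtain ⟨ε, hε, hball⟩ := Metric.eventually_nhds_iff_ball.1 h1
  have h2 : ∀ᶠ ρ in 𝓝[>] (0 : ℝ), ρ ∈ Ioo 0 ε := Ioo_mem_nhdsGT hε
  filter_upwards [h2] with ρ hρ
  have hsub : Metric.closedBall z ρ ⊆ Metric.ball z ε := Metric.closedBall_subset_ball hρ.2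
  have h3 : DifferentiableOn ℂ g (Metric.closedBall z ρ) := fun w hw =>
    (hball w (hsub hw)).1.differentiableAt.differentiableWithinAt
  have h4 := h3.circleIntegral_sub_inv_smul (Metric.mem_ball_self hρ.1)
  rw [circleIntegral.integral_congr hρ.1.le (g := fun w => (w - z)⁻¹ • g w), h4, smul_smul,
    inv_mul_cancel₀ (by simp [Real.pi_ne_zero]), one_smul]
  intro w hw
  refine (hball w (hsub (Metric.sphere_subset_closedBall hw))).2 fun h => ?_
  rw [h, Metric.mem_sphere, dist_self] at hw
  exact hρ.1.ne hw

theorem resonance_of_simple_zero (hU : IsBoundedPotential U B) {a b r₀ : ℝ}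
    (hab : a ≤ b) (ha : -r₀ ≤ a) (hb : b ≤ r₀) (hU0 : ∀ x, x ∉ Icc a b → U x = 0)
    (hz : z ≠ 0) (hzB : 4 * (b - a) * B < ‖2 * Complex.I * z‖)
    (h0 : jostFun hU r₀ (2 * Complex.I * z) = 0)
    (hd : deriv (jostFun hU r₀) (2 * Complex.I * z) ≠ 0) :
    z ∈ resonances U ∧ HasResonanceMultiplicity U z 1 := by
  have hr₀ : 0 ≤ r₀ := by linarith
  have hs : 2 * Complex.I * z ≠ 0 := mul_ne_zero (by simp) hz
  have hzpos : 0 < ‖z‖ := norm_pos_iff.2 hz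
  have hpole : ∀ r, r₀ ≤ r → ‖z‖⁻¹ < r → ∃ g : ℂ → (L2 →L[ℂ] L2), AnalyticAt ℂ g z ∧ g z ≠ 0 ∧
      LinearMap.rank (g z : L2 →ₗ[ℂ] L2) = 1 ∧
      ∀ᶠ w in 𝓝[≠] z, cutResolvent hU r w = (w - z)⁻¹ • g w := by
    intro r hr hr'
    have hr0 : 0 < r := (inv_pos.2 hzpos).trans hr'
    have hzr : 1 - Complex.I * z * r ≠ 0 := by
      intro h
      have h1 : ‖Complex.I * z * r‖ = 1 := by rw [← sub_eq_zero.1 h, norm_one]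
      rw [norm_mul, norm_mul, Complex.norm_I, one_mul, Complex.norm_real,
        Real.norm_of_nonneg hr0.le] at h1
      rw [inv_lt_iff_one_lt_mul₀' hzpos, h1] at hr'
      exact lt_irrefl _ hr'
    set h : ℂ → ℂ := fun w =>
      -(2 * Complex.I * w * Complex.exp (-(2 * Complex.I * w * r))) with hh
    have hfac : (fun w => jostDet hU r w) =ᶠ[𝓝 z]
        fun w => h w * jostFun hU r₀ (2 * Complex.I * w) := by
      have h1 : ∀ᶠ w in 𝓝 z, 4 * (b - a) * B < ‖2 * Complex.I * w‖ :=
        (Continuous.norm (by fun_prop)).continuousAt.eventually (lt_mem_nhds hzB)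
      have h2 : ∀ᶠ w in 𝓝 z, w ≠ 0 := isOpen_ne.mem_nhds hz
      filter_upwards [h1, h2] with w h3 h4
      rw [jostDet_eq hU h4, jostFun_eq_jostFun hU hab ha hb hr hU0
        (mul_ne_zero (by simp) h4) h3.le]
    have hhz : h z ≠ 0 := neg_ne_zero.2 (mul_ne_zero hs (Complex.exp_ne_zero _))
    have hhd : Differentiable ℂ h := by fun_prop
    have hcomp : HasDerivAt (fun w => jostFun hU r₀ (2 * Complex.I * w))
        (deriv (jostFun hU r₀) (2 * Complex.I * z) * (2 * Complex.I)) z := by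
      have h1 := (analyticAt_jostFun hU hr₀ hs).differentiableAt.hasDerivAt
      have h2 : HasDerivAt (fun w : ℂ => 2 * Complex.I * w) (2 * Complex.I) z := by
        simpa using (hasDerivAt_id z).const_mul (2 * Complex.I)
      exact h1.comp z h2
    refine cutResolvent_simple_pole hU hr0 hz hzr ?_ ?_
    · rw [hfac.eq_of_nhds, h0, mul_zero]
    · have h1 := hhd.differentiableAt.hasDerivAt.mul hcomp
      rw [hfac.deriv_eq]
      have h2 : deriv (fun w => h w * jostFun hU r₀ (2 * Complex.I * w)) z = _ := h1.deriv
      rw [h2, h0, mul_zero, zero_add]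
      exact mul_ne_zero hhz (mul_ne_zero hd (by simp))
  have hcont := isResolventContinuation_continuation hU hab ha hb hU0
  refine ⟨⟨_, hcont, max r₀ (‖z‖⁻¹ + 1), ?_⟩, _, hcont, ?_⟩
  · obtain ⟨g, hg, hgz, -, hF⟩ := hpole (max r₀ (‖z‖⁻¹ + 1)) (le_max_left _ _)
      ((lt_add_one _).trans_le (le_max_right _ _))
    rw [continuation_of_le hU (le_max_left _ _)]
    have h1 : meromorphicOrderAt (cutResolvent hU (max r₀ (‖z‖⁻¹ + 1))) z = ((-1 : ℤ) : WithTop ℤ) := by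
      rw [meromorphicOrderAt_eq_int_iff
        (meromorphicAt_cutResolvent hU (hr₀.trans (le_max_left _ _)) z)]
      refine ⟨g, hg, hgz, ?_⟩
      filter_upwards [hF] with w hw
      rw [hw, zpow_neg_one]
    rw [h1]
    exact_mod_cast (by norm_num : (-1 : ℤ) < 0)
  · filter_upwards [eventually_ge_atTop r₀, eventually_gt_atTop ‖z‖⁻¹] with r h1 h2
    obtain ⟨g, hg, -, hrank, hF⟩ := hpole r h1 h2
    rw [continuation_of_le hU h1]
    exact ⟨g z, isResidue_of_simple_pole hg hF, by rw [hrank, Nat.cast_one]⟩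

end Multiplicity

end

section


/-! ### Reduction to a bounded potential -/

theorem ae_eq_zero_of_notMem_essSupport (f : ℝ → ℂ) : ∀ᵐ x, x ∉ essSupport f → f x = 0 := by
  have h : volume {x | x ∉ essSupport f ∧ f x ≠ 0} = 0 := by
    refine measure_null_of_locally_null _ fun x hx => ?_
    have hx1 : ∃ V ∈ 𝓝 x, volume (V ∩ {y | f y ≠ 0}) = 0 := by
      have := hx.1
      simp only [essSupport, mem_ofPred_eq, not_forall, not_lt, nonpos_iff_eq_zero] at this
      obtain ⟨V, hV, h0⟩ := this
      exact ⟨V, hV, h0⟩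
    obtain ⟨V, hV, h0⟩ := hx1
    refine ⟨V ∩ {y | f y ≠ 0}, ?_, h0⟩
    rw [mem_nhdsWithin_iff_eventually]
    filter_upwards [hV] with y hy hy' using ⟨hy, hy'.2⟩
  rw [ae_iff]
  refine measure_mono_null (fun x hx => ?_) h
  simpa only [mem_ofPred_eq, Classical.not_imp] using hx

theorem SchrodingerEq.congr {U V : ℝ → ℂ} (h : U =ᵐ[volume] V) {u g : L2}
    (hu : SchrodingerEq U u g) : SchrodingerEq V u g := by
  intro φ hφ hφ'
  rw [← hu φ hφ hφ']
  refine integral_congr_ae ?_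
  filter_upwards [h] with x hx
  rw [hx]

theorem IsResolventContinuation.congr {U V : ℝ → ℂ} (h : U =ᵐ[volume] V)
    {Rc : ℝ → ℂ → (L2 →L[ℂ] L2)} (hR : IsResolventContinuation U Rc) :
    IsResolventContinuation V Rc := by
  refine ⟨hR.meromorphic, ?_⟩
  obtain ⟨A, hA⟩ := hR.eq_resolvent
  refine ⟨A, fun z hz => ?_⟩
  obtain ⟨T, hT, hT'⟩ := hA z hz
  exact ⟨T, fun u f => (hT u f).trans ⟨fun h1 => h1.congr h, fun h1 => h1.congr h.symm⟩, hT'⟩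

theorem resonances_congr {U V : ℝ → ℂ} (h : U =ᵐ[volume] V) : resonances U = resonances V := by
  ext z
  constructor
  · rintro ⟨Rc, hR, hz⟩
    exact ⟨Rc, hR.congr h, hz⟩
  · rintro ⟨Rc, hR, hz⟩
    exact ⟨Rc, hR.congr h.symm, hz⟩

theorem HasResonanceMultiplicity.congr {U V : ℝ → ℂ} (h : U =ᵐ[volume] V) {z : ℂ} {m : ℕ}
    (hm : HasResonanceMultiplicity U z m) : HasResonanceMultiplicity V z m := by
  obtain ⟨Rc, hR, hz⟩ := hm
  exact ⟨Rc, hR.congr h, hz⟩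

theorem exists_Icc_of_isCompact {K : Set ℝ} {c d : ℝ} (hK : IsCompact K) (hKcd : K ⊆ Ioo c d)
    (hcd : c < d) : ∃ c' d', c < c' ∧ c' ≤ d' ∧ d' < d ∧ K ⊆ Icc c' d' := by
  rcases K.eq_empty_or_nonempty with rfl | hne
  · exact ⟨(c + d) / 2, (c + d) / 2, by linarith, le_rfl, by linarith, empty_subset _⟩
  · have h1 := hK.sInf_mem hne
    have h2 := hK.sSup_mem hne
    exact ⟨sInf K, sSup K, (hKcd h1).1, csInf_le hK.bddBelow h2, (hKcd h2).2,
      fun x hx => ⟨csInf_le hK.bddBelow hx, le_csSup hK.bddAbove hx⟩⟩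

/-- A bounded representative of an essentially bounded function, supported in a prescribed interval
that contains the essential support. -/
theorem exists_bounded_representative {W : ℝ → ℂ} (hW : MemLp W ⊤ volume) {c d : ℝ}
    (hsupp : essSupport W ⊆ Icc c d) : ∃ (W₀ : ℝ → ℂ) (B : ℝ), IsBoundedPotential W₀ B ∧
      W₀ =ᵐ[volume] W ∧ ∀ x, W₀ x ≠ 0 → x ∈ Icc c d := by
  set C := (eLpNorm W ⊤ volume).toReal with hC
  have hbound : ∀ᵐ x, ‖W x‖ ≤ C := by
    filter_upwards [ae_le_eLpNormEssSup (f := W) (μ := volume)] with x hx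
    rw [hC, ← toReal_enorm]
    exact ENNReal.toReal_mono hW.2.ne (by rwa [eLpNorm_exponent_top])
  set W' := hW.1.mk W with hW'
  have hmeas : StronglyMeasurable W' := hW.1.stronglyMeasurable_mk
  have hset : MeasurableSet (Icc c d ∩ {x | ‖W' x‖ ≤ C}) :=
    measurableSet_Icc.inter (measurableSet_le hmeas.norm.measurable measurable_const)
  refine ⟨(Icc c d ∩ {x | ‖W' x‖ ≤ C}).indicator W', C,
    ⟨(hmeas.indicator hset).aestronglyMeasurable, fun x => ?_⟩, ?_, fun x hx => ?_⟩
  · by_cases hx : x ∈ Icc c d ∩ {x | ‖W' x‖ ≤ C}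
    · rw [indicator_of_mem hx]
      exact hx.2
    · rw [indicator_of_notMem hx, norm_zero]
      exact ENNReal.toReal_nonneg
  · filter_upwards [hbound, hW.1.ae_eq_mk, ae_eq_zero_of_notMem_essSupport W] with x h1 h2 h3
    by_cases hx : x ∈ Icc c d
    · have hx' : x ∈ Icc c d ∩ {x | ‖W' x‖ ≤ C} := ⟨hx, by rw [mem_ofPred_eq, hW', ← h2]; exact h1⟩
      rw [indicator_of_mem hx', h2]
    · rw [indicator_of_notMem fun h => hx h.1, h3 fun h => hx (hsupp h)]
  · by_contra h
    exact hx (indicator_of_notMem (fun h' => h h'.1) _)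

/-- The function whose zeros are the large resonances, with its asymptotics. -/
theorem exists_jostFun {j k : ℕ} {a b : ℝ} {C₁ C₂ : ℂ} {V W : ℝ → ℂ}
    (hV : EndpointClass j k a b C₁ C₂ V) (hW : MemLinftyComp W) {c d : ℝ} (hac : a ≤ c)
    (hdb : d ≤ b) (hsupp : essSupport W ⊆ Icc c d) :
    ∃ (F : ℂ → ℂ) (A B S : ℝ), 0 ≤ A ∧ 0 ≤ B ∧ 0 < S ∧
      (∀ s, S ≤ ‖s‖ → 1 ≤ s.re →
        ‖F s - 1 + doubleReflection (b - a) (j + k + 4) (j.factorial * k.factorial * C₁ * C₂) s‖ ≤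
          A * jostError (b - a) (c - a) (b - d) j k s) ∧
      (∀ s, S ≤ ‖s‖ →
        ‖F s - 1‖ ≤ B / ‖s‖ * (1 + B / ‖s‖ * Real.exp (max s.re 0 * (b - a)))) ∧
      (∀ s, S ≤ ‖s‖ → AnalyticAt ℂ F s) ∧
      (∀ z, S ≤ ‖2 * Complex.I * z‖ → z ∈ resonances (V + W) → F (2 * Complex.I * z) = 0) ∧
      (∀ z, S ≤ ‖2 * Complex.I * z‖ → F (2 * Complex.I * z) = 0 →
        deriv F (2 * Complex.I * z) ≠ 0 →
        z ∈ resonances (V + W) ∧ HasResonanceMultiplicity (V + W) z 1) := by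
  have hlt := hV.lt
  obtain ⟨N, hjN, hkN, hsm⟩ := hV.smooth
  obtain ⟨W₀, BW, hW₀, hW₀W, hW₀s⟩ := exists_bounded_representative hW.1 hsupp
  -- the representative of `V` that vanishes outside `[a, b]`
  set V₀ : ℝ → ℂ := (Icc a b).indicator V with hV₀
  have hV₀V : V₀ =ᵐ[volume] V := by
    filter_upwards [ae_eq_zero_of_notMem_essSupport V] with x hx
    by_cases h : x ∈ Icc a b
    · rw [hV₀, indicator_of_mem h]
    · rw [hV₀, indicator_of_notMem h, hx fun h' => h (hV.hull_support ▸ subset_convexHull ℝ _ h')]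
  obtain ⟨CV, hCV⟩ := isCompact_Icc.exists_bound_of_continuousOn hsm.continuousOn
  have hCV0 : 0 ≤ CV := (norm_nonneg _).trans (hCV a (left_mem_Icc.2 hlt.le))
  set U : ℝ → ℂ := fun x => V₀ x + W₀ x with hUdef
  set B := CV + BW with hB
  have hV₀b : ∀ x, ‖V₀ x‖ ≤ CV := by
    intro x
    by_cases h : x ∈ Icc a b
    · rw [hV₀, indicator_of_mem h]
      exact hCV x h
    · rw [hV₀, indicator_of_notMem h, norm_zero]
      exact hCV0
  have hU : IsBoundedPotential U B := by
    refine ⟨AEStronglyMeasurable.add ?_ hW₀.aestronglyMeasurable, fun x =>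
      (norm_add_le _ _).trans (add_le_add (hV₀b x) (hW₀.bound x))⟩
    rw [hV₀, aestronglyMeasurable_indicator_iff measurableSet_Icc]
    exact hsm.continuousOn.aestronglyMeasurable measurableSet_Icc
  have hUV : U =ᵐ[volume] V + W := hV₀V.add hW₀W
  have hU0 : ∀ x, x ∉ Icc a b → U x = 0 := by
    intro x hx
    have h1 : W₀ x = 0 := by
      by_contra h
      exact hx ⟨hac.trans (hW₀s x h).1, (hW₀s x h).2.trans hdb⟩
    simp only [hUdef, hV₀, indicator_of_notMem hx, h1, add_zero]
  have hUi : IntervalIntegrable U volume a b := by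
    rw [intervalIntegrable_iff_integrableOn_Ioc_of_le hlt.le]
    exact Measure.integrableOn_of_bounded (by simp) hU.aestronglyMeasurable (ae_of_all _ hU.bound)
  set r₀ := max |a| |b| with hr₀
  have hra : -r₀ ≤ a := by linarith [neg_abs_le a, le_max_left |a| |b|]
  have hrb : b ≤ r₀ := (le_abs_self b).trans (le_max_right _ _)
  have hr₀0 : 0 ≤ r₀ := (abs_nonneg a).trans (le_max_left _ _)
  obtain ⟨A, S, hA, hasym⟩ := jost_asymptotics (δ := c - a) (δ' := b - d) (W := W₀) (B := B) hlt
    hsm hjN hkN hV.left_equiv hV.right_equiv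
    (fun t ht => by simp only [hUdef, hV₀, indicator_of_mem ht]) hUi hU.bound
    (fun t => (hW₀.bound t).trans (by linarith))
    (fun t ht => by
      rw [add_sub_cancel, sub_sub_cancel]
      exact hW₀s t ht)
  have hLB : 0 ≤ (b - a) * B := mul_nonneg (by linarith) hU.nonneg
  set S' := max (max S 1) (4 * (b - a) * B + 1) with hS'
  have hS0 : ∀ s : ℂ, S' ≤ ‖s‖ → s ≠ 0 ∧ 4 * (b - a) * B < ‖s‖ ∧ S ≤ ‖s‖ := by
    intro s hs
    have h1 : 1 ≤ ‖s‖ := ((le_max_right _ _).trans (le_max_left _ _)).trans hs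
    have h2 : 4 * (b - a) * B + 1 ≤ ‖s‖ := (le_max_right _ _).trans hs
    exact ⟨norm_pos_iff.1 (by linarith), by linarith,
      ((le_max_left _ _).trans (le_max_left _ _)).trans hs⟩
  have hz0 : ∀ z : ℂ, 2 * Complex.I * z ≠ 0 → z ≠ 0 := fun z h h' => h (by rw [h', mul_zero])
  refine ⟨jostFun hU r₀, A, 4 * ((b - a) * B), S', hA, by positivity,
    one_pos.trans_le ((le_max_right _ _).trans (le_max_left _ _)), ?_, ?_, ?_, ?_, ?_⟩
  · intro s hs hre
    obtain ⟨h1, -, h3⟩ := hS0 s hs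
    obtain ⟨w, q, hwq, heq⟩ := jostFun_eq hU hlt.le hra hrb hU0 h1
    have h4 := hasym s h3 hre w q hwq
    rw [heq, doubleReflection, Complex.ofReal_sub]
    exact h4
  · intro s hs
    obtain ⟨h1, h2, -⟩ := hS0 s hs
    obtain ⟨w, q, hwq, heq⟩ := jostFun_eq hU hlt.le hra hrb hU0 h1
    rw [heq]
    refine (jost_crude_bound hwq hUi hU.bound h2.le h1).trans ?_
    have h5 : (b - a) * B / ‖s‖ ≤ 4 * ((b - a) * B) / ‖s‖ :=
      div_le_div_of_nonneg_right (by linarith) (norm_nonneg _)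
    exact mul_le_mul_of_nonneg_right h5 (by positivity)
  · intro s hs
    exact analyticAt_jostFun hU hr₀0 (hS0 s hs).1
  · intro z hz hres
    obtain ⟨h1, h2, -⟩ := hS0 _ hz
    rw [← resonances_congr hUV] at hres
    exact jostFun_eq_zero_of_mem_resonances hU hlt.le hra hrb hU0 (hz0 z h1) h2.le hres
  · intro z hz h0 hd
    obtain ⟨h1, h2, -⟩ := hS0 _ hz
    obtain ⟨h3, h4⟩ := resonance_of_simple_zero hU hlt.le hra hrb hU0 (hz0 z h1) h2 h0 hd
    exact ⟨resonances_congr hUV ▸ h3, h4.congr hUV⟩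

theorem norm_two_I_mul (z : ℂ) : ‖2 * Complex.I * z‖ = 2 * ‖z‖ := by simp

theorem resonance_free_region {j k : ℕ} {a b : ℝ} {C₁ C₂ : ℂ} {V W : ℝ → ℂ}
    (hV : EndpointClass j k a b C₁ C₂ V) (hW : MemLinftyComp W) (hsupp : essSupport W ⊆ Ioo a b) :
    ∃ M₀ : ℝ, 0 < M₀ ∧ ∀ M : ℝ, M₀ < M → ∃ R : ℝ, 0 < R ∧
      resonances (V + W) ∩ (aboveLogCurve M)ᶜ ∩ {z : ℂ | R < ‖z‖} = ∅ := by
  obtain ⟨c, d, hac, hcd, hdb, hcdW⟩ := exists_Icc_of_isCompact hW.2 hsupp hV.lt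
  obtain ⟨F, A, B, S, hA, -, hS, hF, -, -, hres, -⟩ := exists_jostFun hV hW hac.le hdb.le hcdW
  have hρ : (j.factorial * k.factorial * C₁ * C₂ : ℂ) ≠ 0 := by
    have h1 : (j.factorial : ℂ) ≠ 0 := by exact_mod_cast j.factorial_ne_zero
    have h2 : (k.factorial : ℂ) ≠ 0 := by exact_mod_cast k.factorial_ne_zero
    exact mul_ne_zero (mul_ne_zero (mul_ne_zero h1 h2) hV.left_ne_zero) hV.right_ne_zero
  have hδ : 0 < c - a := by linarith
  have hδ' : 0 < b - d := by linarith
  have hmin : 0 < min (c - a) (b - d) := lt_min hδ hδ'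
  refine ⟨(j + k + 4 : ℕ) / min (c - a) (b - d), by positivity, fun M hM => ?_⟩
  have hM0 : 0 < M := lt_trans (by positivity) hM
  rw [div_lt_iff₀ hmin] at hM
  obtain ⟨R, hR⟩ := ne_zero_of_log_le_re hρ hA hδ hδ' (by linarith) hF hM
  refine ⟨max S R, hS.trans_le (le_max_left _ _), ?_⟩
  rw [eq_empty_iff_forall_notMem]
  rintro z ⟨⟨hz1, hz2⟩, hz3⟩
  have hz3' : max S R < ‖z‖ := hz3
  have hzpos : 0 < ‖z‖ := (hS.trans_le (le_max_left _ _)).trans hz3'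
  have hS' := (le_max_left S R).trans hz3'.le
  have hR' := (le_max_right S R).trans hz3'.le
  have him : z.im ≤ -M * Real.log (1 + ‖z‖) := not_lt.1 hz2
  refine hR (2 * Complex.I * z) (by rw [norm_two_I_mul]; linarith) ?_
    (hres z (by rw [norm_two_I_mul]; linarith) hz1)
  -- `log (2|z|) ≤ 2 log (1 + |z|)`, while `Re (2iz) = -2 Im z`
  have hlog : Real.log (2 * ‖z‖) ≤ 2 * Real.log (1 + ‖z‖) := by
    have h1 : Real.log ((1 + ‖z‖) ^ 2) = 2 * Real.log (1 + ‖z‖) := by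
      rw [Real.log_pow]; norm_num
    rw [← h1]
    exact Real.log_le_log (by positivity) (by nlinarith [sq_nonneg ‖z‖])
  have hre : (2 * Complex.I * z).re = -(2 * z.im) := by simp
  rw [norm_two_I_mul, hre]
  nlinarith [mul_le_mul_of_nonneg_left hlog hM0.le]

theorem resonance_asymptotics {j k : ℕ} {a b : ℝ} {C₁ C₂ : ℂ} {V W : ℝ → ℂ}
    (hV : EndpointClass j k a b C₁ C₂ V) (hW : MemLinftyComp W)
    (hsupp : essSupport W ⊆ Ioo (a + ((j : ℝ) + 1) * (b - a) / ((j : ℝ) + k + 4))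
      (b - ((k : ℝ) + 1) * (b - a) / ((j : ℝ) + k + 4))) :
    ∃ R : ℝ, 0 < R ∧ ∃ (Np Nm : ℕ) (zp zm : ℕ → ℂ),
      Tendsto (fun n => zp n - logSequence (b - a) (j + k + 4)
        (j.factorial * k.factorial * C₁ * C₂ / 2 ^ (j + k + 4)) 1 n) atTop (𝓝 0) ∧
      Tendsto (fun n => zm n - logSequence (b - a) (j + k + 4)
        (j.factorial * k.factorial * C₁ * C₂ / 2 ^ (j + k + 4)) (-1) n) atTop (𝓝 0) ∧
      resonances (V + W) ∩ {z : ℂ | R < ‖z‖} = zp '' Ioi Np ∪ zm '' Ioi Nm ∧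
      InjOn zp (Ioi Np) ∧ InjOn zm (Ioi Nm) ∧ Disjoint (zp '' Ioi Np) (zm '' Ioi Nm) ∧
      ∀ z ∈ resonances (V + W), R < ‖z‖ → HasResonanceMultiplicity (V + W) z 1 := by
  have hL : 0 < b - a := by linarith [hV.lt]
  have hp : (0 : ℝ) < (j : ℝ) + k + 4 := by positivity
  have hlt : a + ((j : ℝ) + 1) * (b - a) / ((j : ℝ) + k + 4) <
      b - ((k : ℝ) + 1) * (b - a) / ((j : ℝ) + k + 4) := by
    rw [lt_sub_iff_add_lt, add_assoc, ← lt_sub_iff_add_lt', ← add_div, div_lt_iff₀ hp]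
    nlinarith
  obtain ⟨c, d, hac, hcd, hdb, hcdW⟩ := exists_Icc_of_isCompact hW.2 hsupp hlt
  have hδ : ((j : ℝ) + 1) * (b - a) < (j + k + 4 : ℕ) * (c - a) := by
    rw [← lt_sub_iff_add_lt', div_lt_iff₀ hp] at hac
    push_cast
    linarith
  have hδ' : ((k : ℝ) + 1) * (b - a) < (j + k + 4 : ℕ) * (b - d) := by
    rw [lt_sub_comm, div_lt_iff₀ hp] at hdb
    push_cast
    linarith
  have hac' : a ≤ c := le_trans (le_add_of_nonneg_right (by positivity)) hac.le
  have hdb' : d ≤ b := hdb.le.trans (sub_le_self _ (by positivity))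
  obtain ⟨F, A, B, S, hA, hB, hS, hF, hF', han, hres, hzero⟩ :=
    exists_jostFun hV hW hac' hdb' hcdW
  set ρ : ℂ := j.factorial * k.factorial * C₁ * C₂ with hρdef
  have hρ : ρ ≠ 0 := by
    have h1 : (j.factorial : ℂ) ≠ 0 := by exact_mod_cast j.factorial_ne_zero
    have h2 : (k.factorial : ℂ) ≠ 0 := by exact_mod_cast k.factorial_ne_zero
    exact mul_ne_zero (mul_ne_zero (mul_ne_zero h1 h2) hV.left_ne_zero) hV.right_ne_zero
  obtain ⟨R, hSR, Np, Nm, xp, xm, hxp, hxm, hset, hip, him, hdisj, hsimple⟩ :=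
    zeros_asymptotics hL hρ (relative_error_small hρ hA hB (by linarith) hδ hδ' hL hF hF')
      ⟨S, han⟩ S
  have hR0 : 0 < R := hS.trans_le hSR
  -- resonances outside the disc correspond to zeros of `F` under `s = 2iz`
  have hiff : ∀ z : ℂ, R / 2 < ‖z‖ → (z ∈ resonances (V + W) ↔ F (2 * Complex.I * z) = 0) ∧
      (z ∈ resonances (V + W) → HasResonanceMultiplicity (V + W) z 1) := by
    intro z hz
    have h1 : R < ‖2 * Complex.I * z‖ := by rw [norm_two_I_mul]; linarith
    have h2 : S ≤ ‖2 * Complex.I * z‖ := hSR.trans h1.le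
    have h3 : F (2 * Complex.I * z) = 0 →
        z ∈ resonances (V + W) ∧ HasResonanceMultiplicity (V + W) z 1 :=
      fun h => hzero z h2 h (hsimple _ h h1)
    exact ⟨⟨hres z h2, fun h => (h3 h).1⟩, fun h => (h3 (hres z h2 h)).2⟩
  have h2I : (2 * Complex.I : ℂ) ≠ 0 := by simp
  have htend : ∀ (ς : ℝ) (x : ℕ → ℂ),
      Tendsto (fun n => x n - approxZero (b - a) (j + k + 4) ρ ς n) atTop (𝓝 0) →
      Tendsto (fun n => x n / (2 * Complex.I) - logSequence (b - a) (j + k + 4)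
        (ρ / 2 ^ (j + k + 4)) ς n) atTop (𝓝 0) := by
    intro ς x hx
    have h1 := hx.div_const (2 * Complex.I)
    rw [zero_div] at h1
    refine h1.congr fun n => ?_
    rw [sub_div, approxZero, mul_div_cancel_left₀ _ h2I]
  have hinj : Function.Injective fun s : ℂ => s / (2 * Complex.I) := fun _ _ h => (div_left_inj' h2I).1 h
  have himage : ∀ (x : ℕ → ℂ) (N : ℕ), (fun n => x n / (2 * Complex.I)) '' Ioi N =
      (fun s : ℂ => s / (2 * Complex.I)) '' (x '' Ioi N) := fun x N => by
    rw [image_image]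
  refine ⟨R / 2, by positivity, Np, Nm, fun n => xp n / (2 * Complex.I),
    fun n => xm n / (2 * Complex.I), htend 1 xp hxp, htend (-1) xm hxm, ?_, ?_, ?_, ?_,
    fun z hz hzR => (hiff z hzR).2 hz⟩
  · rw [himage, himage, ← image_union, ← hset]
    ext z
    constructor
    · rintro ⟨hz, hzR⟩
      refine ⟨2 * Complex.I * z, ⟨(hiff z hzR).1.1 hz, ?_⟩, mul_div_cancel_left₀ _ h2I⟩
      have hzR' : R / 2 < ‖z‖ := hzR
      rw [norm_two_I_mul]
      linarith
    · rintro ⟨s, ⟨hs, hsR⟩, rfl⟩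
      have h1 : 2 * Complex.I * (s / (2 * Complex.I)) = s := mul_div_cancel₀ _ h2I
      have h2 : R / 2 < ‖s / (2 * Complex.I)‖ := by
        have h3 := norm_two_I_mul (s / (2 * Complex.I))
        rw [h1] at h3
        linarith
      exact ⟨(hiff _ h2).1.2 (by rw [h1]; exact hs), h2⟩
  · exact fun m hm n hn h => hip hm hn (hinj h)
  · exact fun m hm n hn h => him hm hn (hinj h)
  · rw [himage, himage]
    exact disjoint_image_of_injective hinj hdisj

end

end Resonances

end

theorem theorem3p1 (j k : ℕ) (a b : ℝ) (C₁ C₂ : ℂ) (V W : ℝ → ℂ)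
    (hV : Resonances.EndpointClass j k a b C₁ C₂ V)
    (hW : Resonances.MemLinftyComp W)
    (hsupp : Resonances.essSupport W ⊆ Set.Ioo a b) :
    (∃ M₀ : ℝ, 0 < M₀ ∧ ∀ M : ℝ, M₀ < M → ∃ R : ℝ, 0 < R ∧
      Resonances.resonances (V + W) ∩ (Resonances.aboveLogCurve M)ᶜ ∩ {z : ℂ | R < ‖z‖} = ∅) ∧
    (Resonances.essSupport W ⊆
        Set.Ioo (a + ((j : ℝ) + 1) * (b - a) / ((j : ℝ) + k + 4))
          (b - ((k : ℝ) + 1) * (b - a) / ((j : ℝ) + k + 4)) →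
      ∃ R : ℝ, 0 < R ∧ ∃ (Np Nm : ℕ) (zp zm : ℕ → ℂ),
        Tendsto (fun n => zp n - Resonances.logSequence (b - a) (j + k + 4)
          ((j.factorial : ℂ) * (k.factorial : ℂ) * C₁ * C₂ / 2 ^ (j + k + 4)) 1 n)
          atTop (𝓝 0) ∧
        Tendsto (fun n => zm n - Resonances.logSequence (b - a) (j + k + 4)
          ((j.factorial : ℂ) * (k.factorial : ℂ) * C₁ * C₂ / 2 ^ (j + k + 4)) (-1) n)
          atTop (𝓝 0) ∧
        Resonances.resonances (V + W) ∩ {z : ℂ | R < ‖z‖}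
          = zp '' Set.Ioi Np ∪ zm '' Set.Ioi Nm ∧
        Set.InjOn zp (Set.Ioi Np) ∧ Set.InjOn zm (Set.Ioi Nm) ∧
        Disjoint (zp '' Set.Ioi Np) (zm '' Set.Ioi Nm) ∧
        ∀ z ∈ Resonances.resonances (V + W), R < ‖z‖ →
          Resonances.HasResonanceMultiplicity (V + W) z 1) :=
  ⟨Resonances.resonance_free_region hV hW hsupp, Resonances.resonance_asymptotics hV hW⟩
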